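/- Let $\mathbb{R}^{n+d}=\mathbb{R}^n\times\mathbb{R}^d$ with coordinates $(x,h)$ and dual coordinates $(k,\xi)$. Let $\Omega\subset\mathbb{R}^n$ be open (for instance $\Omega=\mathbb{R}^n$), $I=\Omega\times\{0\}$, $C=\{(x,0;0,\xi): x\in\Omega,\ \xi\neq0\}$ its conormal without the zero section, and let $\mathcal{V}\subset\Omega\times\mathbb{R}^d$ be an open neighbourhood of $I$ which is $\rho$-convex for $\rho=h^j\partial_{h^j}$, i.e. $(x,h)\in\mathcal{V}$ implies $(x,\lambda h)\in\mathcal{V}$ for all $\lambda\in(0,1]$. For a function write $f_\lambda(x,h)=f(x,\lambda h)$, and for a distribution $\langle t_\lambda,\varphi\rangle=\lambda^{-d}\langle t,\varphi_{\lambda^{-1}}\rangle$. For an open $U$ and a set $\Gamma\subset T^\bullet U$ (the cotangent bundle without zero section), a set $B\subset\mathcal{D}'(U)$ is called bounded in $\mathcal{D}'_\Gamma(U)$ if $WF(u)\subset\Gamma$ for all $u\in B$, $\sup_{u\in B}|\langle u,\varphi\rangle|<\infty$ for every $\varphi\in\mathcal{D}(U)$, and $\sup_{u\in B}\sup_{\zeta\in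 V}(1+|\zeta|)^N|\widehat{u\chi}(\zeta)|<\infty$ for all $N\in\mathbb{N}$, all $\chi\in\mathcal{D}(U)$ and all closed cones $V\subset\mathbb{R}^{n+d}\setminus\{0\}$ with $(\operatorname{supp}\chi\times V)\cap\Gamma=\emptyset$. Let $s\in\mathbb{R}$, $t\in\mathcal{D}'(\mathcal{V}\setminus I)$ and $\Gamma=\bigcup_{\lambda\in(0,1]}WF(t_\lambda)$. Assume that $WF(t)$ satisfies the soft landing condition: every point of $I$ has a neighbourhood $U$ with $\varepsilon,\delta>0$ such that $WF(t)|_{U\cap\{|h|\le\varepsilon\}}\subset\{|k|\le\delta|h||\xi|\}$. Assume that $(\lambda^{-s}t_\lambda)_{\lambda\in(0,1]}$ is bounded in $\mathcal{D}'_\Gamma(\mathcal{V}\setminus I)$. A cutoff is a function $\chi\in C^\infty(\Omega\times\mathbb{R}^d)$ such that for every compact $K\subset\Omega$ there are $0<a<b$ with $\chi=1$ on $K\times\{|h|\le a\}$ and $\chi=0$ on $K\times\{|h|\ge b\}$. (1) Let $s+d>0$. For every cutoff $\chi$, the formula $$\langle\overline{t},\varphi\rangle=\lim_{\varepsilon\to0^+}\langle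 t(1-\chi_{\varepsilon^{-1}}),\varphi\rangle\qquad(\varphi\in\mathcal{D}(\mathcal{V}))$$ defines an extension $\overline{t}\in\mathcal{D}'(\mathcal{V})$ of $t$ with $WF(\overline{t})\subset WF(t)\cup C$, and $(\lambda^{-s}\overline{t}_\lambda)_{\lambda\in(0,1]}$ is bounded in $\mathcal{D}'_{\Gamma\cup C}(\mathcal{V})$. (2) Let $s+d\le0$ and let $m\in\mathbb{N}=\{0,1,2,\dots\}$ be such that $-m-1<s+d\le-m$. There is an open neighbourhood $\mathcal{N}\subset\mathcal{V}$ of $I$ such that for every cutoff $\chi$ whose support in $\Omega\times\mathbb{R}^d$ lies in $\mathcal{N}$, the formula $$\langle\overline{t},\varphi\rangle=\lim_{\varepsilon\to0^+}\Big(\langle t(\chi-\chi_{\varepsilon^{-1}}),\varphi\rangle-\Big\langle t(\chi-\chi_{\varepsilon^{-1}}),\sum_{|\alpha|\le m}\tfrac{h^\alpha}{\alpha!}(\partial_h^\alpha\varphi)(x,0)\Big\rangle\Big)+\langle t(1-\chi),\varphi\rangle$$ defines an extension $\overline{t}\in\mathcal{D}'(\mathcal{V})$ of $t$ with $WF(\overline{t})\subset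 WF(t)\cup C$. If $-s-d\notin\mathbb{N}$, then $(\lambda^{-s}\overline{t}_\lambda)_{\lambda\in(0,1]}$ is bounded in $\mathcal{D}'_{\Gamma\cup C}(\mathcal{V})$; if $-s-d\in\mathbb{N}$, then $(\lambda^{-s'}\overline{t}_\lambda)_{\lambda\in(0,1]}$ is bounded in $\mathcal{D}'_{\Gamma\cup C}(\mathcal{V})$ for every $s'<s$. -/

import Mathlib

open Set Filter Topology TopologicalSpace
open scoped ContDiff Distributions

noncomputable section

namespace Microlocal

/-! ### Space, cotangent space, scaling -/

/-- `ℝⁿ⁺ᵈ = ℝⁿ × ℝᵈ`, with points `(x, h)`. It is also used for covectors `(k, ξ)`, where `k` is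
dual to `x` and `ξ` is dual to `h`. -/
abbrev Sp (n d : ℕ) : Type := EuclideanSpace ℝ (Fin n) × EuclideanSpace ℝ (Fin d)

/-- `T*ℝⁿ⁺ᵈ`, with points `((x, h), (k, ξ))`. -/
abbrev Phase (n d : ℕ) : Type := Sp n d × Sp n d

variable {n d : ℕ}

/-- The duality `k·x + ξ·h`. -/
def pairing (ζ p : Sp n d) : ℝ := inner ℝ ζ.1 p.1 + inner ℝ ζ.2 p.2

/-- The size `|k| + |ξ|` of a covector. -/
def covNorm (ζ : Sp n d) : ℝ := ‖ζ.1‖ + ‖ζ.2‖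

/-- The dilation `(x, h) ↦ (x, c h)` in the variable `h`. -/
def dilation (c : ℝ) : Sp n d →L[ℝ] Sp n d :=
  (ContinuousLinearMap.fst ℝ _ _).prod (c • ContinuousLinearMap.snd ℝ _ _)

@[simp] theorem dilation_apply (c : ℝ) (p : Sp n d) : dilation c p = (p.1, c • p.2) := rfl

/-- `U` is `ρ`-convex (for `ρ = hʲ ∂/∂hʲ`): `(x, h) ∈ U` implies `(x, λ h) ∈ U` for `λ ∈ (0, 1]`. -/
def RhoConvex (U : Opens (Sp n d)) : Prop :=
  ∀ p ∈ U, ∀ l : Ioc (0 : ℝ) 1, dilation (l : ℝ) p ∈ U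

/-- The open set `U ∖ {h = 0}`. -/
def puncture (U : Opens (Sp n d)) : Opens (Sp n d) where
  carrier := {p | p ∈ U ∧ p.2 ≠ 0}
  is_open' := U.isOpen.inter (isClosed_singleton.preimage continuous_snd).isOpen_compl

theorem RhoConvex.puncture {U : Opens (Sp n d)} (hU : RhoConvex U) :
    RhoConvex (puncture U) := fun p hp l =>
  ⟨hU p hp.1 l, smul_ne_zero l.2.1.ne' hp.2⟩

/-! ### Distributions -/

/-- Complex distributions on the open set `U`: continuous `ℂ`-linear functionals on the space
`𝓓(U, ℂ)` of complex test functions with its canonical LF topology. -/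
abbrev CDistribution (U : Opens (Sp n d)) : Type := 𝓓(U, ℂ) →L[ℂ] ℂ

open Classical in
/-- The value of a distribution on a function which is a smooth function with compact support
in `U` (it is only applied to such functions). -/
def CDistribution.eval {U : Opens (Sp n d)} (t : CDistribution U) (f : Sp n d → ℂ) : ℂ :=
  if hf : ContDiff ℝ ∞ f ∧ HasCompactSupport f ∧ tsupport f ⊆ U then
    t ⟨f, hf.1, hf.2.1, hf.2.2⟩
  else 0

/-- The test function `φ_{λ⁻¹}(x, h) = φ(x, λ⁻¹ h)`. -/
def scaleTest {U : Opens (Sp n d)} (hU : RhoConvex U) (l : Ioc (0 : ℝ) 1) (φ : 𝓓(U, ℂ)) :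
    𝓓(U, ℂ) where
  toFun p := φ (dilation (l : ℝ)⁻¹ p)
  contDiff' := φ.contDiff.comp (dilation (l : ℝ)⁻¹).contDiff
  hasCompactSupport' := by
    refine HasCompactSupport.intro
      (φ.hasCompactSupport.isCompact.image (dilation (l : ℝ)).continuous) fun p hp => ?_
    refine image_eq_zero_of_notMem_tsupport fun h => hp ⟨_, h, ?_⟩
    ext1 <;> simp [smul_smul, mul_inv_cancel₀ l.2.1.ne']
  tsupport_subset' := fun p hp => by
    have h1 := φ.tsupport_subset
      (tsupport_comp_subset_preimage (φ : Sp n d → ℂ) (dilation (l : ℝ)⁻¹).continuous hp)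
    have h2 := hU _ h1 l
    have h3 : dilation (l : ℝ) (dilation (l : ℝ)⁻¹ p) = p := by
      ext1 <;> simp [smul_smul, mul_inv_cancel₀ l.2.1.ne']
    rwa [h3] at h2

@[simp] theorem scaleTest_apply {U : Opens (Sp n d)} (hU : RhoConvex U) (l : Ioc (0 : ℝ) 1)
    (φ : 𝓓(U, ℂ)) (p : Sp n d) : scaleTest hU l φ p = φ (dilation (l : ℝ)⁻¹ p) := rfl

theorem continuous_scaleTest_aux {U : Opens (Sp n d)} (hU : RhoConvex U) (l : Ioc (0 : ℝ) 1)
    (K : Compacts (Sp n d)) (hK : (K : Set (Sp n d)) ⊆ U) :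
    Continuous (scaleTest hU l ∘ TestFunction.ofSupportedIn hK : 𝓓_{K}(Sp n d, ℂ) → 𝓓(U, ℂ)) := by
  have hinv : ∀ p : Sp n d, dilation (l : ℝ) (dilation (l : ℝ)⁻¹ p) = p := fun p => by
    ext1 <;> simp [smul_smul, mul_inv_cancel₀ l.2.1.ne']
  let K' : Compacts (Sp n d) := K.map (dilation (l : ℝ)) (dilation (l : ℝ)).continuous
  have hK' : (K' : Set (Sp n d)) ⊆ U := by
    rintro _ ⟨p, hp, rfl⟩
    exact hU p (hK hp) l
  let L : Sp n d →L[ℝ] Sp n d := dilation (l : ℝ)⁻¹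
  let A : 𝓓_{K}(Sp n d, ℂ) →L[ℝ] 𝓓_{K'}(Sp n d, ℂ) :=
    ContDiffMapSupportedIn.mkCLM ℝ (fun f p => f (L p)) (fun _ _ _ => rfl) (fun _ _ _ => rfl)
      (fun f => f.contDiff.comp L.contDiff)
      (fun f p hp => f.zero_on_compl fun h => hp ⟨_, h, hinv p⟩)
      (fun i _ => ⟨{i}, ‖L‖ ^ i, by positivity, fun f x _ => by
        have h1 : iteratedFDeriv ℝ i (fun p => f (L p)) x =
            (iteratedFDeriv ℝ i f (L x)).compContinuousLinearMap fun _ => L :=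
          L.iteratedFDeriv_comp_right f.contDiff x (mod_cast le_top)
        rw [h1]
        refine (ContinuousMultilinearMap.norm_compContinuousLinearMap_le _ _).trans ?_
        rw [Finset.sup_singleton, Finset.prod_const, Finset.card_univ, Fintype.card_fin, mul_comm]
        gcongr
        exact ContDiffMapSupportedIn.norm_iteratedFDeriv_apply_le_seminorm_top ℝ⟩)
  exact (TestFunction.continuous_ofSupportedIn hK').comp A.continuous

/-- The scaled distribution `t_λ`, `⟨t_λ, φ⟩ = λ⁻ᵈ ⟨t, φ_{λ⁻¹}⟩`; for a function `t` this is
`t_λ(x, h) = t(x, λ h)`. -/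
def scale {U : Opens (Sp n d)} (hU : RhoConvex U) (l : Ioc (0 : ℝ) 1) (t : CDistribution U) : CDistribution U :=
  (((l : ℝ) ^ d)⁻¹ : ℂ) • t.comp
    (TestFunction.mkCLM ℂ (scaleTest hU l) (fun _ _ => rfl) (fun _ _ => rfl)
      (continuous_scaleTest_aux hU l))

theorem scale_apply {U : Opens (Sp n d)} (hU : RhoConvex U) (l : Ioc (0 : ℝ) 1) (t : CDistribution U)
    (φ : 𝓓(U, ℂ)) : scale hU l t φ = (((l : ℝ) ^ d)⁻¹ : ℂ) * t (scaleTest hU l φ) := rfl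

/-! ### Wave front sets and the spaces `𝓓'_Γ` -/

/-- The test function `χ e_ζ`, `e_ζ(p) = exp(-i ζ·p)`. -/
def expMul {U : Opens (Sp n d)} (χ : 𝓓(U, ℂ)) (ζ : Sp n d) : 𝓓(U, ℂ) where
  toFun p := Complex.exp (-(Complex.I * (pairing ζ p : ℂ))) * χ p
  contDiff' := by
    refine ContDiff.mul ?_ χ.contDiff
    refine ContDiff.cexp (ContDiff.neg (contDiff_const.mul ?_))
    refine Complex.ofRealCLM.contDiff.comp ?_
    change ContDiff ℝ ∞ fun p : Sp n d => (inner ℝ ζ.1 p.1 + inner ℝ ζ.2 p.2 : ℝ)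
    exact (contDiff_const.inner ℝ contDiff_fst).add (contDiff_const.inner ℝ contDiff_snd)
  hasCompactSupport' := χ.hasCompactSupport.mul_left
  tsupport_subset' := (tsupport_mul_subset_right).trans χ.tsupport_subset

/-- The Fourier transform `\widehat{tχ}(ζ) = ⟨t, χ e_ζ⟩`. -/
def localFourier {U : Opens (Sp n d)} (t : CDistribution U) (χ : 𝓓(U, ℂ)) (ζ : Sp n d) : ℂ :=
  t (expMul χ ζ)

/-- Invariance of a set of covectors under multiplication by positive reals. -/
def IsConic (V : Set (Sp n d)) : Prop := ∀ ζ ∈ V, ∀ c : ℝ, 0 < c → c • ζ ∈ V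

/-- The wave front set of `t`, a subset of `T•U`: `(p, η)` with `p ∈ U`, `η ≠ 0` does not belong
to it iff there are a test function `χ` with `χ(p) ≠ 0` and a conic neighbourhood `V` of `η` such
that `\widehat{tχ}` is rapidly decreasing in `V`. -/
def WF {U : Opens (Sp n d)} (t : CDistribution U) : Set (Phase n d) :=
  {q | q.1 ∈ U ∧ q.2 ≠ 0 ∧
    ¬ ∃ (χ : 𝓓(U, ℂ)) (V : Set (Sp n d)), χ q.1 ≠ 0 ∧ IsConic V ∧ V ∈ 𝓝 q.2 ∧
      ∀ N : ℕ, ∃ C : ℝ, ∀ ζ ∈ V, (1 + covNorm ζ) ^ N * ‖localFourier t χ ζ‖ ≤ C}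

/-- `V` is a closed cone in `ℝⁿ⁺ᵈ ∖ {0}` (closed relatively to `ℝⁿ⁺ᵈ ∖ {0}`). -/
def IsClosedCone (V : Set (Sp n d)) : Prop :=
  0 ∉ V ∧ IsConic V ∧ IsClosed (insert 0 V)

/-- The set `B` of distributions on `U` is bounded in `𝓓'_Γ`: it consists of distributions with
wave front set in `Γ`, it is (weakly) bounded in `𝓓'`, and every seminorm
`‖t‖_{N,V,χ} = sup_{ζ ∈ V} (1 + |ζ|)^N |\widehat{tχ}(ζ)|`, where `χ` is a test function and `V` a
closed cone with `(supp χ × V) ∩ Γ = ∅`, is bounded on `B`. -/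
def BoundedIn {U : Opens (Sp n d)} (Γ : Set (Phase n d)) (B : Set (CDistribution U)) : Prop :=
  (∀ t ∈ B, WF t ⊆ Γ) ∧
  (∀ φ : 𝓓(U, ℂ), ∃ C : ℝ, ∀ t ∈ B, ‖t φ‖ ≤ C) ∧
  (∀ (N : ℕ) (V : Set (Sp n d)) (χ : 𝓓(U, ℂ)), IsClosedCone V → (tsupport χ ×ˢ V) ∩ Γ = ∅ →
    ∃ C : ℝ, ∀ t ∈ B, ∀ ζ ∈ V, (1 + covNorm ζ) ^ N * ‖localFourier t χ ζ‖ ≤ C)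

/-- The family `(λ^{-s} t_λ)`, `λ ∈ (0, 1]`. -/
def scaledFamily {U : Opens (Sp n d)} (hU : RhoConvex U) (s : ℝ) (t : CDistribution U) : Set (CDistribution U) :=
  range fun l : Ioc (0 : ℝ) 1 => (((l : ℝ) ^ (-s) : ℝ) : ℂ) • scale hU l t

/-- `Γ = ⋃_{λ ∈ (0, 1]} WF(t_λ)`. -/
def scaledWF {U : Opens (Sp n d)} (hU : RhoConvex U) (t : CDistribution U) : Set (Phase n d) :=
  ⋃ l : Ioc (0 : ℝ) 1, WF (scale hU l t)

/-! ### The submanifold `I = Ω × {0}`: conormal, soft landing condition, cutoffs -/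

/-- The conormal `C = {(x, 0; 0, ξ) | ξ ≠ 0}` of `I = Ω × {0}` without the zero section. -/
def conormal (Ω : Opens (EuclideanSpace ℝ (Fin n))) : Set (Phase n d) :=
  {q | q.1.1 ∈ Ω ∧ q.1.2 = 0 ∧ q.2.1 = 0 ∧ q.2.2 ≠ 0}

/-- The soft landing condition: every point of `I = Ω × {0}` has a neighbourhood `U` such that
`Γ|_{U ∩ {|h| ≤ ε}} ⊆ {|k| ≤ δ |h| |ξ|}` for some `ε, δ > 0`. -/
def SoftLanding (Ω : Opens (EuclideanSpace ℝ (Fin n))) (Γ : Set (Phase n d)) : Prop :=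
  ∀ x ∈ Ω, ∃ U ∈ 𝓝 ((x, 0) : Sp n d), ∃ ε > 0, ∃ δ > 0, ∀ q ∈ Γ, q.1 ∈ U → ‖q.1.2‖ ≤ ε →
    ‖q.2.1‖ ≤ δ * ‖q.1.2‖ * ‖q.2.2‖

/-- `χ` is a smooth cutoff function for `I = Ω × {0}`: it is smooth on `Ω × ℝᵈ` and for every
compact `K ⊆ Ω` there are `0 < a < b` with `χ = 1` on `K × {|h| ≤ a}` and `χ = 0` on
`K × {|h| ≥ b}`. Its values outside `Ω × ℝᵈ` are irrelevant. -/
def IsCutoff (Ω : Opens (EuclideanSpace ℝ (Fin n))) (χ : Sp n d → ℝ) : Prop :=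
  ContDiffOn ℝ ∞ χ {p | p.1 ∈ Ω} ∧
  ∀ K : Set (EuclideanSpace ℝ (Fin n)), IsCompact K → K ⊆ Ω → ∃ a b : ℝ, 0 < a ∧ a < b ∧
    ∀ x ∈ K, ∀ h, (‖h‖ ≤ a → χ (x, h) = 1) ∧ (b ≤ ‖h‖ → χ (x, h) = 0)

/-- The support of `χ` in `Ω × ℝᵈ` is contained in `A`. -/
def CutoffSupportedIn (Ω : Opens (EuclideanSpace ℝ (Fin n))) (χ : Sp n d → ℝ)
    (A : Set (Sp n d)) : Prop :=
  ∀ p ∈ closure (Function.support χ), p.1 ∈ Ω → p ∈ A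

/-! ### The extension -/

/-- `tbar` extends `t` from `U ∖ {h = 0}` to `U`. -/
def IsExtension {U : Opens (Sp n d)} (t : CDistribution (puncture U)) (tbar : CDistribution U) : Prop :=
  ∀ φ : 𝓓(puncture U, ℂ), tbar (TestFunction.monoCLM ℂ φ) = t φ

/-- `⟨tbar, φ⟩ = lim_{ε → 0} ⟨t (1 - χ_{ε⁻¹}), φ⟩`, where `χ_{ε⁻¹}(x, h) = χ(x, h/ε)`. -/
def IsCutoffLimit {U : Opens (Sp n d)} (t : CDistribution (puncture U)) (χ : Sp n d → ℝ)
    (tbar : CDistribution U) : Prop :=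
  ∀ φ : 𝓓(U, ℂ),
    Tendsto (fun ε : ℝ => t.eval fun p => ((1 - χ (dilation ε⁻¹ p) : ℝ) : ℂ) * φ p)
      (𝓝[>] 0) (𝓝 (tbar φ))

/-- The Taylor polynomial `∑_{|α| ≤ m} h^α / α! (∂_h^α φ)(x, 0)` of `φ` in the variable `h`, written
as `∑_{j ≤ m} 1/j! D^jφ(x, 0)[(0, h), …, (0, h)]`. -/
def taylorH (m : ℕ) (φ : Sp n d → ℂ) (p : Sp n d) : ℂ :=
  ∑ j ∈ Finset.range (m + 1),
    ((j.factorial : ℂ)⁻¹) * iteratedFDeriv ℝ j φ (p.1, 0) fun _ => (0, p.2)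

/-- `⟨tbar, φ⟩ = lim_{ε → 0} (⟨t (χ - χ_{ε⁻¹}), φ⟩ - ⟨c_ε, φ⟩) + ⟨t (1 - χ), φ⟩` with the local
counterterms `⟨c_ε, φ⟩ = ⟨t (χ - χ_{ε⁻¹}), ∑_{|α| ≤ m} h^α / α! (∂_h^α φ)(x, 0)⟩`. -/
def IsRenormalizedLimit {U : Opens (Sp n d)} (t : CDistribution (puncture U)) (m : ℕ) (χ : Sp n d → ℝ)
    (tbar : CDistribution U) : Prop :=
  ∀ φ : 𝓓(U, ℂ),
    Tendsto (fun ε : ℝ =>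
        ((t.eval fun p => ((χ p - χ (dilation ε⁻¹ p) : ℝ) : ℂ) * φ p) -
          (t.eval fun p => ((χ p - χ (dilation ε⁻¹ p) : ℝ) : ℂ) * taylorH m φ p)) +
        t.eval fun p => ((1 - χ p : ℝ) : ℂ) * φ p)
      (𝓝[>] 0) (𝓝 (tbar φ))

end Microlocal

end

open Microlocal

/-!
The limit is a telescoping sum over dyadic scales. Write `S_λ` for the contribution of the shell
`|h| ∼ λ` to the pairing of `t` with a test function. By scaling, `S_λ` is `λ^{s+d}` times the pairing
of a member of the bounded family `λ^{-s} t_λ` with the test function dilated by `λ` and cut off to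
the fixed shell `|h| ∼ 1` (`shellEval_div_sub`). If the Taylor polynomial in `h` with `M` terms has
been subtracted, the dilated remainder is `O(λ^M)`, so `S_λ = O(λ^{s+d+M})` and the sum converges
when `s + d + M > 0` (`exists_tendsto_shellEval`). The subtracted terms, of degree `j < M`, are of
size `λ^{s+d+j}` on the shell; as `s + d + j < 0`, their sum over the scales between `λ` and `1` is of
the same order (`exists_shellEval_normalDeriv_le`).

To bound the scaled family of the extension, apply the regularized functional to a test function
dilated by `m⁻¹` (`regularized_comp_dilation`). Scales below `m` give the same convergent sum for the
distribution rescaled by `m`, and scales between `m` and `1` only see the counterterms; both are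
`O(m^{s+d})`, which is the claimed homogeneity (`exists_tendsto_regularized`). When `s + d = 1 - M`,
the counterterm of degree `M - 1` would diverge logarithmically, and everything is done with
exponents slightly smaller than `s`; the limit does not depend on the exponent.

For wave front sets, the same estimate is applied to test functions multiplied by the exponential of
a covector `(k, ξ)`, uniformly in the covector. Dilating by `λ` turns `ξ` into `λξ`, and the Taylor
remainder costs at most a factor `(1 + |ξ|)^M` (`exists_bound_remainder`), which rapid decrease
absorbs. What is needed is rapid decrease of the bounded family in the directions `(k, λξ)`,
`λ ∈ [0, 1]`, on a shell which may be chosen close to `{h = 0}`. Soft landing provides it if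
`|k| ≥ c|ξ|`, that is, in any closed cone without conormal covectors (`exists_cone_bound`). The
counterterms only see the directions `(k, 0)`, but on the full support of the cutoff; this is why the
cutoff has to be supported in a neighbourhood `𝒩` over which the wave front sets of the family have
no such covectors (`SoftLanding.exists_nhds`).

Two tools replace estimates of convolutions. Uniformity comes from the Banach–Steinhaus theorem: a
family of functionals of finite order which is bounded on each smooth function supported in a
compact set is bounded by a fixed number of derivatives (`FiniteOrder.uniform_bound`), hence on
functions depending smoothly on a parameter in a compact set (`FiniteOrder.param_bound`). And soft
landing passes from `WF(t)` to the wave front sets of the `t_λ` because rapid decrease survives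
localization (`DecaysAt.localize`), which is proved by expanding the localizing function of each
coordinate into a trigonometric series with rapidly decreasing coefficients.
-/

noncomputable section

namespace Microlocal

/-! ### Functionals of finite order on smooth functions supported in a fixed set -/

section FiniteOrder

variable {E : Type*} [NormedAddCommGroup E] [NormedSpace ℝ E] {L : Set E} {T : (E → ℂ) → ℂ}

/-- `g` is smooth and vanishes off `L`. -/
structure SmoothIn (L : Set E) (g : E → ℂ) : Prop where
  contDiff : ContDiff ℝ ∞ g
  zero_off : ∀ p, p ∉ L → g p = 0

/-- All derivatives of `g` of order at most `k` are bounded by `B`. -/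
def DerivBound (k : ℕ) (B : ℝ) (g : E → ℂ) : Prop :=
  ∀ j ≤ k, ∀ x, ‖iteratedFDeriv ℝ j g x‖ ≤ B

/-- `T` is linear on the smooth functions vanishing off `L` and bounded there by the supremum of
finitely many derivatives. Its values at other functions are irrelevant. -/
structure FiniteOrder (L : Set E) (T : (E → ℂ) → ℂ) : Prop where
  map_add : ∀ f g, SmoothIn L f → SmoothIn L g → T (fun p => f p + g p) = T f + T g
  map_smul : ∀ (c : ℂ) f, SmoothIn L f → T (fun p => c * f p) = c * T f
  bound : ∃ (k : ℕ) (C : ℝ), 0 ≤ C ∧ ∀ g, SmoothIn L g → ∀ B, DerivBound k B g → ‖T g‖ ≤ C * B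

theorem SmoothIn.mono {L' : Set E} {g : E → ℂ} (hg : SmoothIn L g) (h : L ⊆ L') : SmoothIn L' g :=
  ⟨hg.contDiff, fun p hp => hg.zero_off p fun h' => hp (h h')⟩

theorem SmoothIn.add {f g : E → ℂ} (hf : SmoothIn L f) (hg : SmoothIn L g) :
    SmoothIn L fun p => f p + g p :=
  ⟨hf.contDiff.add hg.contDiff, fun p hp => by simp [hf.zero_off p hp, hg.zero_off p hp]⟩

theorem SmoothIn.sub {f g : E → ℂ} (hf : SmoothIn L f) (hg : SmoothIn L g) :
    SmoothIn L fun p => f p - g p :=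
  ⟨hf.contDiff.sub hg.contDiff, fun p hp => by simp [hf.zero_off p hp, hg.zero_off p hp]⟩

theorem SmoothIn.mul_left {f g : E → ℂ} (hf : ContDiff ℝ ∞ f) (hg : SmoothIn L g) :
    SmoothIn L fun p => f p * g p :=
  ⟨hf.mul hg.contDiff, fun p hp => by simp [hg.zero_off p hp]⟩

theorem SmoothIn.mul_right {f g : E → ℂ} (hf : SmoothIn L f) (hg : ContDiff ℝ ∞ g) :
    SmoothIn L fun p => f p * g p :=
  ⟨hf.contDiff.mul hg, fun p hp => by simp [hf.zero_off p hp]⟩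

theorem SmoothIn.const_mul {g : E → ℂ} (c : ℂ) (hg : SmoothIn L g) :
    SmoothIn L fun p => c * g p := .mul_left contDiff_const hg

theorem SmoothIn.zero : SmoothIn L fun _ : E => (0 : ℂ) := ⟨contDiff_const, fun _ _ => rfl⟩

theorem SmoothIn.sum {ι : Type*} (s : Finset ι) {g : ι → E → ℂ} (hg : ∀ i ∈ s, SmoothIn L (g i)) :
    SmoothIn L fun p => ∑ i ∈ s, g i p :=
  ⟨ContDiff.sum fun i hi => (hg i hi).contDiff, fun p hp =>
    Finset.sum_eq_zero fun i hi => (hg i hi).zero_off p hp⟩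

theorem FiniteOrder.map_zero (hT : FiniteOrder L T) : T (fun _ => 0) = 0 := by
  simpa using hT.map_smul 0 (fun _ => 0) .zero

theorem FiniteOrder.map_sub (hT : FiniteOrder L T) {f g : E → ℂ} (hf : SmoothIn L f)
    (hg : SmoothIn L g) : T (fun p => f p - g p) = T f - T g := by
  have h1 := hT.map_add f (fun p => (-1) * g p) hf (hg.const_mul _)
  rw [hT.map_smul _ _ hg] at h1
  simpa [sub_eq_add_neg] using h1

theorem FiniteOrder.map_sum (hT : FiniteOrder L T) {ι : Type*} (s : Finset ι) {g : ι → E → ℂ}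
    (hg : ∀ i ∈ s, SmoothIn L (g i)) : T (fun p => ∑ i ∈ s, g i p) = ∑ i ∈ s, T (g i) := by
  classical
  induction s using Finset.induction_on with
  | empty => simpa using hT.map_zero
  | insert a s ha ih =>
    simp_rw [Finset.sum_insert ha]
    rw [hT.map_add _ _ (hg a (by simp)) (.sum s fun i hi => hg i (by simp [hi])),
      ih fun i hi => hg i (by simp [hi])]

theorem FiniteOrder.const_mul (hT : FiniteOrder L T) (c : ℂ) :
    FiniteOrder L fun g => c * T g := by
  obtain ⟨k, C, hC, hb⟩ := hT.bound
  refine ⟨fun f g hf hg => by simp only [hT.map_add f g hf hg]; ring,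
    fun b f hf => by simp only [hT.map_smul b f hf]; ring, k, ‖c‖ * C, by positivity,
    fun g hg B hB => ?_⟩
  rw [norm_mul, mul_assoc]
  gcongr
  exact hb g hg B hB

theorem FiniteOrder.add {S : (E → ℂ) → ℂ} (hT : FiniteOrder L T) (hS : FiniteOrder L S) :
    FiniteOrder L fun g => T g + S g := by
  obtain ⟨k, C, hC, hb⟩ := hT.bound
  obtain ⟨k', C', hC', hb'⟩ := hS.bound
  refine ⟨fun f g hf hg => by simp only [hT.map_add f g hf hg, hS.map_add f g hf hg]; ring,
    fun b f hf => by simp only [hT.map_smul b f hf, hS.map_smul b f hf]; ring, max k k', C + C',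
    by positivity, fun g hg B hB => ?_⟩
  rw [add_mul]
  exact (norm_add_le _ _).trans (add_le_add
    (hb g hg B fun j hj => hB j (hj.trans (le_max_left _ _)))
    (hb' g hg B fun j hj => hB j (hj.trans (le_max_right _ _))))

theorem FiniteOrder.sub {S : (E → ℂ) → ℂ} (hT : FiniteOrder L T) (hS : FiniteOrder L S) :
    FiniteOrder L fun g => T g - S g := by
  simpa [sub_eq_add_neg] using hT.add (hS.const_mul (-1))

theorem FiniteOrder.sum {ι : Type*} (s : Finset ι) {T : ι → (E → ℂ) → ℂ}
    (hT : ∀ i ∈ s, FiniteOrder L (T i)) : FiniteOrder L fun g => ∑ i ∈ s, T i g := by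
  classical
  induction s using Finset.induction_on with
  | empty => exact ⟨by simp, by simp, 0, 0, le_rfl, by simp⟩
  | insert a s ha ih =>
    simp_rw [Finset.sum_insert ha]
    exact (hT a (by simp)).add (ih fun i hi => hT i (by simp [hi]))

/-- A functional of finite order may be applied term by term to a series all of whose derivatives
converge normally. -/
theorem FiniteOrder.hasSum (hT : FiniteOrder L T) {ι : Type*} {g : ι → E → ℂ} {v : ℕ → ι → ℝ}
    (hg : ∀ i, SmoothIn L (g i)) (hv : ∀ k, Summable (v k))
    (hgv : ∀ k i x, ‖iteratedFDeriv ℝ k (g i) x‖ ≤ v k i) :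
    SmoothIn L (fun x => ∑' i, g i x) ∧ HasSum (fun i => T (g i)) (T fun x => ∑' i, g i x) := by
  classical
  have key : ∀ s : Set ι, SmoothIn L (fun x => ∑' i : s, g i x) ∧
      ∀ k x, ‖iteratedFDeriv ℝ k (fun x => ∑' i : s, g i x) x‖ ≤ ∑' i : s, v k i := by
    intro s
    have hs : ∀ k : ℕ, Summable fun i : s => v k i := fun k => (hv k).subtype s
    refine ⟨⟨contDiff_tsum (N := ⊤) (v := fun k (i : s) => v k i) (fun i => (hg i).contDiff)
      (fun k _ => hs k) (fun k i x _ => hgv k i x), fun p hp => ?_⟩, fun k x => ?_⟩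
    · simp [fun i => (hg i).zero_off p hp]
    · rw [iteratedFDeriv_tsum_apply (N := ⊤) (v := fun k (i : s) => v k i)
        (fun i : s => (hg i).contDiff) (fun k _ => hs k) (fun k i x _ => hgv k i x) le_top]
      exact tsum_of_norm_bounded (hs k).hasSum fun i => hgv k i x
  have huniv : SmoothIn L (fun x => ∑' i, g i x) := by
    have h := (key univ).1
    have h2 : (fun x => ∑' i : (univ : Set ι), g i x) = fun x => ∑' i, g i x := by
      ext x; exact tsum_univ fun i => g i x
    rwa [h2] at h
  refine ⟨huniv, ?_⟩
  obtain ⟨k, C, hC, hb⟩ := hT.bound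
  have hsumm : ∀ x, Summable fun i => g i x := fun x => by
    refine .of_norm_bounded (hv 0) fun i => ?_
    simpa using hgv 0 i x
  have hV : Summable fun i => ∑ j ∈ Finset.range (k + 1), v j i :=
    summable_sum fun j _ => hv j
  have hv0 : ∀ j i, 0 ≤ v j i := fun j i => (norm_nonneg _).trans (hgv j i 0)
  have htend : Tendsto (fun s : Finset ι =>
      C * ∑' i : {i // i ∉ s}, ∑ j ∈ Finset.range (k + 1), v j i) atTop (𝓝 0) := by
    simpa using (tendsto_tsum_compl_atTop_zero
      (fun i => ∑ j ∈ Finset.range (k + 1), v j i)).const_mul C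
  rw [HasSum, tendsto_iff_norm_sub_tendsto_zero]
  refine squeeze_zero (fun _ => norm_nonneg _) (fun s => ?_) htend
  have hk := key {i | i ∉ s}
  have e1 : (fun x => ∑' i : {i | i ∉ s}, g i x) =
      fun x => (∑' i, g i x) - ∑ i ∈ s, g i x := by
    ext x
    have := (hsumm x).sum_add_tsum_compl (s := s)
    rw [← this]
    simp only [add_sub_cancel_left]
    rfl
  rw [e1] at hk
  have e2 : ∑ i ∈ s, T (g i) - T (fun x => ∑' i, g i x) =
      - T (fun x => (∑' i, g i x) - ∑ i ∈ s, g i x) := by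
    rw [hT.map_sub huniv (.sum s fun i _ => hg i), hT.map_sum s fun i _ => hg i]; ring
  rw [e2, norm_neg]
  refine hb _ hk.1 _ fun j hj x => (hk.2 j x).trans ?_
  refine Summable.tsum_le_tsum (fun i => ?_) ((hv j).subtype _) (hV.subtype _)
  exact Finset.single_le_sum (f := fun j => v j i) (fun j _ => hv0 j _)
    (Finset.mem_range.2 (Nat.lt_succ_of_le hj))

/-- A smooth function vanishing off a compact set has bounded derivatives. -/
theorem SmoothIn.exists_derivBound (hL : IsCompact L) {g : E → ℂ} (hg : SmoothIn L g) (k : ℕ) :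
    ∃ B, 0 ≤ B ∧ ∀ x, ‖iteratedFDeriv ℝ k g x‖ ≤ B := by
  have hc : HasCompactSupport g := HasCompactSupport.intro hL fun p hp => hg.zero_off p hp
  obtain ⟨B, hB⟩ := (hc.iteratedFDeriv k).exists_bound_of_continuous
    (hg.contDiff.continuous_iteratedFDeriv (mod_cast le_top))
  exact ⟨B, (norm_nonneg _).trans (hB 0), hB⟩

/-- The uniform boundedness principle: a pointwise bounded family of functionals of finite order on
the smooth functions supported in a compact set has uniformly bounded order and constants. If this
failed, there would be `g_n` with derivatives up to order `n` bounded by `1` on which the family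
takes values larger than `n`; but it induces, by `a ↦ ∑ a_n g_n`, a pointwise bounded, hence bounded
family of functionals on `ℓ¹`. -/
theorem FiniteOrder.uniform_bound (hL : IsCompact L) {ι : Type*} {T : ι → (E → ℂ) → ℂ}
    (hT : ∀ i, FiniteOrder L (T i)) (hpt : ∀ g, SmoothIn L g → ∃ C, ∀ i, ‖T i g‖ ≤ C) :
    ∃ (k : ℕ) (C : ℝ), 0 ≤ C ∧
      ∀ i g, SmoothIn L g → ∀ B, DerivBound k B g → ‖T i g‖ ≤ C * B := by
  by_contra hcon
  push Not at hcon
  -- Otherwise there are `g_N` with derivatives up to order `N` bounded by one, on which some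
  -- functional exceeds `N`.
  have h1 : ∀ N : ℕ, ∃ i g, SmoothIn L g ∧ DerivBound N 1 g ∧ (N : ℝ) < ‖T i g‖ := by
    intro N
    obtain ⟨i, g, hg, B, hB, hlt⟩ := hcon N N (Nat.cast_nonneg N)
    have hB0 : 0 ≤ B := (norm_nonneg _).trans (hB 0 (Nat.zero_le _) 0)
    have hBpos : 0 < B := by
      rcases hB0.lt_or_eq with h | h
      · exact h
      · exfalso
        have hz : g = fun _ => 0 := by
          ext x
          have := hB 0 (Nat.zero_le _) x
          rw [← h] at this
          simpa using this
        rw [hz, (hT i).map_zero, ← h] at hlt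
        simp at hlt
    refine ⟨i, fun p => ((B⁻¹ : ℝ) : ℂ) * g p, hg.const_mul _, fun j hj x => ?_, ?_⟩
    · have : (fun p => ((B⁻¹ : ℝ) : ℂ) * g p) = (((B⁻¹ : ℝ) : ℂ)) • g := rfl
      rw [this, iteratedFDeriv_const_smul_apply (hg.contDiff.contDiffAt.of_le (mod_cast le_top)),
        norm_smul, Complex.norm_real, norm_inv, Real.norm_of_nonneg hB0, inv_mul_le_iff₀ hBpos,
        mul_one]
      exact hB j hj x
    · rw [(hT i).map_smul _ _ hg, norm_mul, Complex.norm_real, norm_inv, Real.norm_of_nonneg hB0,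
        lt_inv_mul_iff₀ hBpos, mul_comm]
      exact hlt
  choose i g hg hgb hlt using h1
  have hD : ∀ k n, ∃ D, 0 ≤ D ∧ ∀ x, ‖iteratedFDeriv ℝ k (g n) x‖ ≤ D :=
    fun k n => (hg n).exists_derivBound hL k
  choose D hD0 hD using hD
  -- A bound for the `k`-th derivatives of all `g_n`: only those with `n < k` are not bounded by one.
  let M : ℕ → ℝ := fun k => 1 + ∑ n ∈ Finset.range k, D k n
  have hM : ∀ k n x, ‖iteratedFDeriv ℝ k (g n) x‖ ≤ M k := by
    intro k n x
    have h0 : 0 ≤ ∑ n ∈ Finset.range k, D k n := Finset.sum_nonneg fun n _ => hD0 k n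
    by_cases hn : k ≤ n
    · exact (hgb n k hn x).trans (by simp only [M]; linarith)
    · refine (hD k n x).trans ((Finset.single_le_sum (f := fun n => D k n) (fun n _ => hD0 k n)
        (Finset.mem_range.2 (not_le.1 hn))).trans (by simp only [M]; linarith))
  have hM0 : ∀ k, 0 ≤ M k := fun k => (norm_nonneg _).trans (hM k 0 0)
  have hsum : ∀ a : lp (fun _ : ℕ => ℂ) 1, Summable fun n => ‖a n‖ := fun a => by
    simpa using (lp.memℓp a).summable (by simp)
  have hnorm : ∀ a : lp (fun _ : ℕ => ℂ) 1, ‖a‖ = ∑' n, ‖a n‖ := fun a => by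
    simpa using lp.norm_eq_tsum_rpow (p := 1) (by simp) a
  have hder : ∀ (a : lp (fun _ : ℕ => ℂ) 1) k n x,
      ‖iteratedFDeriv ℝ k (fun p => a n * g n p) x‖ ≤ ‖a n‖ * M k := by
    intro a k n x
    have : (fun p => a n * g n p) = a n • g n := rfl
    rw [this, iteratedFDeriv_const_smul_apply ((hg n).contDiff.contDiffAt.of_le (mod_cast le_top)),
      norm_smul]
    gcongr
    exact hM k n x
  have hH : ∀ j (a : lp (fun _ : ℕ => ℂ) 1), SmoothIn L (fun x => ∑' n, a n * g n x) ∧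
      HasSum (fun n => a n * T j (g n)) (T j fun x => ∑' n, a n * g n x) := by
    intro j a
    have := (hT j).hasSum (g := fun n p => a n * g n p) (v := fun k n => ‖a n‖ * M k)
      (fun n => (hg n).const_mul _) (fun k => (hsum a).mul_right _) (hder a)
    simpa only [(hT j).map_smul _ _ (hg _)] using this
  have hbd : ∀ j, ∃ C, ∀ n, ‖T j (g n)‖ ≤ C := by
    intro j
    obtain ⟨k, C, hC, hb⟩ := (hT j).bound
    refine ⟨C * ∑ l ∈ Finset.range (k + 1), M l, fun n => hb _ (hg n) _ fun l hl x =>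
      (hM l n x).trans ?_⟩
    exact Finset.single_le_sum (f := M) (fun l _ => hM0 l) (Finset.mem_range.2 (by omega))
  choose b hb using hbd
  let S : ι → lp (fun _ : ℕ => ℂ) 1 →L[ℂ] ℂ := fun j => LinearMap.mkContinuous
    { toFun := fun a => ∑' n, a n * T j (g n)
      map_add' := fun a a' => by
        rw [← ((hH j a).2.summable).tsum_add ((hH j a').2.summable)]
        simp [add_mul]
      map_smul' := fun c a => by
        simp only [lp.coeFn_smul, Pi.smul_apply, smul_eq_mul, mul_assoc, tsum_mul_left,
          RingHom.id_apply] } (b j) fun a => by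
      simp only [LinearMap.coe_mk, AddHom.coe_mk]
      rw [mul_comm, hnorm, ← tsum_mul_right]
      refine tsum_of_norm_bounded ((hsum a).mul_right _).hasSum fun n => ?_
      rw [norm_mul]
      gcongr
      exact hb j n
  obtain ⟨C, hC⟩ := banach_steinhaus (g := S) fun a => by
    obtain ⟨C, hC⟩ := hpt (fun x => ∑' n, a n * g n x)
      ((hH (i 0) a).1)
    refine ⟨C, fun j => ?_⟩
    have : S j a = T j fun x => ∑' n, a n * g n x := (hH j a).2.tsum_eq
    rw [this]
    exact hC j
  obtain ⟨N, hN⟩ := exists_nat_gt C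
  let e : lp (fun _ : ℕ => ℂ) 1 := lp.single 1 N (1 : ℂ)
  have he : ‖e‖ = 1 := by simp [e, lp.norm_single]
  have hS : S (i N) e = T (i N) (g N) := by
    change ∑' n, e n * T (i N) (g n) = _
    rw [tsum_eq_single N fun n hn => by simp [e, hn]]
    simp [e]
  have := (S (i N)).le_of_opNorm_le (hC (i N)) e
  rw [hS, he, mul_one] at this
  linarith [hlt N]

/-- A pointwise limit of functionals of finite order has finite order. -/
theorem FiniteOrder.of_tendsto (hL : IsCompact L) {S : ℕ → (E → ℂ) → ℂ}
    (hS : ∀ i, FiniteOrder L (S i))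
    (hlim : ∀ g, SmoothIn L g → Tendsto (fun i => S i g) atTop (𝓝 (T g))) : FiniteOrder L T := by
  obtain ⟨k, C, hC, hb⟩ := FiniteOrder.uniform_bound hL hS fun g hg => by
    obtain ⟨C, hC⟩ := (Metric.isBounded_range_of_tendsto _ (hlim g hg)).exists_norm_le
    exact ⟨C, fun i => hC _ ⟨i, rfl⟩⟩
  refine ⟨fun f g hf hg => ?_, fun c f hf => ?_, k, C, hC, fun g hg B hB => ?_⟩
  · refine tendsto_nhds_unique (hlim _ (hf.add hg)) ?_
    simpa only [(hS _).map_add f g hf hg] using (hlim f hf).add (hlim g hg)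
  · refine tendsto_nhds_unique (hlim _ (hf.const_mul c)) ?_
    simpa only [(hS _).map_smul c f hf] using (hlim f hf).const_mul c
  · exact le_of_tendsto (hlim g hg).norm (Eventually.of_forall fun i => hb i g hg B hB)

end FiniteOrder

/-! ### Smooth dependence on parameters -/

section Parameters

variable {E : Type} [NormedAddCommGroup E] [NormedSpace ℝ E] {L : Set E}

theorem norm_iteratedFDeriv_slice_le {Q F : Type} [NormedAddCommGroup Q] [NormedSpace ℝ Q]
    [NormedAddCommGroup F] [NormedSpace ℝ F] {H : E × Q → F} (hH : ContDiff ℝ ∞ H) (k : ℕ) (x : E)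
    (q : Q) :
    ‖iteratedFDeriv ℝ k (fun y => H (y, q)) x‖ ≤ ‖iteratedFDeriv ℝ k H (x, q)‖ := by
  have h1 : (fun y => H (y, q)) =
      (fun z => H (z + (0, q))) ∘ (ContinuousLinearMap.inl ℝ E Q) := by
    ext y; simp
  have h2 : ContDiff ℝ ∞ fun z : E × Q => H (z + (0, q)) :=
    hH.comp (contDiff_id.add contDiff_const)
  rw [h1, (ContinuousLinearMap.inl ℝ E Q).iteratedFDeriv_comp_right h2 x (mod_cast le_top),
    iteratedFDeriv_comp_add_right]
  refine (ContinuousMultilinearMap.norm_compContinuousLinearMap_le _ _).trans ?_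
  rw [Finset.prod_const, Finset.card_univ, Fintype.card_fin]
  have h3 : ‖ContinuousLinearMap.inl ℝ E Q‖ ^ k ≤ 1 :=
    pow_le_one₀ (norm_nonneg _) (ContinuousLinearMap.norm_inl_le_one ..)
  simpa using mul_le_mul_of_nonneg_left h3 (norm_nonneg (iteratedFDeriv ℝ k H (x, q)))

theorem contDiff_slice {Q F : Type} [NormedAddCommGroup Q] [NormedSpace ℝ Q]
    [NormedAddCommGroup F] [NormedSpace ℝ F] {H : E × Q → F} (hH : ContDiff ℝ ∞ H) (q : Q) :
    ContDiff ℝ ∞ fun y => H (y, q) := hH.comp (contDiff_id.prodMk contDiff_const)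

/-- A pointwise bounded family of functionals of finite order is uniformly bounded on smooth
functions which depend smoothly on a parameter in a compact set. -/
theorem FiniteOrder.param_bound (hL : IsCompact L) {ι : Type*} {T : ι → (E → ℂ) → ℂ}
    (hT : ∀ i, FiniteOrder L (T i)) (hpt : ∀ g, SmoothIn L g → ∃ C, ∀ i, ‖T i g‖ ≤ C)
    {Q : Type} [NormedAddCommGroup Q] [NormedSpace ℝ Q] {Q₀ : Set Q} (hQ : IsCompact Q₀)
    {H : E × Q → ℂ} (hH : ContDiff ℝ ∞ H) (h0 : ∀ q ∈ Q₀, ∀ p ∉ L, H (p, q) = 0) :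
    ∃ C, 0 ≤ C ∧ ∀ i, ∀ q ∈ Q₀, ‖T i fun p => H (p, q)‖ ≤ C := by
  obtain ⟨k, C, hC, hb⟩ := FiniteOrder.uniform_bound hL hT hpt
  have h1 : ∀ j : ℕ, ∃ B, 0 ≤ B ∧
      ∀ q ∈ Q₀, ∀ x, ‖iteratedFDeriv ℝ j (fun p => H (p, q)) x‖ ≤ B := by
    intro j
    obtain ⟨B, hB⟩ := (hL.prod hQ).exists_bound_of_continuousOn
      (hH.continuous_iteratedFDeriv (m := j) (mod_cast le_top)).continuousOn
    refine ⟨max B 0, le_max_right _ _, fun q hq x => ?_⟩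
    by_cases hx : x ∈ L
    · exact (norm_iteratedFDeriv_slice_le hH j x q).trans
        ((hB (x, q) ⟨hx, hq⟩).trans (le_max_left _ _))
    · have hs : tsupport (fun p => H (p, q)) ⊆ L :=
        closure_minimal (fun p hp => by_contra fun h => hp (h0 q hq p h)) hL.isClosed
      have : iteratedFDeriv ℝ j (fun p => H (p, q)) x = 0 :=
        image_eq_zero_of_notMem_tsupport fun h => hx (hs (tsupport_iteratedFDeriv_subset j h))
      rw [this, norm_zero]
      exact le_max_right _ _
  choose B hB0 hB using h1
  refine ⟨C * ∑ j ∈ Finset.range (k + 1), B j,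
    mul_nonneg hC (Finset.sum_nonneg fun j _ => hB0 j), fun i q hq => ?_⟩
  refine hb i _ ⟨contDiff_slice hH q, fun p hp => h0 q hq p hp⟩ _
    fun j hj x => (hB j q hq x).trans ?_
  exact Finset.single_le_sum (f := B) (fun l _ => hB0 l) (Finset.mem_range.2 (by omega))

/-- The partial derivative of `H` in a real parameter. -/
def dparam {F : Type} [NormedAddCommGroup F] [NormedSpace ℝ F] (H : E × ℝ → F) (z : E × ℝ) : F :=
  fderiv ℝ H z (0, 1)

theorem contDiff_dparam {F : Type} [NormedAddCommGroup F] [NormedSpace ℝ F] {H : E × ℝ → F}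
    (hH : ContDiff ℝ ∞ H) : ContDiff ℝ ∞ (dparam H) :=
  (hH.fderiv_right (m := ∞) (by simp)).clm_apply contDiff_const

theorem hasDerivAt_dparam {F : Type} [NormedAddCommGroup F] [NormedSpace ℝ F] {H : E × ℝ → F}
    (hH : ContDiff ℝ ∞ H) (p : E) (l : ℝ) :
    HasDerivAt (fun l => H (p, l)) (dparam H (p, l)) l := by
  have h1 : HasFDerivAt H (fderiv ℝ H (p, l)) (p, l) :=
    (hH.differentiable (by simp)).differentiableAt.hasFDerivAt
  exact h1.comp_hasDerivAt l ((hasDerivAt_const l p).prodMk (hasDerivAt_id l))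

theorem norm_le_of_dparam_le {F : Type} [NormedAddCommGroup F] [NormedSpace ℝ F] {G : E × ℝ → F}
    (hG : ContDiff ℝ ∞ G) {x : E} (h0 : G (x, 0) = 0) {r C : ℝ}
    (hb : ∀ s, |s| ≤ r → ‖dparam G (x, s)‖ ≤ C) {s : ℝ} (hs : |s| ≤ r) : ‖G (x, s)‖ ≤ C * |s| := by
  have := (convex_Icc (-r) r).norm_image_sub_le_of_norm_hasDerivWithin_le
    (f := fun l => G (x, l)) (f' := fun l => dparam G (x, l)) (C := C) (x := 0) (y := s)
    (fun l _ => (hasDerivAt_dparam hG x l).hasDerivWithinAt) (fun l hl => hb l (abs_le.2 hl))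
    (by have := (abs_nonneg s).trans hs; constructor <;> linarith) (abs_le.1 hs)
  simpa [h0] using this

/-- If `G` vanishes to second order in the parameter `τ` at `τ = 0`, then so do all of its
derivatives in the other variables. -/
theorem exists_iteratedFDeriv_slice_le_sq (hL : IsCompact L) (k : ℕ) :
    ∀ {F : Type} [NormedAddCommGroup F] [NormedSpace ℝ F] {G : E × ℝ → F}, ContDiff ℝ ∞ G →
    (∀ x, G (x, 0) = 0) → (∀ x, dparam G (x, 0) = 0) →
    ∃ C, 0 ≤ C ∧ ∀ x ∈ L, ∀ τ, |τ| ≤ 1 →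
      ‖iteratedFDeriv ℝ k (fun y => G (y, τ)) x‖ ≤ C * τ ^ 2 := by
  induction k with
  | zero =>
    intro F _ _ G hG h0 h1
    have hG1 := contDiff_dparam hG
    obtain ⟨C, hC⟩ := (hL.prod (isCompact_Icc (a := (-1 : ℝ)) (b := 1))).exists_bound_of_continuousOn
      (contDiff_dparam hG1).continuous.continuousOn
    refine ⟨max C 0, le_max_right _ _, fun x hx τ hτ => ?_⟩
    rw [norm_iteratedFDeriv_zero]
    have h2 : ∀ s, |s| ≤ 1 → ‖dparam G (x, s)‖ ≤ max C 0 * |s| := fun s hs =>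
      norm_le_of_dparam_le hG1 (h1 x) (r := 1)
        (fun s hs => (hC (x, s) ⟨hx, abs_le.1 hs⟩).trans (le_max_left _ _)) hs
    have h3 := norm_le_of_dparam_le hG (h0 x) (r := |τ|) (C := max C 0 * |τ|)
      (fun s hs => (h2 s (hs.trans hτ)).trans (by gcongr)) (s := τ) le_rfl
    rwa [mul_assoc, ← sq, sq_abs] at h3
  | succ k ih =>
    intro F _ _ G hG h0 h1
    let G' : E × ℝ → E →L[ℝ] F := fun z => (fderiv ℝ G z).comp (ContinuousLinearMap.inl ℝ E ℝ)
    have hG' : ContDiff ℝ ∞ G' :=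
      (hG.fderiv_right (m := ∞) (by simp)).clm_comp contDiff_const
    have hfd : ∀ τ, fderiv ℝ (fun y => G (y, τ)) = fun x => G' (x, τ) := by
      intro τ
      ext1 x
      have h2 : HasFDerivAt G (fderiv ℝ G (x, τ)) (x, τ) :=
        (hG.differentiable (by simp)).differentiableAt.hasFDerivAt
      exact (h2.comp x (hasFDerivAt_prodMk_left x τ)).fderiv
    have hz : ∀ x, G' (x, 0) = 0 := by
      intro x
      rw [← congrFun (hfd 0) x]
      simp [h0]
    obtain ⟨C, hC0, hC⟩ := ih hG' hz (fun x => by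
      have hF2 : ContDiff ℝ ∞ (fderiv ℝ G) := hG.fderiv_right (m := ∞) (by simp)
      have hd2 : HasFDerivAt (fderiv ℝ G) (fderiv ℝ (fderiv ℝ G) (x, 0)) (x, 0) :=
        (hF2.differentiable (by simp)).differentiableAt.hasFDerivAt
      have hsymm := (hG.contDiffAt (x := (x, (0 : ℝ)))).isSymmSndFDerivAt
        (by simpa using WithTop.coe_le_coe.2 (le_top (a := (2 : ℕ∞))))
      ext v
      have e1 : dparam G' (x, 0) v = fderiv ℝ (fderiv ℝ G) (x, 0) (0, 1) (v, 0) := by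
        have h3 : HasDerivAt (fun l => G' (x, l) v)
            (fderiv ℝ (fderiv ℝ G) (x, 0) (0, 1) (v, 0)) 0 := by
          have h4 := hd2.comp_hasDerivAt (0 : ℝ)
            ((hasDerivAt_const (0 : ℝ) x).prodMk (hasDerivAt_id (0 : ℝ)))
          exact (h4.clm_apply (hasDerivAt_const (0 : ℝ) (v, (0 : ℝ)))).congr_deriv (by simp)
        have h5 : HasDerivAt (fun l => G' (x, l) v) (dparam G' (x, 0) v) 0 :=
          ((hasDerivAt_dparam hG' x 0).clm_apply (hasDerivAt_const (0 : ℝ) v)).congr_deriv (by simp)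
        exact h5.unique h3
      have e2 : fderiv ℝ (fderiv ℝ G) (x, 0) (v, 0) (0, 1) = 0 := by
        have h6 : HasFDerivAt (fun y => dparam G (y, 0))
            (((ContinuousLinearMap.apply ℝ F ((0, 1) : E × ℝ)).comp
              (fderiv ℝ (fderiv ℝ G) (x, 0))).comp (ContinuousLinearMap.inl ℝ E ℝ)) x := by
          have h9 : HasFDerivAt (dparam G) _ (x, (0 : ℝ)) :=
            (ContinuousLinearMap.apply ℝ F ((0, 1) : E × ℝ)).hasFDerivAt.comp (x, (0 : ℝ)) hd2
          exact HasFDerivAt.comp (f := fun y : E => (y, (0 : ℝ))) x h9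
            (hasFDerivAt_prodMk_left x (0 : ℝ))
        have h7 : (fun y => dparam G (y, 0)) = fun _ => 0 := funext h1
        rw [h7] at h6
        have h8 := congrArg (fun A => A v) (h6.unique (hasFDerivAt_const 0 x))
        simpa using h8
      rw [e1, hsymm.eq, e2]
      rfl)
    refine ⟨C, hC0, fun x hx τ hτ => ?_⟩
    rw [← norm_iteratedFDeriv_fderiv, hfd τ]
    exact hC x hx τ hτ

/-- Differentiation under a functional of finite order. -/
theorem FiniteOrder.hasDerivAt (hL : IsCompact L) {T : (E → ℂ) → ℂ} (hT : FiniteOrder L T)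
    {H : E × ℝ → ℂ} (hH : ContDiff ℝ ∞ H) (h0 : ∀ p ∉ L, ∀ l, H (p, l) = 0) (l : ℝ) :
    HasDerivAt (fun l => T fun p => H (p, l)) (T fun p => dparam H (p, l)) l := by
  have hdz : ∀ p ∉ L, ∀ l, dparam H (p, l) = 0 := fun p hp l => by
    have h1 := hasDerivAt_dparam hH p l
    have h2 : (fun l => H (p, l)) = fun _ => 0 := funext fun l => h0 p hp l
    rw [h2] at h1
    exact h1.unique (hasDerivAt_const l 0)
  let G : E × ℝ → ℂ := fun z => (H (z.1, l + z.2) - H (z.1, l)) - (z.2 : ℂ) * dparam H (z.1, l)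
  have hd := contDiff_dparam hH
  have hG : ContDiff ℝ ∞ G := by
    refine ((hH.comp (contDiff_fst.prodMk (contDiff_const.add contDiff_snd))).sub
      (hH.comp (contDiff_fst.prodMk contDiff_const))).sub
      ((Complex.ofRealCLM.contDiff.comp contDiff_snd).mul
        (hd.comp (contDiff_fst.prodMk contDiff_const)))
  have hG0 : ∀ x, G (x, 0) = 0 := fun x => by simp [G]
  have hG1 : ∀ x, dparam G (x, 0) = 0 := fun x => by
    have h1 := hasDerivAt_dparam hG x 0
    have h2 : HasDerivAt (fun τ : ℝ => H (x, l + τ)) (dparam H (x, l)) 0 := by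
      have h3 : HasDerivAt (fun l => H (x, l)) (dparam H (x, l)) (l + 0) := by
        simpa using hasDerivAt_dparam hH x l
      exact h3.comp_const_add l 0
    have h4 : HasDerivAt (fun τ : ℝ => (τ : ℂ) * dparam H (x, l)) (1 * dparam H (x, l)) 0 :=
      (Complex.ofRealCLM.hasDerivAt (x := (0 : ℝ))).mul_const _
    have h5 := (h2.sub_const (H (x, l))).sub h4
    exact h1.unique (h5.congr_deriv (by simp))
  obtain ⟨k, C, hC, hb⟩ := hT.bound
  choose D hD0 hD using fun j => exists_iteratedFDeriv_slice_le_sq hL j hG hG0 hG1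
  have hGs : ∀ τ, SmoothIn L fun p => G (p, τ) := fun τ =>
    ⟨contDiff_slice hG τ, fun p hp => by simp [G, h0 p hp, hdz p hp]⟩
  have hs1 : ∀ l, SmoothIn L fun p => H (p, l) := fun l =>
    ⟨contDiff_slice hH l, fun p hp => h0 p hp l⟩
  have hs2 : SmoothIn L fun p => dparam H (p, l) := ⟨contDiff_slice hd l, fun p hp => hdz p hp l⟩
  have hest : ∀ τ, |τ| ≤ 1 →
      ‖T (fun p => G (p, τ))‖ ≤ (C * ∑ j ∈ Finset.range (k + 1), D j) * τ ^ 2 := by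
    intro τ hτ
    rw [mul_assoc]
    refine hb _ (hGs τ) _ fun j hj x => ?_
    have hle : D j * τ ^ 2 ≤ (∑ j ∈ Finset.range (k + 1), D j) * τ ^ 2 := by
      gcongr
      exact Finset.single_le_sum (f := D) (fun l _ => hD0 l) (Finset.mem_range.2 (by omega))
    by_cases hx : x ∈ L
    · exact (hD j x hx τ hτ).trans hle
    · have hs : tsupport (fun p => G (p, τ)) ⊆ L :=
        closure_minimal (fun p hp => by_contra fun h => hp ((hGs τ).zero_off p h)) hL.isClosed
      have : iteratedFDeriv ℝ j (fun p => G (p, τ)) x = 0 :=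
        image_eq_zero_of_notMem_tsupport fun h => hx (hs (tsupport_iteratedFDeriv_subset j h))
      rw [this, norm_zero]
      exact (mul_nonneg (hD0 j) (sq_nonneg τ)).trans hle
  rw [hasDerivAt_iff_isLittleO_nhds_zero]
  have heq : ∀ τ : ℝ, T (fun p => H (p, l + τ)) - T (fun p => H (p, l)) -
      τ • T (fun p => dparam H (p, l)) = T fun p => G (p, τ) := by
    intro τ
    have e1 := hT.map_sub ((hs1 (l + τ)).sub (hs1 l)) (hs2.const_mul (τ : ℂ))
    rw [hT.map_sub (hs1 _) (hs1 _), hT.map_smul _ _ hs2] at e1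
    rw [Complex.real_smul]
    exact e1.symm
  simp_rw [heq]
  refine Asymptotics.IsBigO.trans_isLittleO (g := fun τ : ℝ => τ ^ 2) ?_ ?_
  · refine Asymptotics.IsBigO.of_bound (C * ∑ j ∈ Finset.range (k + 1), D j) ?_
    filter_upwards [Metric.closedBall_mem_nhds (0 : ℝ) one_pos] with τ hτ
    have := hest τ (by simpa using hτ)
    simpa using this
  · simpa using Asymptotics.isLittleO_pow_id (𝕜 := ℝ) one_lt_two

end Parameters

/-! ### Distributions as functionals of finite order -/

section Eval

variable {n d : ℕ} {U : Opens (Sp n d)} {L : Set (Sp n d)}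

/-- A smooth function vanishing off a compact subset of `U`, as a test function on `U`. -/
def SmoothIn.toTest {g : Sp n d → ℂ} (hg : SmoothIn L g) (hL : IsCompact L) (hLU : L ⊆ U) :
    𝓓(U, ℂ) where
  toFun := g
  contDiff' := hg.contDiff
  hasCompactSupport' := HasCompactSupport.intro hL fun p hp => hg.zero_off p hp
  tsupport_subset' := (closure_minimal (s := Function.support g)
    (fun p hp => by_contra fun h => hp (hg.zero_off p h)) hL.isClosed).trans hLU

theorem smoothIn_testFunction (φ : 𝓓(U, ℂ)) : SmoothIn (tsupport φ) φ :=
  ⟨φ.contDiff, fun _ hp => image_eq_zero_of_notMem_tsupport hp⟩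

theorem SmoothIn.eval_eq {g : Sp n d → ℂ} (hg : SmoothIn L g) (hL : IsCompact L) (hLU : L ⊆ U)
    (t : CDistribution U) : t.eval g = t (hg.toTest hL hLU) := by
  exact dif_pos ⟨hg.contDiff, (hg.toTest hL hLU).hasCompactSupport,
    (hg.toTest hL hLU).tsupport_subset⟩

theorem CDistribution.eval_coe (t : CDistribution U) (φ : 𝓓(U, ℂ)) : t.eval φ = t φ :=
  (smoothIn_testFunction φ).eval_eq φ.hasCompactSupport φ.tsupport_subset t

/-- A distribution on `U` has finite order on every compact subset of `U`. -/
theorem FiniteOrder.eval (t : CDistribution U) (hL : IsCompact L) (hLU : L ⊆ U) :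
    FiniteOrder L t.eval := by
  let K : Compacts (Sp n d) := ⟨L, hL⟩
  have hK : (K : Set (Sp n d)) ⊆ U := hLU
  refine ⟨fun f g hf hg => ?_, fun c f hf => ?_, ?_⟩
  · rw [(hf.add hg).eval_eq hL hLU, hf.eval_eq hL hLU, hg.eval_eq hL hLU]
    exact _root_.map_add t (hf.toTest hL hLU) (hg.toTest hL hLU)
  · rw [(hf.const_mul c).eval_eq hL hLU, hf.eval_eq hL hLU, ← smul_eq_mul]
    exact _root_.map_smul t c (hf.toTest hL hLU)
  · let S : 𝓓_{K}(Sp n d, ℂ) →L[ℂ] ℂ := t.comp (TestFunction.ofSupportedInCLM ℂ hK)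
    let q : Seminorm ℂ 𝓓_{K}(Sp n d, ℂ) := (normSeminorm ℂ ℂ).comp S.toLinearMap
    have hq : Continuous q := continuous_norm.comp S.continuous
    obtain ⟨s, C, _, hC⟩ := Seminorm.bound_of_continuous
      (ContDiffMapSupportedIn.withSeminorms' ℂ (Sp n d) ℂ ⊤ K) q hq
    refine ⟨s.sup id, C, C.2, fun g hg B hB => ?_⟩
    let G : 𝓓_{K}(Sp n d, ℂ) := ⟨g, hg.contDiff, fun p hp => hg.zero_off p hp⟩
    have h1 : t.eval g = S G := hg.eval_eq hL hLU t
    have h2 := hC G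
    have hB0 : 0 ≤ B := (norm_nonneg _).trans (hB 0 (Nat.zero_le _) 0)
    rw [h1]
    refine h2.trans ?_
    rw [smul_apply]
    change (C : ℝ) * _ ≤ _
    gcongr
    refine Seminorm.finset_sup_apply_le hB0 fun i hi => ?_
    refine Seminorm.finset_sup_apply_le hB0 fun j hj => ?_
    rw [ContDiffMapSupportedIn.seminorm_top_le_iff ℂ hB0]
    intro x _
    exact hB j ((Finset.mem_Iic.1 hj).trans (Finset.le_sup (f := id) hi)) x

/-- A functional which has finite order on every compact subset of `U` is a distribution. -/
theorem exists_cDistribution {T : (Sp n d → ℂ) → ℂ}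
    (hT : ∀ L : Set (Sp n d), IsCompact L → L ⊆ U → FiniteOrder L T) :
    ∃ t : CDistribution U, ∀ φ : 𝓓(U, ℂ), t φ = T φ := by
  have hC : ∀ (K : Compacts (Sp n d)), (K : Set (Sp n d)) ⊆ U →
      ∃ S : 𝓓_{K}(Sp n d, ℂ) →L[ℂ] ℂ, ∀ f, S f = T f := by
    intro K hK
    have hs : ∀ f : 𝓓_{K}(Sp n d, ℂ), SmoothIn K (f : Sp n d → ℂ) := fun f =>
      ⟨f.contDiff, fun p hp => f.zero_on_compl hp⟩
    have hTK := hT K K.isCompact hK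
    obtain ⟨k, C, hC, hb⟩ := hTK.bound
    refine ⟨ContDiffMapSupportedIn.mkCLMtoNormedSpace ℂ (fun f => T f)
      (fun f g => hTK.map_add f g (hs f) (hs g)) (fun c f => hTK.map_smul c f (hs f))
      ⟨Finset.Iic k, C, hC, fun f => hb _ (hs f) _ fun j hj x => ?_⟩, fun f => rfl⟩
    refine (ContDiffMapSupportedIn.norm_iteratedFDeriv_apply_le_seminorm_top ℂ).trans ?_
    exact Seminorm.le_def.1 (Finset.le_sup (f := ContDiffMapSupportedIn.seminorm ℂ (Sp n d) ℂ ⊤ K)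
      (Finset.mem_Iic.2 hj)) f
  choose S hS using hC
  exact ⟨TestFunction.limitCLM ℂ (fun φ => T φ) S fun K hK f => (hS K hK f).symm, fun φ => rfl⟩

end Eval

section Comp

variable {E : Type} [NormedAddCommGroup E] [NormedSpace ℝ E] {L L' : Set E}

theorem SmoothIn.mul_comp {m : E → ℂ} (hm : ContDiff ℝ ∞ m) (A : E →L[ℝ] E) {g : E → ℂ}
    (hg : SmoothIn L g) (hmA : ∀ p ∉ L', A p ∈ L → m p = 0) :
    SmoothIn L' fun p => m p * g (A p) :=
  ⟨hm.mul (hg.contDiff.comp A.contDiff), fun p hp => by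
    by_cases h : A p ∈ L
    · simp [hmA p hp h]
    · simp [hg.zero_off _ h]⟩

/-- Precomposition of a functional of finite order with a linear substitution followed by
multiplication by a smooth function. -/
theorem FiniteOrder.comp_mul (hL' : IsCompact L') {T : (E → ℂ) → ℂ} (hT : FiniteOrder L' T)
    {m : E → ℂ} (hm : ContDiff ℝ ∞ m) (A : E →L[ℝ] E) (hmA : ∀ p ∉ L', A p ∈ L → m p = 0) :
    FiniteOrder L fun g => T fun p => m p * g (A p) := by
  obtain ⟨k, C, hC, hb⟩ := hT.bound
  refine ⟨fun f g hf hg => ?_, fun c f hf => ?_, ?_⟩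
  · rw [← hT.map_add _ _ (hf.mul_comp hm A hmA) (hg.mul_comp hm A hmA)]
    simp only [mul_add]
  · rw [← hT.map_smul _ _ (hf.mul_comp hm A hmA)]
    simp only [mul_left_comm]
  · have h1 : ∀ j : ℕ, ∃ B, 0 ≤ B ∧ ∀ x ∈ L', ‖iteratedFDeriv ℝ j m x‖ ≤ B := by
      intro j
      obtain ⟨B, hB⟩ := hL'.exists_bound_of_continuousOn
        (hm.continuous_iteratedFDeriv (m := j) (mod_cast le_top)).continuousOn
      exact ⟨max B 0, le_max_right _ _, fun x hx => (hB x hx).trans (le_max_left _ _)⟩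
    choose D hD0 hD using h1
    let c : ℕ → ℝ := fun j => ∑ i ∈ Finset.range (j + 1), (j.choose i : ℝ) * D i * ‖A‖ ^ (j - i)
    have hc0 : ∀ j, 0 ≤ c j := fun j => Finset.sum_nonneg fun i _ =>
      mul_nonneg (mul_nonneg (Nat.cast_nonneg _) (hD0 i)) (by positivity)
    refine ⟨k, C * ∑ j ∈ Finset.range (k + 1), c j,
      mul_nonneg hC (Finset.sum_nonneg fun j _ => hc0 j), fun g hg B hB => ?_⟩
    have hB0 : 0 ≤ B := (norm_nonneg _).trans (hB 0 (Nat.zero_le _) 0)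
    rw [mul_assoc]
    refine hb _ (hg.mul_comp hm A hmA) _ fun j hj x => ?_
    have hle : c j * B ≤ (∑ j ∈ Finset.range (k + 1), c j) * B := by
      gcongr
      exact Finset.single_le_sum (f := c) (fun l _ => hc0 l) (Finset.mem_range.2 (by omega))
    refine le_trans ?_ hle
    by_cases hx : x ∈ L'
    · have hgA : ContDiff ℝ ∞ fun p => g (A p) := hg.contDiff.comp A.contDiff
      refine (norm_iteratedFDeriv_mul_le hm hgA x (mod_cast le_top)).trans ?_
      rw [Finset.sum_mul]
      refine Finset.sum_le_sum fun i hi => ?_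
      have h2 : ‖iteratedFDeriv ℝ (j - i) (fun p => g (A p)) x‖ ≤ ‖A‖ ^ (j - i) * B := by
        have hr : j - i ≤ k := by omega
        generalize j - i = r at hr
        have : iteratedFDeriv ℝ r (fun p => g (A p)) x =
            (iteratedFDeriv ℝ r g (A x)).compContinuousLinearMap fun _ => A :=
          A.iteratedFDeriv_comp_right hg.contDiff x (mod_cast le_top)
        rw [this]
        refine (ContinuousMultilinearMap.norm_compContinuousLinearMap_le _ _).trans ?_
        rw [Finset.prod_const, Finset.card_univ, Fintype.card_fin, mul_comm]
        gcongr
        exact hB r hr (A x)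
      calc _ ≤ (j.choose i : ℝ) * D i * (‖A‖ ^ (j - i) * B) := by
            have := hD0 i
            gcongr
            exact hD i x hx
        _ = _ := by ring
    · have hs : tsupport (fun p => m p * g (A p)) ⊆ L' :=
        closure_minimal (fun p hp => by_contra fun h => hp
          ((hg.mul_comp hm A hmA).zero_off p h)) hL'.isClosed
      have : iteratedFDeriv ℝ j (fun p => m p * g (A p)) x = 0 :=
        image_eq_zero_of_notMem_tsupport fun h => hx (hs (tsupport_iteratedFDeriv_subset j h))
      rw [this, norm_zero]
      exact mul_nonneg (hc0 j) hB0

theorem FiniteOrder.mul (hL : IsCompact L) {T : (E → ℂ) → ℂ} (hT : FiniteOrder L T)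
    {m : E → ℂ} (hm : ContDiff ℝ ∞ m) : FiniteOrder L fun g => T fun p => m p * g p :=
  hT.comp_mul hL hm (.id ℝ E) fun _ hp h => absurd h hp

end Comp

/-! ### Exponentials and scalings -/

section Scaling

variable {n d : ℕ} {U : Opens (Sp n d)} {L : Set (Sp n d)}

/-- The exponential `e_ζ(p) = exp(-i ζ·p)`. -/
def expo (ζ p : Sp n d) : ℂ := Complex.exp (-(Complex.I * (pairing ζ p : ℂ)))

theorem contDiff_pairing (ζ : Sp n d) : ContDiff ℝ ∞ fun p : Sp n d => pairing ζ p :=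
  (contDiff_const.inner ℝ contDiff_fst).add (contDiff_const.inner ℝ contDiff_snd)

theorem contDiff_expo (ζ : Sp n d) : ContDiff ℝ ∞ fun p : Sp n d => expo ζ p :=
  (contDiff_const.mul (Complex.ofRealCLM.contDiff.comp (contDiff_pairing ζ))).neg.cexp

theorem localFourier_eq_eval (t : CDistribution U) (χ : 𝓓(U, ℂ)) (ζ : Sp n d) :
    localFourier t χ ζ = t.eval fun p => expo ζ p * χ p :=
  (t.eval_coe (expMul χ ζ)).symm

@[simp] theorem expo_zero (p : Sp n d) : expo 0 p = 1 := by simp [expo, pairing]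

theorem pairing_add (ζ η p : Sp n d) : pairing (ζ + η) p = pairing ζ p + pairing η p := by
  simp [pairing, inner_add_left]; ring

theorem pairing_smul (c : ℝ) (ζ p : Sp n d) : pairing (c • ζ) p = c * pairing ζ p := by
  simp [pairing, inner_smul_left]; ring

theorem pairing_dilation (c : ℝ) (ζ p : Sp n d) :
    pairing ζ (dilation c p) = pairing (dilation c ζ) p := by
  simp [pairing, inner_smul_left, inner_smul_right]

theorem expo_dilation (c : ℝ) (ζ p : Sp n d) : expo ζ (dilation c p) = expo (dilation c ζ) p := by
  simp only [expo, pairing_dilation]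

theorem expo_add (ζ η p : Sp n d) : expo (ζ + η) p = expo ζ p * expo η p := by
  simp only [expo, pairing_add, ← Complex.exp_add]
  congr 1
  push_cast
  ring

theorem dilation_dilation (a b : ℝ) (p : Sp n d) :
    dilation a (dilation b p) = dilation (a * b) p := by
  simp [smul_smul]

@[simp] theorem dilation_one (p : Sp n d) : dilation 1 p = p := by simp

theorem SmoothIn.comp_dilation_inv {g : Sp n d → ℂ} (hg : SmoothIn L g) {l : ℝ} (hl : l ≠ 0) :
    SmoothIn (dilation l '' L) fun p => g (dilation l⁻¹ p) :=
  ⟨hg.contDiff.comp (dilation l⁻¹).contDiff, fun p hp => hg.zero_off _ fun h => hp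
    ⟨_, h, by rw [dilation_dilation, mul_inv_cancel₀ hl, dilation_one]⟩⟩

theorem RhoConvex.image_subset (hU : RhoConvex U) (hLU : L ⊆ U) (l : Ioc (0 : ℝ) 1) :
    dilation (l : ℝ) '' L ⊆ U := by
  rintro _ ⟨p, hp, rfl⟩
  exact hU p (hLU hp) l

theorem eval_scale (hU : RhoConvex U) (t : CDistribution U) (l : Ioc (0 : ℝ) 1) {g : Sp n d → ℂ}
    (hg : SmoothIn L g) (hL : IsCompact L) (hLU : L ⊆ U) :
    (scale hU l t).eval g = (((l : ℝ) ^ d)⁻¹ : ℂ) * t.eval fun p => g (dilation (l : ℝ)⁻¹ p) := by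
  rw [hg.eval_eq hL hLU, scale_apply, (hg.comp_dilation_inv l.2.1.ne').eval_eq
    (hL.image (dilation (l : ℝ)).continuous) (hU.image_subset hLU l)]
  rfl

/-- The member `λ^{-s} t_λ` of the scaled family. -/
def scaled (hU : RhoConvex U) (s : ℝ) (t : CDistribution U) (l : Ioc (0 : ℝ) 1) :
    CDistribution U :=
  (((l : ℝ) ^ (-s) : ℝ) : ℂ) • scale hU l t

theorem CDistribution.eval_smul (c : ℂ) (t : CDistribution U) (g : Sp n d → ℂ) :
    CDistribution.eval (c • t) g = c * t.eval g := by
  unfold CDistribution.eval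
  split_ifs <;> simp

theorem eval_scaled (hU : RhoConvex U) (s : ℝ) (t : CDistribution U) (l : Ioc (0 : ℝ) 1)
    {g : Sp n d → ℂ} (hg : SmoothIn L g) (hL : IsCompact L) (hLU : L ⊆ U) :
    (scaled hU s t l).eval g =
      (((l : ℝ) ^ (-(s + d)) : ℝ) : ℂ) * t.eval fun p => g (dilation (l : ℝ)⁻¹ p) := by
  rw [scaled, CDistribution.eval_smul, eval_scale hU t l hg hL hLU, ← mul_assoc]
  congr 1
  rw [neg_add, Real.rpow_add l.2.1, Real.rpow_neg l.2.1.le (d : ℝ), Real.rpow_natCast]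
  push_cast
  rfl

/-- The product of two scaling parameters. -/
def scaleMul (l l' : Ioc (0 : ℝ) 1) : Ioc (0 : ℝ) 1 :=
  ⟨l * l', mul_pos l.2.1 l'.2.1, mul_le_one₀ l.2.2 l'.2.1.le l'.2.2⟩

/-- The scaled family is stable under scaling. -/
theorem eval_scaled_comp_dilation (hU : RhoConvex U) (s : ℝ) (t : CDistribution U)
    (m l : Ioc (0 : ℝ) 1) {g : Sp n d → ℂ} (hg : SmoothIn L g) (hL : IsCompact L) (hLU : L ⊆ U) :
    (scaled hU s t m).eval (fun p => g (dilation (l : ℝ)⁻¹ p)) =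
      (((l : ℝ) ^ (s + d) : ℝ) : ℂ) * (scaled hU s t (scaleMul m l)).eval g := by
  rw [eval_scaled hU s t m (hg.comp_dilation_inv l.2.1.ne')
    (hL.image (dilation (l : ℝ)).continuous) (hU.image_subset hLU l),
    eval_scaled hU s t (scaleMul m l) hg hL hLU, ← mul_assoc, ← Complex.ofReal_mul]
  have h1 : ((scaleMul m l : Ioc (0 : ℝ) 1) : ℝ) = m * l := rfl
  congr 2
  · rw [h1, Real.mul_rpow m.2.1.le l.2.1.le, mul_left_comm, ← Real.rpow_add l.2.1]
    simp
  · ext p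
    rw [dilation_dilation, h1, mul_inv_rev]

end Scaling

/-! ### Taylor expansion in the normal variable -/

section Taylor

variable {n d : ℕ} {L : Set (Sp n d)}

/-- The coefficient `D^jφ(x, 0)[(0, h), …, (0, h)]` of the Taylor expansion of `φ` in `h`. -/
def normalDeriv (φ : Sp n d → ℂ) (j : ℕ) (p : Sp n d) : ℂ :=
  iteratedFDeriv ℝ j φ (p.1, 0) fun _ => (0, p.2)

/-- The Taylor polynomial in `h` with terms of degree less than `M`. -/
def taylorPoly (M : ℕ) (φ : Sp n d → ℂ) (p : Sp n d) : ℂ :=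
  ∑ j ∈ Finset.range M, ((j.factorial : ℂ)⁻¹) * normalDeriv φ j p

/-- The derivatives `∂_λ^j φ(x, λh)`, as functions of `((x, h), λ)`. -/
def radialDeriv (φ : Sp n d → ℂ) : ℕ → Sp n d × ℝ → ℂ
  | 0 => fun z => φ (dilation z.2 z.1)
  | j + 1 => dparam (radialDeriv φ j)

theorem contDiff_dilation_uncurry : ContDiff ℝ ∞ fun z : Sp n d × ℝ => dilation z.2 z.1 :=
  (contDiff_fst.comp contDiff_fst).prodMk (contDiff_snd.smul (contDiff_snd.comp contDiff_fst))

theorem contDiff_radialDeriv {φ : Sp n d → ℂ} (hφ : ContDiff ℝ ∞ φ) (j : ℕ) :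
    ContDiff ℝ ∞ (radialDeriv φ j) := by
  induction j with
  | zero => exact hφ.comp contDiff_dilation_uncurry
  | succ j ih => exact contDiff_dparam ih

theorem radialDeriv_eq {φ : Sp n d → ℂ} (hφ : ContDiff ℝ ∞ φ) (j : ℕ) (p : Sp n d) (l : ℝ) :
    radialDeriv φ j (p, l) = iteratedFDeriv ℝ j φ (dilation l p) fun _ => (0, p.2) := by
  induction j generalizing l with
  | zero => simp [radialDeriv]
  | succ j ih =>
    have h1 : HasDerivAt (fun l => radialDeriv φ j (p, l)) (radialDeriv φ (j + 1) (p, l)) l :=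
      hasDerivAt_dparam (contDiff_radialDeriv hφ j) p l
    have h2 : (fun l => radialDeriv φ j (p, l)) =
        fun l => iteratedFDeriv ℝ j φ (dilation l p) fun _ => (0, p.2) := funext ih
    rw [h2] at h1
    refine h1.unique ?_
    have hl : HasDerivAt (fun l : ℝ => dilation l p) ((0, p.2) : Sp n d) l := by
      have := (hasDerivAt_const l p.1).prodMk ((hasDerivAt_id l).smul_const p.2)
      simpa using this
    have hd : DifferentiableAt ℝ (iteratedFDeriv ℝ j φ) (dilation l p) :=
      (hφ.differentiable_iteratedFDeriv (m := j)
        (by exact_mod_cast WithTop.coe_lt_coe.2 (ENat.natCast_lt_top j))).differentiableAt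
    have h3 := hd.hasFDerivAt.comp_hasDerivAt l hl
    have h4 := ((ContinuousMultilinearMap.apply ℝ (fun _ : Fin j => Sp n d) ℂ
      fun _ => (0, p.2)).hasFDerivAt.comp_hasDerivAt l h3)
    rw [iteratedFDeriv_succ_apply_left]
    exact h4

theorem normalDeriv_eq_radialDeriv {φ : Sp n d → ℂ} (hφ : ContDiff ℝ ∞ φ) (j : ℕ) (p : Sp n d) :
    normalDeriv φ j p = radialDeriv φ j (p, 0) := by
  rw [radialDeriv_eq hφ]
  simp [normalDeriv]

theorem contDiff_normalDeriv {φ : Sp n d → ℂ} (hφ : ContDiff ℝ ∞ φ) (j : ℕ) :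
    ContDiff ℝ ∞ (normalDeriv φ j) := by
  rw [funext (normalDeriv_eq_radialDeriv hφ j)]
  exact contDiff_slice (contDiff_radialDeriv hφ j) 0

theorem contDiff_taylorPoly {φ : Sp n d → ℂ} (hφ : ContDiff ℝ ∞ φ) (M : ℕ) :
    ContDiff ℝ ∞ (taylorPoly M φ) :=
  ContDiff.sum fun j _ => contDiff_const.mul (contDiff_normalDeriv hφ j)

theorem normalDeriv_dilation (φ : Sp n d → ℂ) (j : ℕ) (c : ℝ) (p : Sp n d) :
    normalDeriv φ j (dilation c p) = (c : ℂ) ^ j * normalDeriv φ j p := by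
  have h := (iteratedFDeriv ℝ j φ (p.1, 0)).map_smul_univ (fun _ => c) fun _ => ((0, p.2) : Sp n d)
  simpa [normalDeriv] using h

theorem normalDeriv_comp_dilation {φ : Sp n d → ℂ} (hφ : ContDiff ℝ ∞ φ) (j : ℕ) (c : ℝ)
    (p : Sp n d) :
    normalDeriv (fun p => φ (dilation c p)) j p = (c : ℂ) ^ j * normalDeriv φ j p := by
  rw [← normalDeriv_dilation]
  have : iteratedFDeriv ℝ j (fun p => φ (dilation c p)) (p.1, 0) = _ :=
    (dilation c).iteratedFDeriv_comp_right hφ (p.1, (0 : EuclideanSpace ℝ (Fin d)))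
      (i := j) (mod_cast le_top)
  rw [normalDeriv, this]
  simp [normalDeriv]

theorem normalDeriv_eq_zero {φ : Sp n d → ℂ} {j : ℕ} {p : Sp n d}
    (hp : ((p.1, 0) : Sp n d) ∉ tsupport φ) : normalDeriv φ j p = 0 := by
  have : iteratedFDeriv ℝ j φ (p.1, 0) = 0 :=
    image_eq_zero_of_notMem_tsupport fun h => hp (tsupport_iteratedFDeriv_subset j h)
  simp [normalDeriv, this]

theorem normalDeriv_eq_zero_of_fst {φ : Sp n d → ℂ} {j : ℕ} {K : Set (EuclideanSpace ℝ (Fin n))}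
    (hK : IsClosed K) (hφ : ∀ p : Sp n d, p.1 ∉ K → φ p = 0) {p : Sp n d} (hp : p.1 ∉ K) :
    normalDeriv φ j p = 0 :=
  normalDeriv_eq_zero fun h => hp <| by
    have h1 : tsupport φ ⊆ Prod.fst ⁻¹' K :=
      closure_minimal (fun _ hq => by_contra fun h => hq (hφ _ h)) (hK.preimage continuous_fst)
    have h2 := h1 h
    exact h2

theorem taylorPoly_eq_zero_of_fst {φ : Sp n d → ℂ} {M : ℕ} {K : Set (EuclideanSpace ℝ (Fin n))}
    (hK : IsClosed K) (hφ : ∀ p : Sp n d, p.1 ∉ K → φ p = 0) {p : Sp n d} (hp : p.1 ∉ K) :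
    taylorPoly M φ p = 0 :=
  Finset.sum_eq_zero fun j _ => by rw [normalDeriv_eq_zero_of_fst hK hφ hp, mul_zero]

theorem dparam_mul_left {E : Type} [NormedAddCommGroup E] [NormedSpace ℝ E] {m : E → ℂ}
    (hm : ContDiff ℝ ∞ m) {H : E × ℝ → ℂ} (hH : ContDiff ℝ ∞ H) (z : E × ℝ) :
    dparam (fun z => m z.1 * H z) z = m z.1 * dparam H z := by
  have h1 := hasDerivAt_dparam (H := fun z : E × ℝ => m z.1 * H z)
    ((hm.comp contDiff_fst).mul hH) z.1 z.2
  exact h1.unique ((hasDerivAt_dparam hH z.1 z.2).const_mul (m z.1))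

section

variable {T : (Sp n d → ℂ) → ℂ} {m : Sp n d → ℂ}

theorem FiniteOrder.hasDerivAt_radialDeriv (hL : IsCompact L) (hT : FiniteOrder L T)
    (hm : SmoothIn L m) {φ : Sp n d → ℂ} (hφ : ContDiff ℝ ∞ φ) (j : ℕ) (l : ℝ) :
    HasDerivAt (fun l => T fun p => m p * radialDeriv φ j (p, l))
      (T fun p => m p * radialDeriv φ (j + 1) (p, l)) l := by
  have hH := contDiff_radialDeriv hφ j
  have := hT.hasDerivAt hL (H := fun z => m z.1 * radialDeriv φ j z)
    ((hm.contDiff.comp contDiff_fst).mul hH) (fun p hp l => by simp [hm.zero_off p hp]) l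
  simp only [dparam_mul_left hm.contDiff hH] at this
  exact this

/-- The radial derivatives are limits of difference quotients of dilates, so that the functionals
which contain them are of finite order. -/
theorem FiniteOrder.radialDeriv (hL : IsCompact L) (hT : FiniteOrder L T) (hm : SmoothIn L m)
    {L' : Set (Sp n d)} (hL' : IsCompact L') (j : ℕ) (l : ℝ) :
    FiniteOrder L' fun φ => T fun p => m p * radialDeriv φ j (p, l) := by
  induction j generalizing l with
  | zero => exact hT.comp_mul hL hm.contDiff (dilation l) fun p hp _ => hm.zero_off p hp
  | succ j ih =>
    refine FiniteOrder.of_tendsto hL' (S := fun i φ =>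
      (((1 / ((i : ℝ) + 1))⁻¹ : ℝ) : ℂ) *
        ((T fun p => m p * Microlocal.radialDeriv φ j (p, l + 1 / ((i : ℝ) + 1))) -
        T fun p => m p * Microlocal.radialDeriv φ j (p, l)))
      (fun i => ((ih _).sub (ih _)).const_mul _) fun φ hφ => ?_
    have h1 := hT.hasDerivAt_radialDeriv hL hm hφ.contDiff j l
    rw [hasDerivAt_iff_tendsto_slope_zero] at h1
    have h2 : Tendsto (fun i : ℕ => 1 / ((i : ℝ) + 1)) atTop (𝓝[≠] 0) :=
      tendsto_nhdsWithin_iff.2 ⟨tendsto_one_div_add_atTop_nhds_zero_nat,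
        Eventually.of_forall fun i => by simp only [mem_compl_iff, mem_singleton_iff]; positivity⟩
    refine (h1.comp h2).congr fun i => ?_
    simp only [Function.comp, Complex.real_smul]

theorem FiniteOrder.normalDeriv (hL : IsCompact L) (hT : FiniteOrder L T) (hm : SmoothIn L m)
    {L' : Set (Sp n d)} (hL' : IsCompact L') (j : ℕ) :
    FiniteOrder L' fun φ => T fun p => m p * normalDeriv φ j p := by
  have h := FiniteOrder.radialDeriv hL hT hm hL' j 0
  have e : ∀ φ, SmoothIn L' φ → (T fun p => m p * Microlocal.normalDeriv φ j p) =
      T fun p => m p * Microlocal.radialDeriv φ j (p, 0) := fun φ hφ => by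
    simp only [normalDeriv_eq_radialDeriv hφ.contDiff]
  obtain ⟨k, C, hC, hb⟩ := h.bound
  exact ⟨fun f g hf hg => by rw [e _ (hf.add hg), e _ hf, e _ hg, h.map_add _ _ hf hg],
    fun c f hf => by rw [e _ (hf.const_mul c), e _ hf, h.map_smul _ _ hf],
    k, C, hC, fun g hg B hB => by rw [e _ hg]; exact hb g hg B hB⟩

theorem FiniteOrder.apply_taylorPoly (hT : FiniteOrder L T) (hm : SmoothIn L m)
    {φ : Sp n d → ℂ} (hφ : ContDiff ℝ ∞ φ) (M : ℕ) :
    (T fun p => m p * taylorPoly M φ p) =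
      ∑ j ∈ Finset.range M, ((j.factorial : ℂ)⁻¹) *
        T fun p => m p * Microlocal.normalDeriv φ j p := by
  have h1 : ∀ j, SmoothIn L fun p => m p * Microlocal.normalDeriv φ j p := fun j =>
    hm.mul_right (contDiff_normalDeriv hφ j)
  have h2 : (fun p => m p * taylorPoly M φ p) = fun p => ∑ j ∈ Finset.range M,
      ((j.factorial : ℂ)⁻¹) * (m p * Microlocal.normalDeriv φ j p) := by
    ext p
    rw [taylorPoly, Finset.mul_sum]
    exact Finset.sum_congr rfl fun j _ => by ring
  rw [h2, hT.map_sum _ fun j _ => (h1 j).const_mul _]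
  exact Finset.sum_congr rfl fun j _ => hT.map_smul _ _ (h1 j)

end

/-- Taylor's estimate for a function given with its successive derivatives `f j`. -/
theorem norm_taylor_remainder_le {M : ℕ} {C r : ℝ} : ∀ {f : ℕ → ℝ → ℂ},
    (∀ j l, HasDerivAt (f j) (f (j + 1) l) l) → (∀ l ∈ Icc 0 r, ‖f M l‖ ≤ C) →
    ∀ l ∈ Icc 0 r, ‖f 0 l - ∑ j ∈ Finset.range M, ((j.factorial : ℂ)⁻¹) * ((l : ℂ) ^ j * f j 0)‖ ≤
      C * l ^ M := by
  induction M with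
  | zero => intro f _ hb l hl; simpa using hb l hl
  | succ M ih =>
    intro f hf hb l hl
    have hC : 0 ≤ C := (norm_nonneg _).trans (hb l hl)
    have h1 := ih (f := fun j => f (j + 1)) (fun j l => hf (j + 1) l) hb
    let g : ℝ → ℂ := fun l =>
      f 0 l - ∑ j ∈ Finset.range (M + 1), ((j.factorial : ℂ)⁻¹) * ((l : ℂ) ^ j * f j 0)
    have hg : ∀ l, HasDerivAt g
        (f 1 l - ∑ j ∈ Finset.range M, ((j.factorial : ℂ)⁻¹) * ((l : ℂ) ^ j * f (j + 1) 0)) l := by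
      intro l
      refine (hf 0 l).sub ?_
      have h2 : ∀ j : ℕ, HasDerivAt (fun l : ℝ => ((j.factorial : ℂ)⁻¹) * ((l : ℂ) ^ j * f j 0))
          (((j.factorial : ℂ)⁻¹) * (((j : ℂ) * (l : ℂ) ^ (j - 1) * 1) * f j 0)) l := fun j =>
        ((((Complex.ofRealCLM.hasDerivAt (x := l))).pow j).mul_const _).const_mul _
      have h3 := HasDerivAt.fun_sum (u := Finset.range (M + 1)) fun j _ => h2 j
      refine h3.congr_deriv ?_
      rw [Finset.sum_range_succ']
      simp only [Nat.cast_zero, zero_mul, mul_zero, add_zero]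
      refine Finset.sum_congr rfl fun j _ => ?_
      have : ((j : ℂ) + 1) ≠ 0 := by exact_mod_cast Nat.succ_ne_zero j
      rw [Nat.factorial_succ]
      push_cast
      field_simp
    have h4 := (convex_Icc (0 : ℝ) l).norm_image_sub_le_of_norm_hasDerivWithin_le
      (f := g) (C := C * l ^ M) (x := 0) (y := l) (fun s _ => (hg s).hasDerivWithinAt)
      (fun s hs => (h1 s ⟨hs.1, hs.2.trans hl.2⟩).trans (by
        have := hs.1
        have := hs.2
        gcongr)) ⟨le_rfl, hl.1⟩ ⟨hl.1, le_rfl⟩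
    have h5 : g 0 = 0 := by
      simp only [g, Finset.sum_range_succ']
      simp
    rw [h5, sub_zero, sub_zero, Real.norm_of_nonneg hl.1] at h4
    rw [pow_succ, ← mul_assoc]
    exact h4

/-! ### Estimates with an exponential factor -/

/-- The parameters `(λ, σ, ω)` of the amplitudes `amplitude φ j`; `ω` is a covector in the normal
directions. -/
abbrev AmpParam (d : ℕ) : Type := ℝ × ℝ × EuclideanSpace ℝ (Fin d)

/-- The amplitudes in `∂_λ^j (e_ζ φ)(x, λh) = (1 + |ξ|)^j e_{(k, λξ)} a_j(x, h; λ, σ, ω)`, where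
`σ = (1 + |ξ|)⁻¹` and `ω = σ ξ`. They depend smoothly on parameters which stay in a compact set. -/
def amplitude (φ : Sp n d → ℂ) : ℕ → Sp n d × AmpParam d → ℂ
  | 0 => fun z => φ (dilation z.2.1 z.1)
  | j + 1 => fun z => (z.2.2.1 : ℂ) * fderiv ℝ (amplitude φ j) z (0, (1, 0, 0)) -
      Complex.I * ((inner ℝ z.2.2.2 z.1.2 : ℝ) : ℂ) * amplitude φ j z

theorem contDiff_amplitude {φ : Sp n d → ℂ} (hφ : ContDiff ℝ ∞ φ) (j : ℕ) :
    ContDiff ℝ ∞ (amplitude φ j) := by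
  induction j with
  | zero =>
    exact hφ.comp (contDiff_dilation_uncurry.comp
      (contDiff_fst.prodMk (contDiff_fst.comp contDiff_snd)))
  | succ j ih =>
    refine ContDiff.sub ?_ ?_
    · exact (Complex.ofRealCLM.contDiff.comp
        (contDiff_fst.comp (contDiff_snd.comp contDiff_snd))).mul
        ((ih.fderiv_right (m := ∞) (by simp)).clm_apply contDiff_const)
    · exact (contDiff_const.mul (Complex.ofRealCLM.contDiff.comp
        ((contDiff_snd.comp (contDiff_snd.comp contDiff_snd)).inner ℝ
          (contDiff_snd.comp contDiff_fst)))).mul ih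

theorem hasDerivAt_expo_dilation (ζ p : Sp n d) (l : ℝ) :
    HasDerivAt (fun l => expo (dilation l ζ) p)
      (-(Complex.I * ((inner ℝ ζ.2 p.2 : ℝ) : ℂ)) * expo (dilation l ζ) p) l := by
  have h1 : HasDerivAt (fun l : ℝ => pairing (dilation l ζ) p) (inner ℝ ζ.2 p.2) l := by
    have h2 : (fun l : ℝ => pairing (dilation l ζ) p) =
        fun l => inner ℝ ζ.1 p.1 + l * inner ℝ ζ.2 p.2 := by
      ext l; simp [pairing, inner_smul_left]
    rw [h2]
    simpa using ((hasDerivAt_id l).mul_const (inner ℝ ζ.2 p.2)).const_add (inner ℝ ζ.1 p.1)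
  have h3 := ((h1.ofReal_comp.const_mul Complex.I).neg).cexp
  refine h3.congr_deriv ?_
  rw [mul_comm]
  rfl

theorem radialDeriv_expo_mul {φ : Sp n d → ℂ} (hφ : ContDiff ℝ ∞ φ) (ζ : Sp n d) (j : ℕ)
    (p : Sp n d) (l : ℝ) :
    radialDeriv (fun p => expo ζ p * φ p) j (p, l) = ((1 + ‖ζ.2‖ : ℝ) : ℂ) ^ j *
      (expo (dilation l ζ) p * amplitude φ j (p, (l, (1 + ‖ζ.2‖)⁻¹, (1 + ‖ζ.2‖)⁻¹ • ζ.2))) := by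
  have hne : ((1 + ‖ζ.2‖ : ℝ) : ℂ) ≠ 0 := by
    have : 0 < 1 + ‖ζ.2‖ := by positivity
    exact_mod_cast this.ne'
  induction j generalizing l with
  | zero => simp only [radialDeriv, amplitude, pow_zero, one_mul, expo_dilation]
  | succ j ih =>
    have h1 : HasDerivAt (fun l => radialDeriv (fun p => expo ζ p * φ p) j (p, l))
        (radialDeriv (fun p => expo ζ p * φ p) (j + 1) (p, l)) l :=
      hasDerivAt_dparam (contDiff_radialDeriv ((contDiff_expo ζ).mul hφ) j) p l
    rw [funext ih] at h1
    refine h1.unique ?_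
    have h2 : HasFDerivAt (amplitude φ j) _ (p, (l, (1 + ‖ζ.2‖)⁻¹, (1 + ‖ζ.2‖)⁻¹ • ζ.2)) :=
      ((contDiff_amplitude hφ j).differentiable (by simp)).differentiableAt.hasFDerivAt
    have h3 := h2.comp_hasDerivAt l ((hasDerivAt_const l p).prodMk ((hasDerivAt_id l).prodMk
      ((hasDerivAt_const l (1 + ‖ζ.2‖)⁻¹).prodMk (hasDerivAt_const l ((1 + ‖ζ.2‖)⁻¹ • ζ.2)))))
    have h4 := ((hasDerivAt_expo_dilation ζ p l).mul h3).const_mul (((1 + ‖ζ.2‖ : ℝ) : ℂ) ^ j)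
    refine h4.congr_deriv ?_
    simp only [amplitude, inner_smul_left, id, Function.comp]
    have hinv := mul_inv_cancel₀ hne
    simp only [conj_trivial]
    push_cast at hinv ⊢
    linear_combination (-((1 + (‖ζ.2‖ : ℂ)) ^ j * expo (dilation l ζ) p *
      (fderiv ℝ (amplitude φ j) (p, (l, (1 + ‖ζ.2‖)⁻¹, (1 + ‖ζ.2‖)⁻¹ • ζ.2)) (0, (1, 0, 0)) -
        Complex.I * ((inner ℝ ζ.2 p.2 : ℝ) : ℂ) *
          amplitude φ j (p, (l, (1 + ‖ζ.2‖)⁻¹, (1 + ‖ζ.2‖)⁻¹ • ζ.2))))) * hinv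

/-- A family of functionals which is bounded on each of the functions `e_{(k, λξ)} g` is bounded by
powers of `|ξ|` on the radial derivatives of `e_{(k, ξ)} φ`. -/
theorem exists_bound_radialDeriv (hL : IsCompact L) {ι : Type*} {T : ι → (Sp n d → ℂ) → ℂ}
    (hT : ∀ i, FiniteOrder L (T i)) (ζ : ι → Sp n d) {Λ : Set ℝ} (hΛ : Λ ⊆ Icc 0 1)
    (hpt : ∀ g, SmoothIn L g →
      ∃ C, ∀ i, ∀ l ∈ Λ, ‖T i fun p => expo (dilation l (ζ i)) p * g p‖ ≤ C)
    {m : Sp n d × ℝ → ℂ} (hm : ContDiff ℝ ∞ m) {R : Set ℝ} (hR : IsCompact R)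
    (hm0 : ∀ r ∈ R, ∀ p ∉ L, m (p, r) = 0) {φ : Sp n d → ℂ} (hφ : ContDiff ℝ ∞ φ) (j : ℕ) :
    ∃ C, 0 ≤ C ∧ ∀ i, ∀ r ∈ R, ∀ l ∈ Λ,
      ‖T i fun p => m (p, r) * radialDeriv (fun p => expo (ζ i) p * φ p) j (p, l)‖ ≤
        C * (1 + ‖(ζ i).2‖) ^ j := by
  have hQ : IsCompact (R ×ˢ (Icc (0 : ℝ) 1 ×ˢ (Icc (0 : ℝ) 1 ×ˢ
      Metric.closedBall (0 : EuclideanSpace ℝ (Fin d)) 1))) :=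
    hR.prod (isCompact_Icc.prod (isCompact_Icc.prod (isCompact_closedBall _ _)))
  obtain ⟨C, hC, hb⟩ := FiniteOrder.param_bound hL
    (T := fun (z : ι × Λ) g => T z.1 fun p => expo (dilation (z.2 : ℝ) (ζ z.1)) p * g p)
    (fun z => (hT z.1).mul hL (contDiff_expo _))
    (fun g hg => (hpt g hg).imp fun C hC z => hC z.1 z.2 z.2.2) hQ
    (H := fun z : Sp n d × (ℝ × AmpParam d) => m (z.1, z.2.1) * amplitude φ j (z.1, z.2.2))
    ((hm.comp (contDiff_fst.prodMk (contDiff_fst.comp contDiff_snd))).mul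
      ((contDiff_amplitude hφ j).comp (contDiff_fst.prodMk (contDiff_snd.comp contDiff_snd))))
    (fun q hq p hp => by simp [hm0 q.1 hq.1 p hp])
  refine ⟨C, hC, fun i r hr l hl => ?_⟩
  have hpos : 0 < 1 + ‖(ζ i).2‖ := by positivity
  have h1 := hb (i, ⟨l, hl⟩) (r, (l, (1 + ‖(ζ i).2‖)⁻¹, (1 + ‖(ζ i).2‖)⁻¹ • (ζ i).2))
    ⟨hr, hΛ hl, ⟨by positivity, inv_le_one_of_one_le₀ (by linarith [norm_nonneg (ζ i).2])⟩, by
      rw [mem_closedBall_zero_iff, norm_smul, norm_inv, Real.norm_of_nonneg hpos.le,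
        inv_mul_le_iff₀ hpos]
      linarith⟩
  simp only [radialDeriv_expo_mul hφ]
  have hs : SmoothIn L fun p => expo (dilation l (ζ i)) p *
      (m (p, r) * amplitude φ j (p, (l, (1 + ‖(ζ i).2‖)⁻¹, (1 + ‖(ζ i).2‖)⁻¹ • (ζ i).2))) :=
    ⟨(contDiff_expo _).mul ((contDiff_slice hm r).mul (contDiff_slice (contDiff_amplitude hφ j) _)),
      fun p hp => by simp [hm0 r hr p hp]⟩
  have h2 := (hT i).map_smul (((1 + ‖(ζ i).2‖ : ℝ) : ℂ) ^ j) _ hs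
  have h3 : (fun p => m (p, r) * (((1 + ‖(ζ i).2‖ : ℝ) : ℂ) ^ j * (expo (dilation l (ζ i)) p *
      amplitude φ j (p, (l, (1 + ‖(ζ i).2‖)⁻¹, (1 + ‖(ζ i).2‖)⁻¹ • (ζ i).2))))) =
      fun p => ((1 + ‖(ζ i).2‖ : ℝ) : ℂ) ^ j * (expo (dilation l (ζ i)) p *
      (m (p, r) * amplitude φ j (p, (l, (1 + ‖(ζ i).2‖)⁻¹, (1 + ‖(ζ i).2‖)⁻¹ • (ζ i).2)))) := by
    ext p; ring
  rw [h3, h2, norm_mul, norm_pow, Complex.norm_real, Real.norm_of_nonneg hpos.le, mul_comm]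
  exact mul_le_mul_of_nonneg_right h1 (pow_nonneg hpos.le _)

/-- The Taylor remainder of order `M` of `e_ζ φ`, dilated by `λ`, contributes a factor `λ^M`, at the
cost of a factor `(1 + |ξ|)^M`. -/
theorem exists_bound_remainder (hL : IsCompact L) {ι : Type*} {T : ι → (Sp n d → ℂ) → ℂ}
    (hT : ∀ i, FiniteOrder L (T i)) (ζ : ι → Sp n d)
    (hpt : ∀ g, SmoothIn L g →
      ∃ C, ∀ i, ∀ l ∈ Icc (0 : ℝ) 1, ‖T i fun p => expo (dilation l (ζ i)) p * g p‖ ≤ C)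
    {m : Sp n d × ℝ → ℂ} (hm : ContDiff ℝ ∞ m) {R : Set ℝ} (hR : IsCompact R)
    (hm0 : ∀ r ∈ R, ∀ p ∉ L, m (p, r) = 0) {φ : Sp n d → ℂ} (hφ : ContDiff ℝ ∞ φ) (M : ℕ) :
    ∃ C, 0 ≤ C ∧ ∀ i, ∀ r ∈ R, ∀ l ∈ Icc (0 : ℝ) 1,
      ‖T i fun p => m (p, r) * (expo (ζ i) (dilation l p) * φ (dilation l p) -
        taylorPoly M (fun p => expo (ζ i) p * φ p) (dilation l p))‖ ≤
        C * (1 + ‖(ζ i).2‖) ^ M * l ^ M := by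
  obtain ⟨C, hC, hb⟩ := exists_bound_radialDeriv hL hT ζ subset_rfl hpt hm hR hm0 hφ M
  refine ⟨C, hC, fun i r hr l hl => ?_⟩
  have hψ : ContDiff ℝ ∞ fun p => expo (ζ i) p * φ p := (contDiff_expo _).mul hφ
  set ψ : Sp n d → ℂ := fun p => expo (ζ i) p * φ p
  have hmr : SmoothIn L fun p => m (p, r) := ⟨contDiff_slice hm r, fun p hp => hm0 r hr p hp⟩
  have h1 := norm_taylor_remainder_le
    (f := fun j l => T i fun p => m (p, r) * radialDeriv ψ j (p, l))
    (fun j l => (hT i).hasDerivAt_radialDeriv hL hmr hψ j l) (fun l hl => hb i r hr l hl) l hl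
  refine le_trans (le_of_eq ?_) h1
  congr 1
  have hs : ∀ j, SmoothIn L fun p => m (p, r) * normalDeriv ψ j p := fun j =>
    hmr.mul_right (contDiff_normalDeriv hψ j)
  have e1 : (fun p => m (p, r) * (expo (ζ i) (dilation l p) * φ (dilation l p) -
        taylorPoly M ψ (dilation l p))) = fun p => m (p, r) * radialDeriv ψ 0 (p, l) -
        ∑ j ∈ Finset.range M, (((j.factorial : ℂ)⁻¹) * (l : ℂ) ^ j) *
          (m (p, r) * normalDeriv ψ j p) := by
    ext p
    rw [mul_sub, taylorPoly, Finset.mul_sum]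
    congr 1
    exact Finset.sum_congr rfl fun j _ => by rw [normalDeriv_dilation]; ring
  rw [e1, (hT i).map_sub (hmr.mul_right (contDiff_slice (contDiff_radialDeriv hψ 0) l))
    (.sum _ fun j _ => (hs j).const_mul _), (hT i).map_sum _ fun j _ => (hs j).const_mul _]
  congr 1
  refine Finset.sum_congr rfl fun j _ => ?_
  rw [(hT i).map_smul _ _ (hs j), mul_assoc]
  simp only [normalDeriv_eq_radialDeriv hψ]

end Taylor

/-! ### Functions controlled on dyadic intervals -/

section Dyadic

variable {F : ℝ → ℂ} {a C : ℝ}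

/-- If `F` varies by `O(λ^a)`, `a > 0`, on `[λ/2, λ]`, the geometric series bounds its variation on
all of `(0, λ]`. -/
theorem norm_sub_le_of_dyadic (ha : 0 < a)
    (hF : ∀ l ∈ Ioc (0 : ℝ) 1, ∀ r ∈ Icc (1 : ℝ) 2, ‖F (l / r) - F l‖ ≤ C * l ^ a)
    {l ε : ℝ} (hl : l ∈ Ioc (0 : ℝ) 1) (hε : ε ∈ Ioc 0 l) :
    ‖F ε - F l‖ ≤ C * (1 - (2 : ℝ) ^ (-a))⁻¹ * l ^ a := by
  have h2 : (2 : ℝ) ^ (-a) < 1 := Real.rpow_lt_one_of_one_lt_of_neg one_lt_two (by linarith)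
  have h2' : 0 < (2 : ℝ) ^ (-a) := by positivity
  have hC : 0 ≤ C := by
    have := (norm_nonneg _).trans (hF 1 ⟨one_pos, le_rfl⟩ 1 ⟨le_rfl, one_le_two⟩)
    simpa using this
  have hc : 1 ≤ (1 - (2 : ℝ) ^ (-a))⁻¹ := (one_le_inv₀ (by linarith)).2 (by linarith)
  have key : ∀ k : ℕ, ∀ l ∈ Ioc (0 : ℝ) 1, ∀ ε ∈ Icc (l / 2 ^ k) l,
      ‖F ε - F l‖ ≤ C * (1 - (2 : ℝ) ^ (-a))⁻¹ * l ^ a := by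
    intro k
    induction k with
    | zero =>
      intro l hl ε hε
      have : ε = l := le_antisymm hε.2 (by simpa using hε.1)
      rw [this, sub_self, norm_zero]
      have := hl.1
      positivity
    | succ k ih =>
      intro l hl ε hε
      have hl0 := hl.1
      have hε0 : 0 < ε := lt_of_lt_of_le (by positivity) hε.1
      by_cases hcase : l / 2 ≤ ε
      · have h3 := hF l hl (l / ε) ⟨(one_le_div hε0).2 hε.2, (div_le_iff₀ hε0).2 (by linarith)⟩
        rw [div_div_cancel₀ hl0.ne'] at h3
        refine h3.trans ?_
        rw [mul_assoc]
        gcongr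
        exact le_mul_of_one_le_left (by positivity) hc
      · have h3 := ih (l / 2) ⟨by positivity, by linarith [hl.2]⟩ ε
          ⟨by rw [div_div, ← pow_succ']; exact hε.1, (not_le.1 hcase).le⟩
        have h4 := hF l hl 2 ⟨one_le_two, le_rfl⟩
        have h5 : (l / 2) ^ a = (2 : ℝ) ^ (-a) * l ^ a := by
          rw [Real.div_rpow hl0.le zero_le_two, Real.rpow_neg zero_le_two]
          ring
        calc ‖F ε - F l‖ ≤ ‖F ε - F (l / 2)‖ + ‖F (l / 2) - F l‖ :=
              norm_sub_le_norm_sub_add_norm_sub ..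
          _ ≤ C * (1 - (2 : ℝ) ^ (-a))⁻¹ * ((2 : ℝ) ^ (-a) * l ^ a) + C * l ^ a := by
              rw [← h5]; exact add_le_add h3 h4
          _ = C * (1 - (2 : ℝ) ^ (-a))⁻¹ * l ^ a := by
              have : 1 - (2 : ℝ) ^ (-a) ≠ 0 := by linarith
              field_simp
              ring
  obtain ⟨k, hk⟩ := pow_unbounded_of_one_lt (l / ε) one_lt_two
  refine key k l hl ε ⟨?_, hε.2⟩
  rw [div_le_iff₀ (by positivity)]
  rw [div_lt_iff₀ hε.1] at hk
  linarith

/-- If `F` varies by `O(λ^a)`, `a > 0`, on `[λ/2, λ]`, it has a limit at `0`. -/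
theorem exists_tendsto_of_dyadic (ha : 0 < a)
    (hF : ∀ l ∈ Ioc (0 : ℝ) 1, ∀ r ∈ Icc (1 : ℝ) 2, ‖F (l / r) - F l‖ ≤ C * l ^ a) :
    ∃ y, Tendsto F (𝓝[>] 0) (𝓝 y) := by
  refine cauchy_map_iff_exists_tendsto.1 ?_
  have h0 : Tendsto (fun l : ℝ => 2 * (C * (1 - (2 : ℝ) ^ (-a))⁻¹ * l ^ a)) (𝓝[>] 0) (𝓝 0) := by
    have : Tendsto (fun l : ℝ => l ^ a) (𝓝[>] 0) (𝓝 0) := by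
      have := (Real.continuousAt_rpow_const 0 a (Or.inr ha.le)).tendsto
      rw [Real.zero_rpow ha.ne'] at this
      exact this.mono_left nhdsWithin_le_nhds
    simpa using (this.const_mul (C * (1 - (2 : ℝ) ^ (-a))⁻¹)).const_mul 2
  rw [Metric.cauchy_iff]
  refine ⟨inferInstance, fun δ hδ => ?_⟩
  obtain ⟨l, hl1, hl⟩ := ((h0.eventually_lt_const hδ).and
    (Ioc_mem_nhdsGT (zero_lt_one' ℝ))).exists
  refine ⟨F '' Ioc 0 l, image_mem_map (Ioc_mem_nhdsGT hl.1), ?_⟩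
  rintro _ ⟨ε, hε, rfl⟩ _ ⟨ε', hε', rfl⟩
  have h1 := norm_sub_le_of_dyadic ha hF hl hε
  have h2 := norm_sub_le_of_dyadic ha hF hl hε'
  calc dist (F ε) (F ε') ≤ dist (F ε) (F l) + dist (F ε') (F l) := dist_triangle_right _ _ _
    _ < δ := by rw [dist_eq_norm, dist_eq_norm]; linarith

theorem norm_limit_sub_le_of_dyadic (ha : 0 < a)
    (hF : ∀ l ∈ Ioc (0 : ℝ) 1, ∀ r ∈ Icc (1 : ℝ) 2, ‖F (l / r) - F l‖ ≤ C * l ^ a) {y : ℂ}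
    (hy : Tendsto F (𝓝[>] 0) (𝓝 y)) : ‖y - F 1‖ ≤ C * (1 - (2 : ℝ) ^ (-a))⁻¹ := by
  refine le_of_tendsto (hy.sub_const (F 1)).norm ?_
  filter_upwards [Ioc_mem_nhdsGT (zero_lt_one' ℝ)] with ε hε
  simpa using norm_sub_le_of_dyadic ha hF ⟨one_pos, le_rfl⟩ hε

/-- If `F` varies by `O(λ^a)`, `a < 0`, on `[λ/2, λ]`, it is `O(λ^a)` up to a constant. -/
theorem norm_sub_one_le_of_dyadic (ha : a < 0)
    (hF : ∀ l ∈ Ioc (0 : ℝ) 1, ∀ r ∈ Icc (1 : ℝ) 2, ‖F (l / r) - F l‖ ≤ C * l ^ a)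
    {l : ℝ} (hl : l ∈ Ioc (0 : ℝ) 1) :
    ‖F l - F 1‖ ≤ C * (1 - (2 : ℝ) ^ a)⁻¹ * l ^ a := by
  have h2 : (2 : ℝ) ^ a < 1 := Real.rpow_lt_one_of_one_lt_of_neg one_lt_two ha
  have h2' : 0 < (2 : ℝ) ^ a := by positivity
  have hC : 0 ≤ C := by
    have := (norm_nonneg _).trans (hF 1 ⟨one_pos, le_rfl⟩ 1 ⟨le_rfl, one_le_two⟩)
    simpa using this
  have hc : 1 ≤ (1 - (2 : ℝ) ^ a)⁻¹ := (one_le_inv₀ (by linarith)).2 (by linarith)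
  have key : ∀ k : ℕ, ∀ l ∈ Icc ((1 / 2 : ℝ) ^ (k + 1)) 1,
      ‖F l - F 1‖ ≤ C * (1 - (2 : ℝ) ^ a)⁻¹ * l ^ a := by
    have base : ∀ l ∈ Icc (1 / 2 : ℝ) 1, ‖F l - F 1‖ ≤ C * (1 - (2 : ℝ) ^ a)⁻¹ * l ^ a := by
      intro l hl
      have hl0 : 0 < l := lt_of_lt_of_le (by norm_num) hl.1
      have h3 := hF 1 ⟨one_pos, le_rfl⟩ l⁻¹ ⟨(one_le_inv₀ hl0).2 hl.2, by
        rw [inv_le_comm₀ hl0 two_pos]; linarith [hl.1]⟩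
      rw [div_inv_eq_mul, one_mul, Real.one_rpow, mul_one] at h3
      refine h3.trans ?_
      rw [mul_assoc]
      exact le_mul_of_one_le_right hC (one_le_mul_of_one_le_of_one_le hc
        (Real.one_le_rpow_of_pos_of_le_one_of_nonpos hl0 hl.2 ha.le))
    intro k
    induction k with
    | zero => simpa using base
    | succ k ih =>
      intro l hl
      by_cases hcase : 1 / 2 ≤ l
      · exact base l ⟨hcase, hl.2⟩
      have hl0 : 0 < l := lt_of_lt_of_le (by positivity) hl.1
      have h3 := ih (2 * l) ⟨by have := hl.1; rw [pow_succ] at this; linarith, by linarith⟩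
      have h4 := hF (2 * l) ⟨by linarith, by linarith⟩ 2 ⟨one_le_two, le_rfl⟩
      rw [mul_div_cancel_left₀ _ two_ne_zero] at h4
      rw [Real.mul_rpow zero_le_two hl0.le] at h3 h4
      calc ‖F l - F 1‖ ≤ ‖F l - F (2 * l)‖ + ‖F (2 * l) - F 1‖ :=
            norm_sub_le_norm_sub_add_norm_sub ..
        _ ≤ C * ((2 : ℝ) ^ a * l ^ a) + C * (1 - (2 : ℝ) ^ a)⁻¹ * ((2 : ℝ) ^ a * l ^ a) :=
            add_le_add h4 h3
        _ = C * (1 - (2 : ℝ) ^ a)⁻¹ * l ^ a * (2 * (2 : ℝ) ^ a - ((2 : ℝ) ^ a) ^ 2) := by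
            have : 1 - (2 : ℝ) ^ a ≠ 0 := by linarith
            field_simp
            ring
        _ ≤ C * (1 - (2 : ℝ) ^ a)⁻¹ * l ^ a * 1 := by
            have : 0 ≤ (1 - (2 : ℝ) ^ a)⁻¹ := by linarith
            gcongr
            nlinarith [sq_nonneg (1 - (2 : ℝ) ^ a)]
        _ = _ := mul_one _
  obtain ⟨k, hk⟩ := exists_pow_lt_of_lt_one hl.1 (by norm_num : (1 / 2 : ℝ) < 1)
  refine key k l ⟨le_trans ?_ hk.le, hl.2⟩
  rw [pow_succ]
  linarith [show 0 < (1 / 2 : ℝ) ^ k by positivity]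

end Dyadic

/-! ### Localization of rapid decrease -/

section Localization

variable {n d : ℕ} {L : Set (Sp n d)}

theorem covNorm_nonneg (ζ : Sp n d) : 0 ≤ covNorm ζ := by unfold covNorm; positivity

theorem covNorm_smul (c : ℝ) (ζ : Sp n d) : covNorm (c • ζ) = |c| * covNorm ζ := by
  simp [covNorm, norm_smul]; ring

theorem covNorm_add_le (ζ η : Sp n d) : covNorm (ζ + η) ≤ covNorm ζ + covNorm η := by
  have h1 := norm_add_le ζ.1 η.1
  have h2 := norm_add_le ζ.2 η.2
  simp only [covNorm, Prod.fst_add, Prod.snd_add]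
  linarith

theorem norm_le_covNorm (ζ : Sp n d) : ‖ζ‖ ≤ covNorm ζ :=
  max_le (by simp [covNorm]) (by simp [covNorm])

theorem covNorm_le_two_mul_norm (ζ : Sp n d) : covNorm ζ ≤ 2 * ‖ζ‖ := by
  have h1 : ‖ζ.1‖ ≤ ‖ζ‖ := le_max_left _ _
  have h2 : ‖ζ.2‖ ≤ ‖ζ‖ := le_max_right _ _
  unfold covNorm
  linarith

/-- The pairing with a covector as a continuous linear form. -/
def pairingCLM (ζ : Sp n d) : Sp n d →L[ℝ] ℝ :=
  ((innerSL ℝ ζ.1).comp (.fst ℝ _ _)) + ((innerSL ℝ ζ.2).comp (.snd ℝ _ _))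

theorem norm_pairingCLM_le (ζ : Sp n d) : ‖pairingCLM ζ‖ ≤ covNorm ζ := by
  refine ContinuousLinearMap.opNorm_le_bound _ (covNorm_nonneg ζ) fun p => ?_
  have h1 : ‖p.1‖ ≤ ‖p‖ := le_max_left _ _
  have h2 : ‖p.2‖ ≤ ‖p‖ := le_max_right _ _
  calc ‖pairingCLM ζ p‖ ≤ ‖inner ℝ ζ.1 p.1‖ + ‖inner ℝ ζ.2 p.2‖ := norm_add_le _ _
    _ ≤ ‖ζ.1‖ * ‖p‖ + ‖ζ.2‖ * ‖p‖ := by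
        gcongr
        · exact (norm_inner_le_norm _ _).trans (by gcongr)
        · exact (norm_inner_le_norm _ _).trans (by gcongr)
    _ = covNorm ζ * ‖p‖ := by rw [covNorm]; ring

theorem norm_iteratedFDeriv_expo_le (ζ : Sp n d) (i : ℕ) (p : Sp n d) :
    ‖iteratedFDeriv ℝ i (fun p => expo ζ p) p‖ ≤ covNorm ζ ^ i := by
  let g : ℝ → ℂ := fun s => Complex.exp (-(Complex.I * s))
  have hg : ContDiff ℝ ∞ g := (contDiff_const.mul Complex.ofRealCLM.contDiff).neg.cexp
  have h1 : ∀ i, iteratedDeriv i g = fun s => (-Complex.I) ^ i * g s := by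
    intro i
    induction i with
    | zero => ext s; simp
    | succ i ih =>
      ext s
      rw [iteratedDeriv_succ, ih]
      have h2 : HasDerivAt g (Complex.exp (-(Complex.I * s)) * -(Complex.I * 1)) s :=
        (((Complex.ofRealCLM.hasDerivAt (x := s)).const_mul Complex.I).neg).cexp
      rw [(h2.const_mul ((-Complex.I) ^ i)).deriv]
      simp only [g]
      ring
  have h2 : ∀ s, ‖iteratedFDeriv ℝ i g s‖ = 1 := by
    intro s
    rw [norm_iteratedFDeriv_eq_norm_iteratedDeriv, h1]
    have : g s = Complex.exp ((-s : ℝ) * Complex.I) := by simp only [g]; congr 1; push_cast; ring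
    simp only [this]
    rw [norm_mul, Complex.norm_exp_ofReal_mul_I, norm_pow, norm_neg, Complex.norm_I]
    simp
  have h3 : iteratedFDeriv ℝ i (fun p => expo ζ p) p =
      (iteratedFDeriv ℝ i g (pairingCLM ζ p)).compContinuousLinearMap fun _ => pairingCLM ζ :=
    (pairingCLM ζ).iteratedFDeriv_comp_right hg p (mod_cast le_top)
  rw [h3]
  refine (ContinuousMultilinearMap.norm_compContinuousLinearMap_le _ _).trans ?_
  rw [h2, one_mul, Finset.prod_const, Finset.card_univ, Fintype.card_fin]
  exact pow_le_pow_left₀ (norm_nonneg _) (norm_pairingCLM_le ζ) i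

theorem exists_bound_iteratedFDeriv_expo_mul (hL : IsCompact L) {χ : Sp n d → ℂ}
    (hχ : SmoothIn L χ) (j : ℕ) : ∃ D, 0 ≤ D ∧ ∀ ζ x,
      ‖iteratedFDeriv ℝ j (fun p => expo ζ p * χ p) x‖ ≤ D * (1 + covNorm ζ) ^ j := by
  choose B hB0 hB using fun k => hχ.exists_derivBound hL k
  refine ⟨∑ i ∈ Finset.range (j + 1), (j.choose i : ℝ) * B (j - i),
    Finset.sum_nonneg fun i _ => mul_nonneg (Nat.cast_nonneg _) (hB0 _), fun ζ x => ?_⟩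
  refine (norm_iteratedFDeriv_mul_le (contDiff_expo ζ) hχ.contDiff x (mod_cast le_top)).trans ?_
  rw [Finset.sum_mul]
  refine Finset.sum_le_sum fun i hi => ?_
  have h0 := covNorm_nonneg ζ
  have h1 : ‖iteratedFDeriv ℝ i (fun p => expo ζ p) x‖ ≤ (1 + covNorm ζ) ^ j :=
    (norm_iteratedFDeriv_expo_le ζ i x).trans ((pow_le_pow_left₀ h0 (by linarith) i).trans
      (pow_le_pow_right₀ (by linarith) (Nat.lt_succ_iff.1 (Finset.mem_range.1 hi))))
  calc _ ≤ (j.choose i : ℝ) * (1 + covNorm ζ) ^ j * B (j - i) := by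
        gcongr
        exact hB _ x
    _ = _ := by ring

/-- Fourier transforms of compactly supported distributions grow at most polynomially. -/
theorem FiniteOrder.exists_bound_expo_mul {T : (Sp n d → ℂ) → ℂ} (hT : FiniteOrder L T)
    (hL : IsCompact L) {χ : Sp n d → ℂ} (hχ : SmoothIn L χ) : ∃ (m : ℕ) (C : ℝ), 0 ≤ C ∧
      ∀ ζ, ‖T fun p => expo ζ p * χ p‖ ≤ C * (1 + covNorm ζ) ^ m := by
  obtain ⟨k, C, hC, hb⟩ := hT.bound
  choose D hD0 hD using fun j => exists_bound_iteratedFDeriv_expo_mul hL hχ j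
  refine ⟨k, C * ∑ j ∈ Finset.range (k + 1), D j,
    mul_nonneg hC (Finset.sum_nonneg fun j _ => hD0 j), fun ζ => ?_⟩
  rw [mul_assoc]
  refine hb _ (.mul_left (contDiff_expo ζ) hχ) _ fun j hj x => (hD j ζ x).trans ?_
  have h0 := covNorm_nonneg ζ
  have hs : D j ≤ ∑ j ∈ Finset.range (k + 1), D j :=
    Finset.single_le_sum (f := D) (fun l _ => hD0 l) (Finset.mem_range.2 (by omega))
  have h1 : (1 : ℝ) ≤ 1 + covNorm ζ := by linarith
  exact mul_le_mul hs (pow_le_pow_right₀ h1 hj) (by positivity) ((hD0 j).trans hs)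

/-- A smooth function on the line supported in `[-1/4, 1/4]` agrees on `[-1/2, 1/2]` with a
trigonometric series with rapidly decreasing coefficients, by Poisson's summation formula. -/
theorem exists_trigonometric_series {β : ℝ → ℂ} (hβ : ContDiff ℝ ∞ β)
    (h0 : ∀ s, 1 / 4 < |s| → β s = 0) :
    ∃ c : ℤ → ℂ, (∀ Q : ℕ, Summable fun k : ℤ => ‖c k‖ * (1 + |(k : ℝ)|) ^ Q) ∧
      ∀ s : ℝ, |s| ≤ 1 / 2 →
        HasSum (fun k : ℤ => c k * Complex.exp (2 * Real.pi * Complex.I * k * s)) (β s) := by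
  have hc : HasCompactSupport β := HasCompactSupport.intro (isCompact_closedBall (0 : ℝ) (1 / 4))
    fun s hs => h0 s (by simpa using hs)
  let f : SchwartzMap ℝ ℂ := hc.toSchwartzMap hβ
  have hf : ∀ s, f s = β s := fun s => rfl
  let g : SchwartzMap ℝ ℂ := FourierTransform.fourier f
  have hdec : ∀ Q : ℕ, Summable fun k : ℤ => ‖g k‖ * (1 + |(k : ℝ)|) ^ Q := by
    intro Q
    obtain ⟨C, hC⟩ : ∃ C, ∀ x : ℝ, (1 + ‖x‖) ^ (Q + 2) * ‖g x‖ ≤ C := by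
      have h1 := fun x => SchwartzMap.one_add_le_sup_seminorm_apply (𝕜 := ℝ) (m := (Q + 2, 0))
        (k := Q + 2) (n := 0) le_rfl le_rfl g x
      simp only [norm_iteratedFDeriv_zero] at h1
      exact ⟨_, h1⟩
    have hs : Summable fun k : ℤ => C * (1 / |(k : ℝ) + 0| ^ (2 : ℝ)) :=
      ((Real.summable_one_div_int_add_rpow 0 2).2 one_lt_two).mul_left C
    refine Summable.of_norm_bounded_eventually hs ?_
    filter_upwards [(Set.finite_singleton (0 : ℤ)).compl_mem_cofinite] with k hk
    have hk' : 0 < |(k : ℝ)| := by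
      rw [abs_pos]; exact_mod_cast hk
    have h1 := hC k
    rw [Real.norm_eq_abs] at h1
    rw [Real.norm_of_nonneg (by positivity), add_zero, Real.rpow_two, mul_one_div,
      le_div_iff₀ (by positivity)]
    refine le_trans ?_ h1
    calc ‖g k‖ * (1 + |(k : ℝ)|) ^ Q * |(k : ℝ)| ^ 2
        ≤ ‖g k‖ * (1 + |(k : ℝ)|) ^ Q * (1 + |(k : ℝ)|) ^ 2 := by gcongr; linarith
      _ = _ := by ring
  refine ⟨fun k => g k, hdec, fun s hs => ?_⟩
  have hsum : Summable fun k : ℤ => g k * Complex.exp (2 * Real.pi * Complex.I * k * s) := by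
    refine Summable.of_norm_bounded (by simpa using hdec 0) fun k => ?_
    have : Complex.exp (2 * Real.pi * Complex.I * k * s) =
        Complex.exp ((2 * Real.pi * k * s : ℝ) * Complex.I) := by congr 1; push_cast; ring
    rw [norm_mul, this, Complex.norm_exp_ofReal_mul_I, mul_one]
  -- For `|s| ≤ 1/2` only the term `k = 0` of the periodization `∑ β(s + k)` is nonzero.
  have hP := f.tsum_eq_tsum_fourier s
  rw [tsum_eq_single 0] at hP
  · have h2 : β s = ∑' k : ℤ, g k * Complex.exp (2 * Real.pi * Complex.I * k * s) := by
      rw [← hf, show f s = f (s + (0 : ℤ)) by simp, hP]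
      refine tsum_congr fun k => ?_
      rw [fourier_coe_apply]
      simp only [Complex.ofReal_one, div_one]
      rfl
    rw [h2]
    exact hsum.hasSum
  · intro k hk
    rw [hf]
    refine h0 _ ?_
    have h1 : (1 : ℝ) ≤ |(k : ℝ)| := by exact_mod_cast Int.one_le_abs hk
    have h2 : |(k : ℝ)| ≤ |s + k| + |s| := by
      calc |(k : ℝ)| = |(s + k) - s| := by ring_nf
        _ ≤ _ := abs_sub _ _
    linarith

/-- `ζ ↦ T(e_ζ χ)` is rapidly decreasing in a conic neighbourhood of `η`. -/
def DecaysAt (T : (Sp n d → ℂ) → ℂ) (χ : Sp n d → ℂ) (η : Sp n d) : Prop :=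
  ∃ V : Set (Sp n d), IsConic V ∧ V ∈ 𝓝 η ∧
    ∀ N : ℕ, ∃ C : ℝ, ∀ ζ ∈ V, (1 + covNorm ζ) ^ N * ‖T fun p => expo ζ p * χ p‖ ≤ C

/-- A conic neighbourhood contains a smaller one which stays inside when perturbed by covectors of
small relative size. -/
theorem exists_conic_shrink {V : Set (Sp n d)} {η : Sp n d} (hV : IsConic V) (hη : V ∈ 𝓝 η) :
    ∃ (V' : Set (Sp n d)) (c : ℝ), IsConic V' ∧ V' ∈ 𝓝 η ∧ 0 < c ∧ c ≤ 1 / 2 ∧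
      ∀ ζ ∈ V', ∀ y, covNorm y ≤ c * covNorm ζ → ζ + y ∈ V := by
  obtain ⟨r, hr, hrV⟩ := Metric.mem_nhds_iff.1 hη
  refine ⟨{ζ | ∃ τ : ℝ, 0 < τ ∧ ‖τ • ζ - η‖ < r / 2}, min (1 / 2) (r / (4 * (‖η‖ + r))),
    ?_, ?_, by positivity, min_le_left _ _, ?_⟩
  · rintro ζ ⟨τ, hτ, h⟩ c hc
    exact ⟨τ / c, by positivity, by rwa [smul_smul, div_mul_cancel₀ _ hc.ne']⟩
  · filter_upwards [Metric.ball_mem_nhds η (half_pos hr)] with ζ hζ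
    exact ⟨1, one_pos, by simpa [dist_eq_norm] using hζ⟩
  · rintro ζ ⟨τ, hτ, h⟩ y hy
    have h1 : ‖τ • ζ‖ ≤ ‖η‖ + r := by
      have := norm_le_norm_add_norm_sub' (τ • ζ) η
      linarith
    have h2 : ‖τ • y‖ ≤ r / 2 := by
      calc ‖τ • y‖ ≤ covNorm (τ • y) := norm_le_covNorm _
        _ = τ * covNorm y := by rw [covNorm_smul, abs_of_pos hτ]
        _ ≤ τ * (r / (4 * (‖η‖ + r)) * covNorm ζ) := by
            gcongr
            exact hy.trans (mul_le_mul_of_nonneg_right (min_le_right _ _) (covNorm_nonneg ζ))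
        _ = r / (4 * (‖η‖ + r)) * covNorm (τ • ζ) := by rw [covNorm_smul, abs_of_pos hτ]; ring
        _ ≤ r / (4 * (‖η‖ + r)) * (2 * (‖η‖ + r)) := by
            gcongr
            exact (covNorm_le_two_mul_norm _).trans (by gcongr)
        _ = r / 2 := by
            have : ‖η‖ + r ≠ 0 := by positivity
            field_simp
            ring
    have h3 : τ • (ζ + y) ∈ V := by
      refine hrV ?_
      rw [mem_ball_iff_norm, smul_add, add_sub_right_comm]
      exact (norm_add_le _ _).trans_lt (by linarith)
    have h4 := hV _ h3 τ⁻¹ (by positivity)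
    rwa [smul_smul, inv_mul_cancel₀ hτ.ne', one_smul] at h4

theorem contDiff_comp_pairing {β : ℝ → ℂ} (hβ : ContDiff ℝ ∞ β) (v p₀ : Sp n d) :
    ContDiff ℝ ∞ fun p => β (pairing v (p - p₀)) :=
  hβ.comp ((contDiff_pairing v).comp (contDiff_id.sub contDiff_const))

/-- Rapid decrease in a direction persists after multiplication by a bump function of one linear
form: the bump function is a superposition of the characters `e_{-2πkv}`, `k ∈ ℤ`, with rapidly
decreasing coefficients. -/
theorem DecaysAt.mul_bump {T : (Sp n d → ℂ) → ℂ} {χ : Sp n d → ℂ} {η : Sp n d}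
    (h : DecaysAt T χ η) (hT : FiniteOrder L T) (hL : IsCompact L) (hχ : SmoothIn L χ)
    {β : ℝ → ℂ} (hβ : ContDiff ℝ ∞ β) (h0 : ∀ s, 1 / 4 < |s| → β s = 0) {v p₀ : Sp n d}
    (hv : ∀ p ∈ L, |pairing v (p - p₀)| ≤ 1 / 2) :
    DecaysAt T (fun p => χ p * β (pairing v (p - p₀))) η := by
  obtain ⟨V, hVc, hVn, hdec⟩ := h
  obtain ⟨V', c, hV'c, hV'n, hc0, hc2, hV'⟩ := exists_conic_shrink hVc hVn
  obtain ⟨a, ha, hsum⟩ := exists_trigonometric_series hβ h0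
  obtain ⟨m, Cm, hCm, hm⟩ := hT.exists_bound_expo_mul hL hχ
  choose D hD0 hD using fun j => exists_bound_iteratedFDeriv_expo_mul hL hχ j
  let y : ℤ → Sp n d := fun k => (-(2 * Real.pi * k)) • v
  have hy : ∀ k, covNorm (y k) = (2 * Real.pi * covNorm v) * |(k : ℝ)| := fun k => by
    simp only [y]
    rw [covNorm_smul, abs_neg, abs_mul, abs_of_pos Real.two_pi_pos]; ring
  let b : ℤ → ℂ := fun k => a k * Complex.exp (-(2 * Real.pi * Complex.I * k * pairing v p₀))
  have hb : ∀ k, ‖b k‖ = ‖a k‖ := fun k => by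
    have : Complex.exp (-(2 * Real.pi * Complex.I * k * pairing v p₀)) =
        Complex.exp ((-(2 * Real.pi * k * pairing v p₀) : ℝ) * Complex.I) := by
      congr 1; push_cast; ring
    simp only [b]
    rw [norm_mul, this, Complex.norm_exp_ofReal_mul_I, mul_one]
  set w : ℝ := 1 + 2 * Real.pi * covNorm v
  have hv0 := covNorm_nonneg v
  have hpi := Real.pi_pos
  have hw : 1 ≤ w := by simp only [w]; nlinarith [mul_nonneg hpi.le hv0]
  have hgrow : ∀ ζ k, 1 + covNorm (ζ + y k) ≤ (1 + covNorm ζ) * w * (1 + |(k : ℝ)|) := by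
    intro ζ k
    have h1 := covNorm_add_le ζ (y k)
    have h2 := covNorm_nonneg ζ
    have h3 := abs_nonneg (k : ℝ)
    have h4 : 0 ≤ 2 * Real.pi * covNorm v := by positivity
    rw [hy] at h1
    have h5 : (1 + covNorm ζ) * w * (1 + |(k : ℝ)|) =
      1 + covNorm ζ + 2 * Real.pi * covNorm v * |(k : ℝ)| +
      (2 * Real.pi * covNorm v + |(k : ℝ)| + covNorm ζ * (2 * Real.pi * covNorm v) +
        covNorm ζ * |(k : ℝ)| + covNorm ζ * (2 * Real.pi * covNorm v) * |(k : ℝ)|) := by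
      simp only [w]; ring
    rw [h5]
    have h6 : 0 ≤ 2 * Real.pi * covNorm v + |(k : ℝ)| + covNorm ζ * (2 * Real.pi * covNorm v) +
        covNorm ζ * |(k : ℝ)| + covNorm ζ * (2 * Real.pi * covNorm v) * |(k : ℝ)| := by positivity
    linarith
  have hseries : ∀ ζ, HasSum (fun k => b k * T fun p => expo (ζ + y k) p * χ p)
      (T fun p => expo ζ p * (χ p * β (pairing v (p - p₀)))) := by
    intro ζ
    have hs := (hT.hasSum (g := fun k p => b k * (expo (ζ + y k) p * χ p))
      (v := fun j k => ‖a k‖ * (1 + |(k : ℝ)|) ^ j * (D j * ((1 + covNorm ζ) * w) ^ j))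
      (fun k => (SmoothIn.mul_left (contDiff_expo _) hχ).const_mul _)
      (fun j => (ha j).mul_right _) fun j k x => ?_).2
    · have e1 : (fun p => expo ζ p * (χ p * β (pairing v (p - p₀)))) =
          fun p => ∑' k, b k * (expo (ζ + y k) p * χ p) := by
        ext p
        by_cases hp : p ∈ L
        · have h1 := ((hsum _ (hv p hp)).mul_left (expo ζ p * χ p)).tsum_eq
          rw [← mul_assoc, ← h1]
          refine tsum_congr fun k => ?_
          rw [expo_add]
          have e2 : a k * Complex.exp (2 * Real.pi * Complex.I * k * (pairing v (p - p₀) : ℝ)) =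
              b k * expo (y k) p := by
            simp only [b, y, expo, pairing_smul]
            have e3 : pairing v (p - p₀) = pairing v p - pairing v p₀ := by
              simp [pairing, inner_sub_right]; ring
            rw [mul_assoc (a k), ← Complex.exp_add, e3]
            congr 2
            push_cast
            ring
          rw [e2]
          ring
        · simp [hχ.zero_off p hp]
      rw [e1]
      simpa only [hT.map_smul _ _ (SmoothIn.mul_left (contDiff_expo _) hχ)] using hs
    · have e4 : (fun p => b k * (expo (ζ + y k) p * χ p)) =
          b k • fun p => expo (ζ + y k) p * χ p := rfl
      rw [e4, iteratedFDeriv_const_smul_apply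
        (((contDiff_expo _).mul hχ.contDiff).contDiffAt.of_le (mod_cast le_top)), norm_smul, hb]
      have h0' := covNorm_nonneg (ζ + y k)
      calc _ ≤ ‖a k‖ * (D j * ((1 + covNorm ζ) * w * (1 + |(k : ℝ)|)) ^ j) := by
            gcongr
            refine (hD j (ζ + y k) x).trans ?_
            have := hD0 j
            gcongr
            exact hgrow ζ k
        _ = _ := by rw [mul_pow _ (1 + |(k : ℝ)|)]; ring
  refine ⟨V', hV'c, hV'n, fun N => ?_⟩
  obtain ⟨CN, hCN⟩ := hdec N
  have hCN0 : 0 ≤ CN := by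
    refine le_trans ?_ (hCN η (mem_of_mem_nhds hVn))
    have := covNorm_nonneg η
    positivity
  -- below, `1 + |ζ| ≤ B (1 + |k|)` unless `|2πkv| ≤ c |ζ|`
  set B : ℝ := 1 + 2 * Real.pi * covNorm v / c
  have hB1 : 1 ≤ B := by
    have : 0 ≤ 2 * Real.pi * covNorm v / c := by positivity
    simp only [B]; linarith
  set C' : ℝ := 2 ^ N * CN + B ^ N * (Cm * (B * w) ^ m)
  have hterm : ∀ ζ ∈ V', ∀ k : ℤ, (1 + covNorm ζ) ^ N * ‖T fun p => expo (ζ + y k) p * χ p‖ ≤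
      C' * (1 + |(k : ℝ)|) ^ (N + 2 * m) := by
    intro ζ hζ k
    have hζ0 := covNorm_nonneg ζ
    have hk0 := abs_nonneg (k : ℝ)
    have hk1 : (1 : ℝ) ≤ (1 + |(k : ℝ)|) ^ (N + 2 * m) := one_le_pow₀ (by linarith)
    -- A small shift stays in the cone of rapid decrease; for a large one, polynomial growth in `ζ`
    -- is polynomial growth in `k`.
    by_cases hcase : covNorm (y k) ≤ c * covNorm ζ
    · have h1 := hCN _ (hV' ζ hζ _ hcase)
      have h2 : 1 + covNorm ζ ≤ 2 * (1 + covNorm (ζ + y k)) := by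
        have h3 := covNorm_add_le (ζ + y k) (-y k)
        have h4 : covNorm (-y k) = covNorm (y k) := by simp [covNorm]
        rw [add_neg_cancel_right, h4] at h3
        nlinarith
      calc _ ≤ (2 * (1 + covNorm (ζ + y k))) ^ N * ‖T fun p => expo (ζ + y k) p * χ p‖ := by gcongr
        _ = 2 ^ N * ((1 + covNorm (ζ + y k)) ^ N * ‖T fun p => expo (ζ + y k) p * χ p‖) := by
            rw [mul_pow]; ring
        _ ≤ 2 ^ N * CN := by gcongr
        _ ≤ C' := by simp only [C']; have : 0 ≤ B ^ N * (Cm * (B * w) ^ m) := by positivity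
                     linarith
        _ ≤ _ := le_mul_of_one_le_right (by positivity) hk1
    · have h1 : 1 + covNorm ζ ≤ B * (1 + |(k : ℝ)|) := by
        rw [hy, not_le, mul_comm, ← lt_div_iff₀ hc0] at hcase
        have h2 : 2 * Real.pi * covNorm v * |(k : ℝ)| / c =
            2 * Real.pi * covNorm v / c * |(k : ℝ)| := by
          ring
        rw [h2] at hcase
        have h3 : 0 ≤ 2 * Real.pi * covNorm v / c := by positivity
        simp only [B]
        nlinarith
      calc _ ≤ (B * (1 + |(k : ℝ)|)) ^ N * (Cm * (1 + covNorm (ζ + y k)) ^ m) := by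
            gcongr
            exact hm _
        _ ≤ (B * (1 + |(k : ℝ)|)) ^ N *
            (Cm * (B * (1 + |(k : ℝ)|) * w * (1 + |(k : ℝ)|)) ^ m) := by
            have := covNorm_nonneg (ζ + y k)
            gcongr
            exact (hgrow ζ k).trans (by gcongr)
        _ = B ^ N * (Cm * (B * w) ^ m) * (1 + |(k : ℝ)|) ^ (N + 2 * m) := by
            rw [show B * (1 + |(k : ℝ)|) * w * (1 + |(k : ℝ)|) = B * w * (1 + |(k : ℝ)|) ^ 2 by ring,
              mul_pow B, mul_pow (B * w), ← pow_mul, pow_add]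
            ring
        _ ≤ _ := by
            gcongr
            simp only [C']
            have : 0 ≤ 2 ^ N * CN := by positivity
            linarith
  refine ⟨∑' k : ℤ, C' * (‖a k‖ * (1 + |(k : ℝ)|) ^ (N + 2 * m)), fun ζ hζ => ?_⟩
  have hζ0 := covNorm_nonneg ζ
  have h1 : ‖T fun p => expo ζ p * (χ p * β (pairing v (p - p₀)))‖ * (1 + covNorm ζ) ^ N ≤
      ∑' k : ℤ, C' * (‖a k‖ * (1 + |(k : ℝ)|) ^ (N + 2 * m)) := by
    have h2 := (hseries ζ).mul_right (((1 + covNorm ζ) ^ N : ℝ) : ℂ)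
    have h3 : ‖T fun p => expo ζ p * (χ p * β (pairing v (p - p₀)))‖ * (1 + covNorm ζ) ^ N =
        ‖(T fun p => expo ζ p * (χ p * β (pairing v (p - p₀)))) *
          (((1 + covNorm ζ) ^ N : ℝ) : ℂ)‖ := by
      rw [norm_mul, Complex.norm_real, Real.norm_of_nonneg (by positivity)]
    rw [h3, ← h2.tsum_eq]
    refine tsum_of_norm_bounded ((ha _).mul_left C').hasSum fun k => ?_
    rw [norm_mul, norm_mul, hb, Complex.norm_real, Real.norm_of_nonneg (by positivity), mul_assoc]
    calc _ = ‖a k‖ * ((1 + covNorm ζ) ^ N * ‖T fun p => expo (ζ + y k) p * χ p‖) := by ring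
      _ ≤ ‖a k‖ * (C' * (1 + |(k : ℝ)|) ^ (N + 2 * m)) :=
          mul_le_mul_of_nonneg_left (hterm ζ hζ k) (norm_nonneg _)
      _ = _ := by ring
  linarith

theorem norm_euclidean_le_sum {k : ℕ} (x : EuclideanSpace ℝ (Fin k)) : ‖x‖ ≤ ∑ i, |x i| := by
  have h1 := (EuclideanSpace.basisFun (Fin k) ℝ).sum_repr x
  calc ‖x‖ = ‖∑ i, x i • EuclideanSpace.basisFun (Fin k) ℝ i‖ := by
        conv_lhs => rw [← h1]
        simp
    _ ≤ ∑ i, ‖x i • EuclideanSpace.basisFun (Fin k) ℝ i‖ := norm_sum_le _ _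
    _ = ∑ i, |x i| := by simp [norm_smul]

/-- The coordinate covectors. -/
def coordCovector : Fin n ⊕ Fin d → Sp n d
  | .inl i => (EuclideanSpace.single i 1, 0)
  | .inr j => (0, EuclideanSpace.single j 1)

theorem covNorm_coordCovector (i : Fin n ⊕ Fin d) : covNorm (coordCovector i) = 1 := by
  cases i <;> simp [coordCovector, covNorm]

theorem abs_pairing_le (ζ p : Sp n d) : |pairing ζ p| ≤ covNorm ζ * ‖p‖ :=
  (pairingCLM ζ).le_of_opNorm_le (norm_pairingCLM_le ζ) p

theorem norm_lt_of_coord_lt {p : Sp n d} {r : ℝ} (hr : 0 < r)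
    (h : ∀ i, |pairing (coordCovector i) p| < r / (n + d + 1)) : ‖p‖ < r := by
  have hr' : 0 < r / (n + d + 1) := by positivity
  have hmul : r / (n + d + 1) * (n + d + 1) = r := div_mul_cancel₀ _ (by positivity)
  have hn : (0 : ℝ) ≤ n := Nat.cast_nonneg n
  have hd : (0 : ℝ) ≤ d := Nat.cast_nonneg d
  have h1 : ‖p.1‖ < r := by
    refine (norm_euclidean_le_sum p.1).trans_lt ?_
    have : ∑ i, |p.1 i| ≤ ∑ _i : Fin n, r / (n + d + 1) := Finset.sum_le_sum fun i _ => by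
      simpa [coordCovector, pairing, EuclideanSpace.inner_single_left] using (h (.inl i)).le
    rw [Finset.sum_const, Finset.card_univ, Fintype.card_fin, nsmul_eq_mul] at this
    nlinarith
  have h2 : ‖p.2‖ < r := by
    refine (norm_euclidean_le_sum p.2).trans_lt ?_
    have : ∑ i, |p.2 i| ≤ ∑ _i : Fin d, r / (n + d + 1) := Finset.sum_le_sum fun i _ => by
      simpa [coordCovector, pairing, EuclideanSpace.inner_single_left] using (h (.inr i)).le
    rw [Finset.sum_const, Finset.card_univ, Fintype.card_fin, nsmul_eq_mul] at this
    nlinarith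
  exact max_lt h1 h2

/-- Rapid decrease in a direction persists after multiplication by suitable bump functions with
support in any given neighbourhood of a point. -/
theorem DecaysAt.localize {T : (Sp n d → ℂ) → ℂ} {χ : Sp n d → ℂ} {η p₀ : Sp n d}
    (h : DecaysAt T χ η) (hT : FiniteOrder L T) (hL : IsCompact L) (hχ : SmoothIn L χ)
    {W : Set (Sp n d)} (hW : W ∈ 𝓝 p₀) :
    ∃ χ' : Sp n d → ℂ, SmoothIn L χ' ∧ (∀ p, p ∉ W → χ' p = 0) ∧ χ' p₀ = χ p₀ ∧
      DecaysAt T χ' η := by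
  classical
  obtain ⟨r, hr, hrW⟩ := Metric.mem_nhds_iff.1 hW
  obtain ⟨R, hR0, hR⟩ : ∃ R, 0 < R ∧ ∀ p ∈ L, ‖p - p₀‖ ≤ R := by
    obtain ⟨R, hR⟩ := hL.exists_bound_of_continuousOn
      (f := fun p => p - p₀) (continuous_id.sub continuous_const).continuousOn
    exact ⟨max R 1, by positivity, fun p hp => (hR p hp).trans (le_max_left _ _)⟩
  set δ : ℝ := 1 / (2 * R)
  have hδ : 0 < δ := by positivity
  set ρ : ℝ := min (1 / 4) (δ * (r / (n + d + 1)))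
  have hρ : 0 < ρ := by positivity
  let f : ContDiffBump (0 : ℝ) := ⟨ρ / 2, ρ, half_pos hρ, half_lt_self hρ⟩
  let β : ℝ → ℂ := fun s => (f s : ℂ)
  have hβ : ContDiff ℝ ∞ β := Complex.ofRealCLM.contDiff.comp f.contDiff
  have hβ0 : ∀ s, ρ ≤ |s| → β s = 0 := fun s hs => by
    simp only [β]
    rw [f.zero_of_le_dist (by simpa [f] using hs), Complex.ofReal_zero]
  have hβ1 : β 0 = 1 := by
    simp only [β]
    rw [f.one_of_mem_closedBall (by simpa [f] using (half_pos hρ).le), Complex.ofReal_one]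
  let v : Fin n ⊕ Fin d → Sp n d := fun i => δ • coordCovector i
  have hv : ∀ i, ∀ p ∈ L, |pairing (v i) (p - p₀)| ≤ 1 / 2 := by
    intro i p hp
    have h1 := abs_pairing_le (coordCovector i) (p - p₀)
    rw [covNorm_coordCovector, one_mul] at h1
    simp only [v]
    rw [pairing_smul, abs_mul, abs_of_pos hδ]
    calc δ * _ ≤ δ * R := by gcongr; exact h1.trans (hR p hp)
      _ = 1 / 2 := by simp only [δ]; field_simp
  have key : ∀ S : Finset (Fin n ⊕ Fin d),
      SmoothIn L (fun p => χ p * ∏ i ∈ S, β (pairing (v i) (p - p₀))) ∧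
      DecaysAt T (fun p => χ p * ∏ i ∈ S, β (pairing (v i) (p - p₀))) η := by
    intro S
    induction S using Finset.induction_on with
    | empty => simpa using ⟨hχ, h⟩
    | insert a S ha ih =>
      have e : (fun p => χ p * ∏ i ∈ insert a S, β (pairing (v i) (p - p₀))) =
          fun p => (χ p * ∏ i ∈ S, β (pairing (v i) (p - p₀))) * β (pairing (v a) (p - p₀)) := by
        ext p
        rw [Finset.prod_insert ha]
        ring
      rw [e]
      exact ⟨ih.1.mul_right (contDiff_comp_pairing hβ _ _), ih.2.mul_bump hT hL ih.1 hβ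
        (fun s hs => hβ0 s ((min_le_left _ _).trans hs.le)) (hv a)⟩
  refine ⟨_, (key Finset.univ).1, fun p hp => ?_, ?_, (key Finset.univ).2⟩
  · have h1 : ¬ ∀ i, |pairing (coordCovector i) (p - p₀)| < r / (n + d + 1) := fun hall =>
      hp (hrW (mem_ball_iff_norm.2 (norm_lt_of_coord_lt hr hall)))
    push Not at h1
    obtain ⟨i, hi⟩ := h1
    rw [Finset.prod_eq_zero (Finset.mem_univ i), mul_zero]
    refine hβ0 _ ((min_le_right _ _).trans ?_)
    simp only [v]
    rw [pairing_smul, abs_mul, abs_of_pos hδ]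
    gcongr
  · have : ∀ i, β (pairing (v i) (p₀ - p₀)) = 1 := fun i => by
      rw [show pairing (v i) (p₀ - p₀) = 0 by simp [pairing]]
      exact hβ1
    simp only [this, Finset.prod_const_one, mul_one]

end Localization

/-! ### Wave front sets of scaled distributions, and soft landing -/

section Scaling

variable {n d : ℕ}

theorem mem_WF_iff {U : Opens (Sp n d)} {t : CDistribution U} {q : Phase n d} :
    q ∈ WF t ↔ q.1 ∈ U ∧ q.2 ≠ 0 ∧ ∀ χ : 𝓓(U, ℂ), χ q.1 ≠ 0 → ¬ DecaysAt t.eval χ q.2 := by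
  simp only [WF, Set.mem_ofPred_eq, DecaysAt, ← localFourier_eq_eval]
  refine and_congr_right fun _ => and_congr_right fun _ => ?_
  push Not
  exact ⟨fun h χ hχ V h1 h2 => h χ V hχ h1 h2, fun h χ V hχ h1 h2 => h χ hχ V h1 h2⟩

/-- Wave front sets of scaled distributions: if `(x, h; k, ξ)` belongs to the wave front set of
`t_λ` then `(x, λh; k, λ⁻¹ξ)` belongs to that of `t`. A test function at `(x, λh)` has to be
localized before it can be pulled back, since `U` need not be invariant under `h ↦ λ⁻¹h`. -/
theorem mem_WF_of_mem_WF_scale {U : Opens (Sp n d)} (hU : RhoConvex U) (l : Ioc (0 : ℝ) 1)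
    {t : CDistribution U} {q : Phase n d} (hq : q ∈ WF (scale hU l t)) :
    (dilation (l : ℝ) q.1, dilation (l : ℝ)⁻¹ q.2) ∈ WF t := by
  have hl := l.2.1.ne'
  rw [mem_WF_iff] at hq ⊢
  have hinj : ∀ {a : ℝ}, a ≠ 0 → ∀ ζ : Sp n d, dilation a⁻¹ (dilation a ζ) = ζ := fun ha ζ => by
    rw [dilation_dilation, inv_mul_cancel₀ ha, dilation_one]
  have hinj' : ∀ ζ : Sp n d, dilation (l : ℝ) (dilation (l : ℝ)⁻¹ ζ) = ζ := fun ζ => by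
    rw [dilation_dilation, mul_inv_cancel₀ hl, dilation_one]
  refine ⟨hU _ hq.1 l, fun h => hq.2.1 ?_, fun χ hχ hdec => ?_⟩
  · have h' : dilation (l : ℝ)⁻¹ q.2 = 0 := h
    rw [← hinj' q.2, h', map_zero]
  let W : Set (Sp n d) := dilation (l : ℝ)⁻¹ ⁻¹' U
  have hW : W ∈ 𝓝 (dilation (l : ℝ) q.1) :=
    (U.isOpen.preimage (dilation (l : ℝ)⁻¹).continuous).mem_nhds
      (by rw [mem_preimage, hinj hl]; exact hq.1)
  obtain ⟨W', hW', hW'c, hW'W⟩ := exists_mem_nhds_isClosed_subset hW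
  have hLc : IsCompact (tsupport χ) := χ.hasCompactSupport
  obtain ⟨χ', hχ's, hχ'0, hχ'1, V, hVc, hVn, hVd⟩ := hdec.localize
    (FiniteOrder.eval t hLc χ.tsupport_subset) hLc (smoothIn_testFunction χ) hW'
  have hs' : SmoothIn (tsupport χ ∩ W') χ' := ⟨hχ's.contDiff, fun p hp => by
    by_cases h1 : p ∈ W'
    · exact hχ's.zero_off p fun h2 => hp ⟨h2, h1⟩
    · exact hχ'0 p h1⟩
  have hK' : IsCompact (tsupport χ ∩ W') := hLc.inter_right hW'c
  have hK : IsCompact (dilation (l : ℝ)⁻¹ '' (tsupport χ ∩ W')) :=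
    hK'.image (dilation (l : ℝ)⁻¹).continuous
  have hKU : dilation (l : ℝ)⁻¹ '' (tsupport χ ∩ W') ⊆ U := by
    rintro _ ⟨p, hp, rfl⟩
    exact hW'W hp.2
  have hs : SmoothIn (dilation (l : ℝ)⁻¹ '' (tsupport χ ∩ W'))
      fun p => χ' (dilation (l : ℝ) p) := by
    simpa using hs'.comp_dilation_inv (inv_ne_zero hl)
  refine hq.2.2 (hs.toTest hK hKU) (by rw [← hχ'1] at hχ; exact hχ)
    ⟨dilation (l : ℝ)⁻¹ ⁻¹' V, fun ζ hζ c hc => ?_, ?_, fun N => ?_⟩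
  · simpa only [mem_preimage, map_smul] using hVc _ hζ c hc
  · exact (dilation (l : ℝ)⁻¹).continuous.continuousAt hVn
  · obtain ⟨C, hC⟩ := hVd N
    refine ⟨((l : ℝ) ^ d)⁻¹ * C, fun ζ hζ => ?_⟩
    have h1 := hC _ hζ
    have e : (scale hU l t).eval (fun p => expo ζ p * (hs.toTest hK hKU) p) =
        (((l : ℝ) ^ d)⁻¹ : ℂ) * t.eval fun p => expo (dilation (l : ℝ)⁻¹ ζ) p * χ' p := by
      have e1 := eval_scale hU t l (g := fun p => expo ζ p * χ' (dilation (l : ℝ) p))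
        (.mul_left (contDiff_expo ζ) hs) hK hKU
      simp only [hinj', expo_dilation] at e1
      exact e1
    rw [e, norm_mul]
    have h2 : ‖(((l : ℝ) ^ d)⁻¹ : ℂ)‖ = ((l : ℝ) ^ d)⁻¹ := by
      rw [← Complex.ofReal_pow, ← Complex.ofReal_inv, Complex.norm_real,
        Real.norm_of_nonneg (inv_nonneg.2 (pow_nonneg l.2.1.le _))]
    have h3 : covNorm ζ ≤ covNorm (dilation (l : ℝ)⁻¹ ζ) := by
      simp only [covNorm, dilation_apply, norm_smul, norm_inv, Real.norm_of_nonneg l.2.1.le]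
      have : ‖ζ.2‖ ≤ (l : ℝ)⁻¹ * ‖ζ.2‖ :=
        le_mul_of_one_le_left (norm_nonneg _) ((one_le_inv₀ l.2.1).2 l.2.2)
      linarith
    rw [h2, mul_left_comm]
    refine mul_le_mul_of_nonneg_left (le_trans ?_ h1) (inv_nonneg.2 (pow_nonneg l.2.1.le _))
    have := covNorm_nonneg ζ
    gcongr

/-- An element of `⋃_λ WF(t_λ)` comes from an element of `WF(t)`. -/
theorem exists_mem_WF_of_mem_scaledWF {U : Opens (Sp n d)} (hU : RhoConvex U)
    {t : CDistribution U} {q : Phase n d} (hq : q ∈ scaledWF hU t) :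
    ∃ l : Ioc (0 : ℝ) 1, (dilation (l : ℝ) q.1, dilation (l : ℝ)⁻¹ q.2) ∈ WF t := by
  obtain ⟨l, hl⟩ := mem_iUnion.1 hq
  exact ⟨l, mem_WF_of_mem_WF_scale hU l hl⟩

/-- The soft landing estimate is invariant under scaling, hence it passes from `WF(t)` to
`⋃_λ WF(t_λ)`. -/
theorem scaledWF_softLanding {U : Opens (Sp n d)} (hU : RhoConvex U) {t : CDistribution U}
    {A : Set (EuclideanSpace ℝ (Fin n))} {r δ : ℝ}
    (h : ∀ q ∈ WF t, q.1.1 ∈ A → ‖q.1.2‖ ≤ r → ‖q.2.1‖ ≤ δ * ‖q.1.2‖ * ‖q.2.2‖)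
    {q : Phase n d} (hq : q ∈ scaledWF hU t) (hA : q.1.1 ∈ A) (hr : ‖q.1.2‖ ≤ r) :
    ‖q.2.1‖ ≤ δ * ‖q.1.2‖ * ‖q.2.2‖ := by
  obtain ⟨l, hl⟩ := exists_mem_WF_of_mem_scaledWF hU hq
  have h1 := h _ hl hA (by
    simp only [dilation_apply, norm_smul, Real.norm_of_nonneg l.2.1.le]
    exact (mul_le_of_le_one_left (norm_nonneg _) l.2.2).trans hr)
  simp only [dilation_apply, norm_smul, Real.norm_of_nonneg l.2.1.le, norm_inv] at h1
  have : δ * ((l : ℝ) * ‖q.1.2‖) * ((l : ℝ)⁻¹ * ‖q.2.2‖) = δ * ‖q.1.2‖ * ‖q.2.2‖ := by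
    have := l.2.1.ne'
    field_simp
  rwa [this] at h1

/-- The soft landing condition is uniform over compact subsets of `Ω`. -/
theorem SoftLanding.exists_uniform {Ω : Opens (EuclideanSpace ℝ (Fin n))} {Γ : Set (Phase n d)}
    (h : SoftLanding Ω Γ) {K : Set (EuclideanSpace ℝ (Fin n))} (hK : IsCompact K)
    (hKΩ : K ⊆ Ω) : ∃ r > 0, ∃ δ > 0, ∀ q ∈ Γ, q.1.1 ∈ K → ‖q.1.2‖ ≤ r →
      ‖q.2.1‖ ≤ δ * ‖q.1.2‖ * ‖q.2.2‖ := by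
  refine hK.induction_on (p := fun A => ∃ r > 0, ∃ δ > 0, ∀ q ∈ Γ, q.1.1 ∈ A → ‖q.1.2‖ ≤ r →
      ‖q.2.1‖ ≤ δ * ‖q.1.2‖ * ‖q.2.2‖) ⟨1, one_pos, 1, one_pos, by simp⟩ ?_ ?_ ?_
  · rintro A B hAB ⟨r, hr, δ, hδ, h⟩
    exact ⟨r, hr, δ, hδ, fun q hq hA => h q hq (hAB hA)⟩
  · rintro A B ⟨r, hr, δ, hδ, h⟩ ⟨r', hr', δ', hδ', h'⟩
    refine ⟨min r r', lt_min hr hr', max δ δ', lt_max_of_lt_left hδ, fun q hq hA hq' => ?_⟩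
    rcases hA with hA | hA
    · refine (h q hq hA (hq'.trans (min_le_left _ _))).trans ?_
      gcongr
      exact le_max_left _ _
    · refine (h' q hq hA (hq'.trans (min_le_right _ _))).trans ?_
      gcongr
      exact le_max_right _ _
  · intro x hx
    obtain ⟨U, hU, ε, hε, δ, hδ, h1⟩ := h x (hKΩ hx)
    obtain ⟨r, hr, hrU⟩ := Metric.mem_nhds_iff.1 hU
    refine ⟨Metric.ball x r, mem_nhdsWithin_of_mem_nhds (Metric.ball_mem_nhds x hr),
      min ε (r / 2), by positivity, δ, hδ, fun q hq hA hq' => ?_⟩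
    refine h1 q hq (hrU ?_) (hq'.trans (min_le_left _ _))
    have h2 : ‖q.1.2‖ < r := by
      have := hq'.trans (min_le_right _ _)
      linarith
    rw [Metric.mem_ball, Prod.dist_eq]
    exact max_lt hA (by simpa using h2)

end Scaling

/-! ### Cutoffs, and the distribution between two scales -/

section LocalCutoff

variable {n d : ℕ} {S : Set (Sp n d)} {a : ℝ} {κ : EuclideanSpace ℝ (Fin n) → ℂ} {θ : Sp n d → ℂ}

/-- The part of `S` at distance at least `r` from `{h = 0}`. -/
def shell (r : ℝ) (S : Set (Sp n d)) : Set (Sp n d) := {p | p ∈ S ∧ r ≤ ‖p.2‖}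

theorem isCompact_shell (hS : IsCompact S) (r : ℝ) : IsCompact (shell r S) :=
  hS.inter_right (isClosed_le continuous_const continuous_snd.norm)

theorem shell_subset_puncture {U : Opens (Sp n d)} (hS : S ⊆ U) {r : ℝ} (hr : 0 < r) :
    shell r S ⊆ puncture U :=
  fun _ hp => ⟨hS hp.1, norm_pos_iff.1 (hr.trans_le hp.2)⟩

theorem shell_mono {r r' : ℝ} (h : r ≤ r') : shell r' S ⊆ shell r S :=
  fun _ hp => ⟨hp.1, h.trans hp.2⟩

/-- A cutoff function for `{h = 0}`, localized in `x`: `θ` is smooth, it equals `κ(x)` for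
`|h| ≤ a`, and it vanishes off the compact set `S`, which is star-shaped in `h`. -/
structure LocalCutoff (S : Set (Sp n d)) (a : ℝ) (κ : EuclideanSpace ℝ (Fin n) → ℂ)
    (θ : Sp n d → ℂ) : Prop where
  contDiff : ContDiff ℝ ∞ θ
  pos : 0 < a
  isCompact : IsCompact S
  star : ∀ p ∈ S, ∀ c ∈ Icc (0 : ℝ) 1, dilation c p ∈ S
  inner : ∀ p, ‖p.2‖ ≤ a → θ p = κ p.1
  off : ∀ p ∉ S, θ p = 0

theorem LocalCutoff.smoothIn_sub (hθ : LocalCutoff S a κ θ) {r : ℝ} (hr : 1 ≤ r) :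
    SmoothIn (shell (a / r) S) fun p => θ p - θ (dilation r p) := by
  have hr0 : 0 < r := one_pos.trans_le hr
  refine ⟨hθ.contDiff.sub (hθ.contDiff.comp (dilation r).contDiff), fun p hp => ?_⟩
  by_cases hpS : p ∈ S
  · have h1 : ‖p.2‖ < a / r := not_le.1 fun h => hp ⟨hpS, h⟩
    rw [lt_div_iff₀ hr0] at h1
    rw [hθ.inner p (by nlinarith [norm_nonneg p.2]), hθ.inner]
    · exact sub_self _
    · rw [dilation_apply, norm_smul, Real.norm_of_nonneg hr0.le, mul_comm]
      exact h1.le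
  · rw [hθ.off p hpS, hθ.off, sub_self]
    intro h
    refine hpS ?_
    have := hθ.star _ h r⁻¹ ⟨inv_nonneg.2 hr0.le, inv_le_one_of_one_le₀ hr⟩
    rwa [dilation_dilation, inv_mul_cancel₀ hr0.ne', dilation_one] at this

theorem LocalCutoff.smoothIn_sub_inv (hθ : LocalCutoff S a κ θ) {ε : ℝ} (hε : ε ∈ Ioc (0 : ℝ) 1) :
    SmoothIn (shell (a * ε) S) fun p => θ p - θ (dilation ε⁻¹ p) := by
  simpa using hθ.smoothIn_sub ((one_le_inv₀ hε.1).2 hε.2)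

/-- The value `⟨u (θ - θ_{ε⁻¹}), ψ⟩`. -/
def shellEval {U : Opens (Sp n d)} (u : CDistribution U) (θ ψ : Sp n d → ℂ) (ε : ℝ) : ℂ :=
  u.eval fun p => (θ p - θ (dilation ε⁻¹ p)) * ψ p

theorem shellEval_one {U : Opens (Sp n d)} (u : CDistribution U) (θ ψ : Sp n d → ℂ) :
    shellEval u θ ψ 1 = 0 := by
  have := (FiniteOrder.eval u isCompact_empty (empty_subset _)).map_zero
  simpa [shellEval] using this

variable {U : Opens (Sp n d)} (hU : RhoConvex U) (s : ℝ) (t : CDistribution (puncture U))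

/-- The contribution of the shell `|h| ∼ λ` is, by scaling, the contribution of the shell `|h| ∼ 1`
to a rescaled distribution. -/
theorem shellEval_div_sub (hθ : LocalCutoff S a κ θ) (hS : S ⊆ U) (m l : Ioc (0 : ℝ) 1) {r : ℝ}
    (hr : r ∈ Icc (1 : ℝ) 2) {ψ : Sp n d → ℂ} (hψ : ContDiff ℝ ∞ ψ) :
    shellEval (scaled hU.puncture s t m) θ ψ (l / r) -
        shellEval (scaled hU.puncture s t m) θ ψ l =
      (((l : ℝ) ^ (s + d) : ℝ) : ℂ) * (scaled hU.puncture s t (scaleMul m l)).eval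
        fun p => (θ p - θ (dilation r p)) * ψ (dilation (l : ℝ) p) := by
  have hl := l.2.1
  have hr0 : 0 < r := one_pos.trans_le hr.1
  have hlr : (l : ℝ) / r ∈ Ioc (0 : ℝ) 1 :=
    ⟨by positivity, (div_le_self hl.le hr.1).trans l.2.2⟩
  have ha := hθ.pos
  have hpos : 0 < a * (l / r) := mul_pos ha hlr.1
  have hf := ((hθ.smoothIn_sub_inv hlr).mul_right hψ)
  have hg := ((hθ.smoothIn_sub_inv l.2).mul_right hψ).mono
    (shell_mono (S := S) (mul_le_mul_of_nonneg_left (div_le_self hl.le hr.1) ha.le))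
  have hL := isCompact_shell hθ.isCompact (a * (l / r))
  have hLU := shell_subset_puncture hS hpos
  have hs : SmoothIn (shell (a / r) S)
      fun p => (θ p - θ (dilation r p)) * ψ (dilation (l : ℝ) p) :=
    (hθ.smoothIn_sub hr.1).mul_right (hψ.comp (dilation (l : ℝ)).contDiff)
  rw [shellEval, shellEval, ← (FiniteOrder.eval _ hL hLU).map_sub hf hg,
    ← eval_scaled_comp_dilation hU.puncture s t m l hs
      (isCompact_shell hθ.isCompact _) (shell_subset_puncture hS (by positivity))]
  congr 1
  ext p
  rw [ dilation_dilation, dilation_dilation, mul_inv_cancel₀ hl.ne', dilation_one,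
    inv_div, div_eq_mul_inv]
  ring

/-- The Taylor remainder of order `M` in the variable `h`. -/
def taylorRemainder (M : ℕ) (φ : Sp n d → ℂ) (p : Sp n d) : ℂ := φ p - taylorPoly M φ p

theorem contDiff_taylorRemainder {φ : Sp n d → ℂ} (hφ : ContDiff ℝ ∞ φ) (M : ℕ) :
    ContDiff ℝ ∞ (taylorRemainder M φ) := hφ.sub (contDiff_taylorPoly hφ M)

/-- For each `g` supported in `L`, the family `λ^{-s} t_λ` is bounded, with weight `w(ζ)`, on the
functions `e_{(k, lξ)} g` with `ζ = (k, ξ)` in `Z` and `l` in `Λ`. -/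
def ScaledBound (L : Set (Sp n d)) (Λ : Set ℝ) (Z : Set (Sp n d)) (w : Sp n d → ℝ) : Prop :=
  ∀ g, SmoothIn L g → ∃ C, ∀ m : Ioc (0 : ℝ) 1, ∀ ζ ∈ Z, ∀ l ∈ Λ,
    w ζ * ‖(scaled hU.puncture s t m).eval fun p => expo (dilation l ζ) p * g p‖ ≤ C

variable {Z : Set (Sp n d)} {w : Sp n d → ℝ} {hU s t}

theorem exists_shellEval_taylorRemainder_le (hθ : LocalCutoff S a κ θ) (hS : S ⊆ U)
    (hw : ∀ ζ, 0 ≤ w ζ) (hH : ScaledBound hU s t (shell (a / 2) S) (Icc 0 1) Z w)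
    {φ : Sp n d → ℂ} (hφ : ContDiff ℝ ∞ φ) (M : ℕ) :
    ∃ C, 0 ≤ C ∧ ∀ m : Ioc (0 : ℝ) 1, ∀ ζ ∈ Z, ∀ l ∈ Ioc (0 : ℝ) 1, ∀ r ∈ Icc (1 : ℝ) 2,
      ‖w ζ * shellEval (scaled hU.puncture s t m) θ
            (taylorRemainder M fun p => expo ζ p * φ p) (l / r) -
          w ζ * shellEval (scaled hU.puncture s t m) θ
            (taylorRemainder M fun p => expo ζ p * φ p) l‖ ≤
        C * (1 + ‖ζ.2‖) ^ M * l ^ (s + d + M) := by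
  have ha := hθ.pos
  have hL := isCompact_shell hθ.isCompact (a / 2)
  have hLU := shell_subset_puncture (U := U) hS (half_pos ha)
  have hm0 : ∀ r ∈ Icc (1 : ℝ) 2, ∀ p ∉ shell (a / 2) S, θ p - θ (dilation r p) = 0 :=
    fun r hr p hp => (hθ.smoothIn_sub hr.1).zero_off p fun h => hp (shell_mono
      (div_le_div_of_nonneg_left ha.le (one_pos.trans_le hr.1) hr.2) h)
  obtain ⟨C, hC, hb⟩ := exists_bound_remainder hL
    (T := fun (i : Ioc (0 : ℝ) 1 × Z) g => (w i.2 : ℂ) * (scaled hU.puncture s t i.1).eval g)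
    (fun i => (FiniteOrder.eval _ hL hLU).const_mul _) (fun i => (i.2 : Sp n d))
    (fun g hg => (hH g hg).imp fun C hC i l hl => by
      rw [norm_mul, Complex.norm_real, Real.norm_of_nonneg (hw _)]
      exact hC i.1 i.2 i.2.2 l hl)
    (m := fun z : Sp n d × ℝ => θ z.1 - θ (dilation z.2 z.1))
    ((hθ.contDiff.comp contDiff_fst).sub (hθ.contDiff.comp contDiff_dilation_uncurry))
    isCompact_Icc hm0 hφ M
  refine ⟨C, hC, fun m ζ hζ l hl r hr => ?_⟩
  have h1 := hb (scaleMul m ⟨l, hl⟩, ⟨ζ, hζ⟩) r hr l ⟨hl.1.le, hl.2⟩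
  have h2 := shellEval_div_sub hU s t hθ hS m ⟨l, hl⟩ hr
    (contDiff_taylorRemainder ((contDiff_expo ζ).mul hφ) M)
  rw [← mul_sub]
  change ‖(w ζ : ℂ) * (shellEval _ θ _ ((⟨l, hl⟩ : Ioc (0 : ℝ) 1) / r) -
    shellEval _ θ _ (⟨l, hl⟩ : Ioc (0 : ℝ) 1))‖ ≤ _
  rw [h2, mul_left_comm, norm_mul, Complex.norm_real,
    Real.norm_of_nonneg (Real.rpow_nonneg hl.1.le _), Real.rpow_add_natCast hl.1.ne' (s + d) M]
  calc l ^ (s + d) * _ ≤ l ^ (s + d) * (C * (1 + ‖ζ.2‖) ^ M * l ^ M) :=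
        mul_le_mul_of_nonneg_left h1 (Real.rpow_nonneg hl.1.le _)
    _ = _ := by ring

theorem exists_shellEval_normalDeriv_sub_le (hθ : LocalCutoff S a κ θ) (hS : S ⊆ U)
    (hw : ∀ ζ, 0 ≤ w ζ) (hH : ScaledBound hU s t (shell (a / 2) S) {0} Z w)
    {φ : Sp n d → ℂ} (hφ : ContDiff ℝ ∞ φ) (j : ℕ) :
    ∃ C, 0 ≤ C ∧ ∀ m : Ioc (0 : ℝ) 1, ∀ ζ ∈ Z, ∀ l ∈ Ioc (0 : ℝ) 1, ∀ r ∈ Icc (1 : ℝ) 2,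
      ‖w ζ * shellEval (scaled hU.puncture s t m) θ
            (normalDeriv (fun p => expo ζ p * φ p) j) (l / r) -
          w ζ * shellEval (scaled hU.puncture s t m) θ
            (normalDeriv (fun p => expo ζ p * φ p) j) l‖ ≤
        C * (1 + ‖ζ.2‖) ^ j * l ^ (s + d + j) := by
  have ha := hθ.pos
  have hL := isCompact_shell hθ.isCompact (a / 2)
  have hLU := shell_subset_puncture (U := U) hS (half_pos ha)
  have hm0 : ∀ r ∈ Icc (1 : ℝ) 2, ∀ p ∉ shell (a / 2) S, θ p - θ (dilation r p) = 0 :=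
    fun r hr p hp => (hθ.smoothIn_sub hr.1).zero_off p fun h => hp (shell_mono
      (div_le_div_of_nonneg_left ha.le (one_pos.trans_le hr.1) hr.2) h)
  obtain ⟨C, hC, hb⟩ := exists_bound_radialDeriv hL
    (T := fun (i : Ioc (0 : ℝ) 1 × Z) g => (w i.2 : ℂ) * (scaled hU.puncture s t i.1).eval g)
    (fun i => (FiniteOrder.eval _ hL hLU).const_mul _) (fun i => (i.2 : Sp n d))
    (Λ := {0}) (by simp)
    (fun g hg => (hH g hg).imp fun C hC i l hl => by
      rw [norm_mul, Complex.norm_real, Real.norm_of_nonneg (hw _)]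
      exact hC i.1 i.2 i.2.2 l hl)
    (m := fun z : Sp n d × ℝ => θ z.1 - θ (dilation z.2 z.1))
    ((hθ.contDiff.comp contDiff_fst).sub (hθ.contDiff.comp contDiff_dilation_uncurry))
    isCompact_Icc hm0 hφ j
  refine ⟨C, hC, fun m ζ hζ l hl r hr => ?_⟩
  have hψ : ContDiff ℝ ∞ fun p => expo ζ p * φ p := (contDiff_expo ζ).mul hφ
  have h1 := hb (scaleMul m ⟨l, hl⟩, ⟨ζ, hζ⟩) r hr 0 rfl
  have h2 := shellEval_div_sub hU s t hθ hS m ⟨l, hl⟩ hr (contDiff_normalDeriv hψ j)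
  simp only [← normalDeriv_eq_radialDeriv hψ] at h1
  rw [← mul_sub]
  change ‖(w ζ : ℂ) * (shellEval _ θ _ ((⟨l, hl⟩ : Ioc (0 : ℝ) 1) / r) -
    shellEval _ θ _ (⟨l, hl⟩ : Ioc (0 : ℝ) 1))‖ ≤ _
  have h3 := (FiniteOrder.eval (scaled hU.puncture s t (scaleMul m ⟨l, hl⟩)) hL hLU).map_smul
    ((l : ℂ) ^ j) (fun p => (θ p - θ (dilation r p)) * normalDeriv (fun p => expo ζ p * φ p) j p)
    ⟨((hθ.smoothIn_sub hr.1).mul_right (contDiff_normalDeriv hψ j)).contDiff,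
      fun p hp => by rw [hm0 r hr p hp, zero_mul]⟩
  simp only [normalDeriv_dilation, mul_left_comm (θ _ - θ _)] at h2
  rw [h2, h3, ← mul_assoc (((l ^ (s + d) : ℝ) : ℂ)), mul_left_comm, norm_mul, norm_mul,
    norm_pow, Complex.norm_real, Complex.norm_real, Real.norm_of_nonneg hl.1.le,
    Real.norm_of_nonneg (Real.rpow_nonneg hl.1.le _), ← Real.rpow_add_natCast hl.1.ne' (s + d) j]
  calc l ^ (s + d + j) * _ ≤ l ^ (s + d + j) * (C * (1 + ‖ζ.2‖) ^ j) :=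
        mul_le_mul_of_nonneg_left h1 (Real.rpow_nonneg hl.1.le _)
    _ = _ := by ring

/-- The sum over small scales of the Taylor remainders converges and is bounded. -/
theorem exists_tendsto_shellEval (hθ : LocalCutoff S a κ θ) (hS : S ⊆ U)
    (hw : ∀ ζ, 0 < w ζ) (hH : ScaledBound hU s t (shell (a / 2) S) (Icc 0 1) Z w)
    {φ : Sp n d → ℂ} (hφ : ContDiff ℝ ∞ φ) {M : ℕ} (hM : 0 < s + d + M) :
    ∃ C, 0 ≤ C ∧ ∀ m : Ioc (0 : ℝ) 1, ∀ ζ ∈ Z, ∃ y,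
      Tendsto (shellEval (scaled hU.puncture s t m) θ
        (taylorRemainder M fun p => expo ζ p * φ p)) (𝓝[>] 0) (𝓝 y) ∧
      w ζ * ‖y‖ ≤ C * (1 + ‖ζ.2‖) ^ M := by
  obtain ⟨C, hC, hb⟩ := exists_shellEval_taylorRemainder_le hθ hS (fun ζ => (hw ζ).le) hH hφ M
  have h2 : (2 : ℝ) ^ (-(s + d + M)) < 1 :=
    Real.rpow_lt_one_of_one_lt_of_neg one_lt_two (by linarith)
  refine ⟨C * (1 - (2 : ℝ) ^ (-(s + d + M)))⁻¹, mul_nonneg hC (inv_nonneg.2 (by linarith)),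
    fun m ζ hζ => ?_⟩
  have hwζ : (w ζ : ℂ) ≠ 0 := Complex.ofReal_ne_zero.2 (hw ζ).ne'
  set F := shellEval (scaled hU.puncture s t m) θ (taylorRemainder M fun p => expo ζ p * φ p)
    with hF
  obtain ⟨y, hy⟩ := exists_tendsto_of_dyadic (F := fun ε => (w ζ : ℂ) * F ε) hM (hb m ζ hζ)
  refine ⟨(w ζ : ℂ)⁻¹ * y, ?_, ?_⟩
  · have := hy.const_mul (w ζ : ℂ)⁻¹
    simpa only [inv_mul_cancel_left₀ hwζ] using this
  · have h1 := norm_limit_sub_le_of_dyadic (F := fun ε => (w ζ : ℂ) * F ε) hM (hb m ζ hζ) hy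
    rw [hF, shellEval_one, mul_zero, sub_zero] at h1
    rw [norm_mul, norm_inv, Complex.norm_real, Real.norm_of_nonneg (hw ζ).le,
      mul_inv_cancel_left₀ (hw ζ).ne']
    linarith

/-- The counterterms diverge at most like `λ^{s+d+j}`. -/
theorem exists_shellEval_normalDeriv_le (hθ : LocalCutoff S a κ θ) (hS : S ⊆ U)
    (hw : ∀ ζ, 0 ≤ w ζ) (hH : ScaledBound hU s t (shell (a / 2) S) {0} Z w)
    {φ : Sp n d → ℂ} (hφ : ContDiff ℝ ∞ φ) {j : ℕ} (hj : s + d + j < 0) :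
    ∃ C, 0 ≤ C ∧ ∀ ζ ∈ Z, ∀ l ∈ Ioc (0 : ℝ) 1,
      w ζ * ‖shellEval t θ (normalDeriv (fun p => expo ζ p * φ p) j) l‖ ≤
        C * (1 + ‖ζ.2‖) ^ j * l ^ (s + d + j) := by
  obtain ⟨C, hC, hb⟩ := exists_shellEval_normalDeriv_sub_le hθ hS hw hH hφ j
  have h2 : (2 : ℝ) ^ (s + d + j) < 1 := Real.rpow_lt_one_of_one_lt_of_neg one_lt_two hj
  refine ⟨C * (1 - (2 : ℝ) ^ (s + d + j))⁻¹, mul_nonneg hC (inv_nonneg.2 (by linarith)),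
    fun ζ hζ l hl => ?_⟩
  have h1 := norm_sub_one_le_of_dyadic
    (F := fun ε => (w ζ : ℂ) * shellEval (scaled hU.puncture s t ⟨1, one_pos, le_rfl⟩) θ
      (normalDeriv (fun p => expo ζ p * φ p) j) ε) hj (hb ⟨1, one_pos, le_rfl⟩ ζ hζ) hl
  have hψ : ContDiff ℝ ∞ fun p => expo ζ p * φ p := (contDiff_expo ζ).mul hφ
  have h3 : shellEval (scaled hU.puncture s t ⟨1, one_pos, le_rfl⟩) θ
      (normalDeriv (fun p => expo ζ p * φ p) j) l =
      shellEval t θ (normalDeriv (fun p => expo ζ p * φ p) j) l := by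
    rw [shellEval, eval_scaled hU.puncture s t _ ((hθ.smoothIn_sub_inv hl).mul_right
      (contDiff_normalDeriv hψ j)) (isCompact_shell hθ.isCompact _)
      (shell_subset_puncture hS (mul_pos hθ.pos hl.1))]
    simp [shellEval]
  rw [shellEval_one, mul_zero, sub_zero, h3, norm_mul, Complex.norm_real,
    Real.norm_of_nonneg (hw ζ)] at h1
  calc _ ≤ _ := h1
    _ = _ := by ring

end LocalCutoff

/-! ### The regularized functionals and their limit -/

section Regularized

variable {n d : ℕ} {S S' : Set (Sp n d)} {a a' : ℝ} {κ κ' : EuclideanSpace ℝ (Fin n) → ℂ}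
  {θ χ : Sp n d → ℂ} {U : Opens (Sp n d)}

/-- The functional whose limit for `ε → 0` is the extension:
`⟨t (1 - χ_{ε⁻¹}), g⟩ - ∑_{j < M} 1/j! ⟨t (χ - χ_{ε⁻¹}), A_j g⟩`, where `A_j g` is the part of the
Taylor expansion of `g` in `h` which is homogeneous of degree `j`. -/
def regularized (t : CDistribution (puncture U)) (χ : Sp n d → ℂ) (M : ℕ) (g : Sp n d → ℂ)
    (ε : ℝ) : ℂ :=
  (t.eval fun p => (1 - χ (dilation ε⁻¹ p)) * g p) -
    ∑ j ∈ Finset.range M, ((j.factorial : ℂ)⁻¹) * shellEval t χ (normalDeriv g j) ε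

theorem shellEval_taylorRemainder (u : CDistribution (puncture U)) (hθ : LocalCutoff S a κ θ)
    (hS : S ⊆ U) {ε : ℝ} (hε : ε ∈ Ioc (0 : ℝ) 1) {g : Sp n d → ℂ} (hg : ContDiff ℝ ∞ g) (M : ℕ) :
    shellEval u θ (taylorRemainder M g) ε = shellEval u θ g ε -
      ∑ j ∈ Finset.range M, ((j.factorial : ℂ)⁻¹) * shellEval u θ (normalDeriv g j) ε := by
  have hT := FiniteOrder.eval u (isCompact_shell hθ.isCompact (a * ε))
    (shell_subset_puncture hS (mul_pos hθ.pos hε.1))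
  have hs := hθ.smoothIn_sub_inv hε
  have h1 := hT.apply_taylorPoly hs hg M
  have h2 := hT.map_sub (hs.mul_right hg) (hs.mul_right (contDiff_taylorPoly hg M))
  simp only [shellEval, taylorRemainder, mul_sub]
  rw [h2, h1]

theorem eval_comp_dilation_inv (hU : RhoConvex U) (s : ℝ) (t : CDistribution U)
    (m : Ioc (0 : ℝ) 1) {L : Set (Sp n d)} {g : Sp n d → ℂ} (hg : SmoothIn L g)
    (hL : IsCompact L) (hLU : L ⊆ U) :
    (t.eval fun p => g (dilation (m : ℝ)⁻¹ p)) =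
      (((m : ℝ) ^ (s + d) : ℝ) : ℂ) * (scaled hU s t m).eval g := by
  rw [eval_scaled hU s t m hg hL hLU, ← mul_assoc, ← Complex.ofReal_mul,
    ← Real.rpow_add m.2.1, add_neg_cancel, Real.rpow_zero, Complex.ofReal_one, one_mul]

theorem LocalCutoff.smoothIn_one_sub_mul (hθ : LocalCutoff S a κ θ) {L : Set (Sp n d)}
    {g : Sp n d → ℂ} (hg : SmoothIn L g) (hκ : ∀ p, κ p.1 ≠ 1 → g p = 0) :
    SmoothIn (shell a L) fun p => (1 - θ p) * g p := by
  refine ⟨(contDiff_const.sub hθ.contDiff).mul hg.contDiff, fun p hp => ?_⟩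
  by_cases hpL : p ∈ L
  · have h1 : ‖p.2‖ ≤ a := le_of_lt (not_le.1 fun h => hp ⟨hpL, h⟩)
    rw [hθ.inner p h1]
    by_cases h : κ p.1 = 1
    · rw [h, sub_self, zero_mul]
    · rw [hκ p h, mul_zero]
  · rw [hg.zero_off p hpL, mul_zero]

variable {M : ℕ} (hU : RhoConvex U) (s : ℝ) (t : CDistribution (puncture U))

/-- How the regularized functionals behave under scaling. The argument is evaluated at the scale
`e₀ m ε`; with `θ = χ_{e₀⁻¹}`, what happens at scales below `e₀ m` is expressed by the rescaled
distribution, and only the counterterms see the scales between `e₀ m` and `1`. -/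
theorem regularized_comp_dilation (hθ : LocalCutoff S a κ θ) (hS : S ⊆ U) {e₀ : ℝ}
    (he : e₀ ∈ Ioc (0 : ℝ) 1) (hχθ : ∀ p, θ p = χ (dilation e₀⁻¹ p))
    (hχ : 0 < M → LocalCutoff S' a' κ' χ ∧ S' ⊆ U) {L : Set (Sp n d)} {g : Sp n d → ℂ}
    (hg : SmoothIn L g) (hL : IsCompact L) (hLU : L ⊆ U) (hκ : ∀ p, κ p.1 ≠ 1 → g p = 0)
    (m : Ioc (0 : ℝ) 1) {ε : ℝ} (hε : ε ∈ Ioc (0 : ℝ) 1) :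
    regularized t χ M (fun p => g (dilation (m : ℝ)⁻¹ p)) (e₀ * m * ε) =
      (((m : ℝ) ^ (s + d) : ℝ) : ℂ) *
          (((scaled hU.puncture s t m).eval fun p => (1 - θ p) * g p) +
            shellEval (scaled hU.puncture s t m) θ (taylorRemainder M g) ε) -
        ∑ j ∈ Finset.range M, ((j.factorial : ℂ)⁻¹) *
          ((((m : ℝ)⁻¹ ^ j : ℝ) : ℂ) * shellEval t χ (normalDeriv g j) (e₀ * m)) := by
  have hm := m.2.1
  have hdil : ∀ p : Sp n d, dilation (e₀ * m * ε)⁻¹ p =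
      dilation e₀⁻¹ (dilation ε⁻¹ (dilation (m : ℝ)⁻¹ p)) := fun p => by
    rw [dilation_dilation, dilation_dilation]
    congr 2
    rw [mul_inv, mul_inv]
    ring
  have hdil' : ∀ p : Sp n d, dilation (e₀ * m)⁻¹ p = dilation e₀⁻¹ (dilation (m : ℝ)⁻¹ p) :=
    fun p => by rw [dilation_dilation, mul_inv]
  have hLs := isCompact_shell hθ.isCompact (a * ε)
  have hLsU := shell_subset_puncture (U := U) hS (mul_pos hθ.pos hε.1)
  have hsh := hθ.smoothIn_sub_inv hε
  have h1 : (t.eval fun p => (1 - χ (dilation (e₀ * m * ε)⁻¹ p)) * g (dilation (m : ℝ)⁻¹ p)) =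
      (((m : ℝ) ^ (s + d) : ℝ) : ℂ) *
          (((scaled hU.puncture s t m).eval fun p => (1 - θ p) * g p) +
            shellEval (scaled hU.puncture s t m) θ g ε) := by
    have hA := hθ.smoothIn_one_sub_mul hg hκ
    have hB := hsh.mul_right hg.contDiff
    have hc : IsCompact (shell a L ∪ shell (a * ε) S) := (isCompact_shell hL a).union hLs
    have hcU : shell a L ∪ shell (a * ε) S ⊆ puncture U :=
      union_subset (shell_subset_puncture hLU hθ.pos) hLsU
    have hA' := hA.mono (subset_union_left (t := shell (a * ε) S))
    have hB' := hB.mono (subset_union_right (s := shell a L))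
    rw [shellEval, ← (FiniteOrder.eval _ hc hcU).map_add _ _ hA' hB',
      ← eval_comp_dilation_inv hU.puncture s t m (hA'.add hB') hc hcU]
    congr 1
    ext p
    rw [hχθ, hχθ, hdil]
    ring
  have h2 : ∀ j ∈ Finset.range M,
      shellEval t χ (normalDeriv (fun p => g (dilation (m : ℝ)⁻¹ p)) j) (e₀ * m * ε) =
      (((m : ℝ)⁻¹ ^ j : ℝ) : ℂ) * shellEval t χ (normalDeriv g j) (e₀ * m) +
      (((m : ℝ) ^ (s + d) : ℝ) : ℂ) *
        shellEval (scaled hU.puncture s t m) θ (normalDeriv g j) ε := by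
    intro j hj
    obtain ⟨hχ, hS'⟩ := hχ (Nat.zero_lt_of_lt (Finset.mem_range.1 hj))
    -- Split the shell `χ - χ_{(e₀ m ε)⁻¹}` at the scale `e₀ m`; the inner part is the dilate by `m`
    -- of `θ - θ_{ε⁻¹}`.
    have hem : e₀ * m ∈ Ioc (0 : ℝ) 1 := ⟨mul_pos he.1 hm, mul_le_one₀ he.2 hm.le m.2.2⟩
    have hB := hsh.mul_right (contDiff_normalDeriv hg.contDiff j)
    have hB' := hB.comp_dilation_inv hm.ne'
    have hA := (hχ.smoothIn_sub_inv hem).mul_right (contDiff_normalDeriv hg.contDiff j)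
    have hcA := isCompact_shell hχ.isCompact (a' * (e₀ * m))
    have hcAU := shell_subset_puncture (U := U) hS' (mul_pos hχ.pos hem.1)
    have hcB := hLs.image (dilation (m : ℝ)).continuous
    have hcBU := hU.puncture.image_subset hLsU m
    rw [shellEval, shellEval, shellEval, ← (FiniteOrder.eval t hcA hcAU).map_smul _ _ hA,
      ← eval_comp_dilation_inv hU.puncture s t m hB hLs hLsU,
      ← (FiniteOrder.eval t (hcA.union hcB) (union_subset hcAU hcBU)).map_add _ _
        ((hA.const_mul _).mono subset_union_left) (hB'.mono subset_union_right)]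
    congr 1
    ext p
    rw [hχθ, hχθ, hdil, hdil', normalDeriv_comp_dilation hg.contDiff, normalDeriv_dilation]
    push_cast
    ring
  rw [regularized, h1, shellEval_taylorRemainder _ hθ hS hε hg.contDiff, Finset.sum_congr rfl
    fun j hj => by rw [h2 j hj]]
  simp only [mul_add, mul_sub, Finset.sum_add_distrib, Finset.mul_sum,
    mul_left_comm (((m : ℝ) ^ (s + d) : ℝ) : ℂ)]
  ring

variable {Z : Set (Sp n d)} {w : Sp n d → ℝ} {hU s t}

/-- The main estimate: the regularized functionals converge, and the scaled limit inherits the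
bounds of the family `λ^{-s} t_λ`, up to a power of `|ξ|`. -/
theorem exists_tendsto_regularized (hθ : LocalCutoff S a κ θ) (hS : S ⊆ U) {e₀ : ℝ}
    (he : e₀ ∈ Ioc (0 : ℝ) 1) (hχθ : ∀ p, θ p = χ (dilation e₀⁻¹ p))
    (hχ : 0 < M → LocalCutoff S' a' κ' χ ∧ S' ⊆ U) {L : Set (Sp n d)} {φ : Sp n d → ℂ}
    (hφ : SmoothIn L φ) (hL : IsCompact L) (hLU : L ⊆ U) (hκ : ∀ p, κ p.1 ≠ 1 → φ p = 0)
    (hM : 0 < s + d + M) (hneg : ∀ j < M, s + d + j < 0) (hw : ∀ ζ, 0 < w ζ)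
    (h1 : ScaledBound hU s t (shell (a / 2) S) (Icc 0 1) Z w)
    (h2 : ∃ C, ∀ m : Ioc (0 : ℝ) 1, ∀ ζ ∈ Z,
      w ζ * ‖(scaled hU.puncture s t m).eval fun p => (1 - θ p) * (expo ζ p * φ p)‖ ≤
        C * (1 + ‖ζ.2‖) ^ M)
    (h3 : 0 < M → ScaledBound hU s t (shell (a' / 2) S') {0} Z w) :
    ∃ C, ∀ m : Ioc (0 : ℝ) 1, ∀ ζ ∈ Z, ∃ y,
      Tendsto (regularized t χ M fun p => expo ζ (dilation (m : ℝ)⁻¹ p) * φ (dilation (m : ℝ)⁻¹ p))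
        (𝓝[>] 0) (𝓝 y) ∧
      w ζ * ((m : ℝ) ^ (-(s + d)) * ‖y‖) ≤ C * (1 + ‖ζ.2‖) ^ M := by
  obtain ⟨C₁, hC₁, hb₁⟩ := exists_tendsto_shellEval hθ hS hw h1 hφ.contDiff hM
  obtain ⟨C₂, hb₂⟩ := h2
  have h4 : ∀ j, ∃ C, 0 ≤ C ∧ (j < M → ∀ ζ ∈ Z, ∀ l ∈ Ioc (0 : ℝ) 1,
      w ζ * ‖shellEval t χ (normalDeriv (fun p => expo ζ p * φ p) j) l‖ ≤
        C * (1 + ‖ζ.2‖) ^ j * l ^ (s + d + j)) := by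
    intro j
    by_cases hj : j < M
    · obtain ⟨hχ, hS'⟩ := hχ (Nat.zero_lt_of_lt hj)
      obtain ⟨C, hC, hb⟩ := exists_shellEval_normalDeriv_le hχ hS' (fun ζ => (hw ζ).le)
        (h3 (Nat.zero_lt_of_lt hj)) hφ.contDiff (hneg j hj)
      exact ⟨C, hC, fun _ => hb⟩
    · exact ⟨0, le_rfl, fun h => absurd h hj⟩
  choose D hD hDb using h4
  refine ⟨C₂ + C₁ + ∑ j ∈ Finset.range M, D j * e₀ ^ (s + d + j), fun m ζ hζ => ?_⟩
  obtain ⟨y, hy, hyb⟩ := hb₁ m ζ hζ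
  have hm := m.2.1
  have hg : SmoothIn L fun p => expo ζ p * φ p := .mul_left (contDiff_expo ζ) hφ
  set u := scaled hU.puncture s t m with hu
  set g : Sp n d → ℂ := fun p => expo ζ p * φ p with hgdef
  set v := u.eval fun p => (1 - θ p) * g p with hv
  set Y := (((m : ℝ) ^ (s + d) : ℝ) : ℂ) * (v + y) -
        ∑ j ∈ Finset.range M, ((j.factorial : ℂ)⁻¹) *
          ((((m : ℝ)⁻¹ ^ j : ℝ) : ℂ) * shellEval t χ (normalDeriv g j) (e₀ * m)) with hY
  have hem : e₀ * m ∈ Ioc (0 : ℝ) 1 := ⟨mul_pos he.1 hm, mul_le_one₀ he.2 hm.le m.2.2⟩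
  refine ⟨Y, ?_, ?_⟩
  · have hlim : Tendsto (fun ε => (((m : ℝ) ^ (s + d) : ℝ) : ℂ) *
          (v + shellEval u θ (taylorRemainder M g) ε) -
        ∑ j ∈ Finset.range M, ((j.factorial : ℂ)⁻¹) *
          ((((m : ℝ)⁻¹ ^ j : ℝ) : ℂ) * shellEval t χ (normalDeriv g j) (e₀ * m)))
        (𝓝[>] 0) (𝓝 Y) := ((hy.const_add v).const_mul _).sub_const _
    have hscale : Tendsto (fun η : ℝ => (e₀ * m)⁻¹ * η) (𝓝[>] 0) (𝓝[>] 0) := by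
      refine tendsto_nhdsWithin_iff.2 ⟨?_, ?_⟩
      · have := (continuous_const_mul ((e₀ * m : ℝ)⁻¹)).tendsto 0
        rw [mul_zero] at this
        exact this.mono_left nhdsWithin_le_nhds
      · filter_upwards [self_mem_nhdsWithin] with η hη
        exact mul_pos (inv_pos.2 hem.1) hη
    refine (hlim.comp hscale).congr' ?_
    filter_upwards [hscale.eventually (Ioc_mem_nhdsGT (zero_lt_one' ℝ))] with η hη
    have := regularized_comp_dilation hU s t hθ hS he hχθ hχ hg hL hLU
      (fun p hp => by rw [hgdef]; simp only [hκ p hp, mul_zero]) m hη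
    rw [mul_inv_cancel_left₀ hem.1.ne'] at this
    exact this.symm
  · have hξ : 1 ≤ 1 + ‖ζ.2‖ := by linarith [norm_nonneg ζ.2]
    have hmm : (m : ℝ) ^ (-(s + d)) * (m : ℝ) ^ (s + d) = 1 := by
      rw [← Real.rpow_add hm, neg_add_cancel, Real.rpow_zero]
    have hms := Real.rpow_nonneg hm.le (s + d)
    have hms' := Real.rpow_nonneg hm.le (-(s + d))
    have hwζ := (hw ζ).le
    have hterm : ∀ j ∈ Finset.range M, w ζ * ((m : ℝ) ^ (-(s + d)) * ‖((j.factorial : ℂ)⁻¹) *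
          ((((m : ℝ)⁻¹ ^ j : ℝ) : ℂ) * shellEval t χ (normalDeriv g j) (e₀ * m))‖) ≤
        D j * e₀ ^ (s + d + j) * (1 + ‖ζ.2‖) ^ M := by
      intro j hj
      have hj' := Finset.mem_range.1 hj
      have hb := hDb j hj' ζ hζ (e₀ * m) hem
      have hfac : ‖((j.factorial : ℂ)⁻¹)‖ ≤ 1 := by
        rw [norm_inv, Complex.norm_natCast]
        exact inv_le_one_of_one_le₀ (mod_cast Nat.one_le_iff_ne_zero.2 j.factorial_ne_zero)
      rw [norm_mul, norm_mul, Complex.norm_real, Real.norm_of_nonneg (by positivity)]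
      have e1 : (m : ℝ) ^ (-(s + d)) * (m : ℝ)⁻¹ ^ j * (e₀ * m) ^ (s + d + j) =
          e₀ ^ (s + d + j) := by
        rw [Real.mul_rpow he.1.le hm.le, Real.rpow_add_natCast hm.ne' (s + d) j, inv_pow]
        have : (m : ℝ) ^ j ≠ 0 := pow_ne_zero _ hm.ne'
        calc _ = e₀ ^ (s + d + j) * ((m : ℝ) ^ (-(s + d)) * (m : ℝ) ^ (s + d)) *
              (((m : ℝ) ^ j)⁻¹ * (m : ℝ) ^ j) := by ring
          _ = _ := by rw [hmm, inv_mul_cancel₀ this, mul_one, mul_one]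
      calc w ζ * ((m : ℝ) ^ (-(s + d)) * (‖((j.factorial : ℂ)⁻¹)‖ *
            ((m : ℝ)⁻¹ ^ j * ‖shellEval t χ (normalDeriv g j) (e₀ * m)‖)))
          ≤ w ζ * ((m : ℝ) ^ (-(s + d)) * (1 *
            ((m : ℝ)⁻¹ ^ j * ‖shellEval t χ (normalDeriv g j) (e₀ * m)‖))) := by gcongr
        _ = (m : ℝ) ^ (-(s + d)) * (m : ℝ)⁻¹ ^ j *
            (w ζ * ‖shellEval t χ (normalDeriv g j) (e₀ * m)‖) := by ring
        _ ≤ (m : ℝ) ^ (-(s + d)) * (m : ℝ)⁻¹ ^ j *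
            (D j * (1 + ‖ζ.2‖) ^ j * (e₀ * m) ^ (s + d + j)) := by gcongr
        _ = D j * ((m : ℝ) ^ (-(s + d)) * (m : ℝ)⁻¹ ^ j * (e₀ * m) ^ (s + d + j)) *
            (1 + ‖ζ.2‖) ^ j := by ring
        _ ≤ _ := by
          rw [e1]
          have := hD j
          have := Real.rpow_nonneg he.1.le (s + d + j)
          gcongr
    have hv' : w ζ * ‖v‖ ≤ C₂ * (1 + ‖ζ.2‖) ^ M := hb₂ m ζ hζ
    calc w ζ * ((m : ℝ) ^ (-(s + d)) * ‖Y‖)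
        ≤ w ζ * ((m : ℝ) ^ (-(s + d)) * ((m : ℝ) ^ (s + d) * (‖v‖ + ‖y‖) +
            ∑ j ∈ Finset.range M, ‖((j.factorial : ℂ)⁻¹) *
          ((((m : ℝ)⁻¹ ^ j : ℝ) : ℂ) * shellEval t χ (normalDeriv g j) (e₀ * m))‖)) := by
          gcongr
          refine (norm_sub_le _ _).trans (add_le_add ?_ (norm_sum_le _ _))
          rw [norm_mul, Complex.norm_real, Real.norm_of_nonneg hms]
          gcongr
          exact norm_add_le _ _
      _ = ((m : ℝ) ^ (-(s + d)) * (m : ℝ) ^ (s + d)) * (w ζ * ‖v‖ + w ζ * ‖y‖) +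
            ∑ j ∈ Finset.range M, w ζ * ((m : ℝ) ^ (-(s + d)) * ‖((j.factorial : ℂ)⁻¹) *
          ((((m : ℝ)⁻¹ ^ j : ℝ) : ℂ) * shellEval t χ (normalDeriv g j) (e₀ * m))‖) := by
          rw [← Finset.mul_sum, ← Finset.mul_sum]
          ring
      _ ≤ 1 * (C₂ * (1 + ‖ζ.2‖) ^ M + C₁ * (1 + ‖ζ.2‖) ^ M) +
            ∑ j ∈ Finset.range M, D j * e₀ ^ (s + d + j) * (1 + ‖ζ.2‖) ^ M := by
          rw [hmm]
          exact add_le_add (mul_le_mul_of_nonneg_left (add_le_add hv' hyb) zero_le_one)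
            (Finset.sum_le_sum hterm)
      _ = _ := by
          rw [← Finset.sum_mul]
          ring

end Regularized

/-! ### Localization of cutoffs in `x` -/

section Localize

variable {n d : ℕ} {Ω : Opens (EuclideanSpace ℝ (Fin n))} {𝒱 : Opens (Sp n d)}

/-- The product of a compact set in `x` and a ball in `h`. -/
def cylinder (K : Set (EuclideanSpace ℝ (Fin n))) (r : ℝ) : Set (Sp n d) :=
  {p | p.1 ∈ K ∧ ‖p.2‖ ≤ r}

theorem isCompact_cylinder {K : Set (EuclideanSpace ℝ (Fin n))} (hK : IsCompact K) (r : ℝ) :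
    IsCompact (cylinder K r : Set (Sp n d)) := by
  have : (cylinder K r : Set (Sp n d)) = K ×ˢ Metric.closedBall 0 r := by
    ext p
    simp [cylinder]
  rw [this]
  exact hK.prod (isCompact_closedBall _ _)

theorem exists_cylinder_subset {U : Opens (Sp n d)} {K : Set (EuclideanSpace ℝ (Fin n))}
    (hK : IsCompact K) (hKU : ∀ x ∈ K, ((x, 0) : Sp n d) ∈ U) :
    ∃ r > 0, (cylinder K r : Set (Sp n d)) ⊆ U := by
  obtain ⟨u, v, _, hv, hu, h0, huv⟩ := generalized_tube_lemma hK
    (isCompact_singleton (x := (0 : EuclideanSpace ℝ (Fin d)))) U.isOpen (by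
      rintro ⟨x, h⟩ ⟨hx, rfl⟩
      exact hKU x hx)
  obtain ⟨r, hr, hrv⟩ := Metric.isOpen_iff.1 hv 0 (h0 rfl)
  refine ⟨r / 2, half_pos hr, fun p hp => huv ⟨hu hp.1, hrv ?_⟩⟩
  rw [mem_ball_zero_iff]
  exact hp.2.trans_lt (half_lt_self hr)

theorem exists_smooth_bump {K : Set (EuclideanSpace ℝ (Fin n))} (hK : IsCompact K)
    (hKΩ : K ⊆ Ω) : ∃ (κ : EuclideanSpace ℝ (Fin n) → ℝ) (K' : Set (EuclideanSpace ℝ (Fin n))),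
      ContDiff ℝ ∞ κ ∧ IsCompact K' ∧ K' ⊆ Ω ∧ K ⊆ K' ∧ (∀ x ∈ K, κ x = 1) ∧
        ∀ x ∉ K', κ x = 0 := by
  obtain ⟨K', hK', hKK', hK'Ω⟩ := exists_compact_between hK Ω.isOpen hKΩ
  obtain ⟨f, hf0, hf1, -⟩ := exists_contMDiffMap_zero_one_of_isClosed (n := ⊤)
    (modelWithCornersSelf ℝ (EuclideanSpace ℝ (Fin n)))
    (isOpen_interior (s := K')).isClosed_compl hK.isClosed
    (disjoint_compl_left_iff_subset.2 hKK')
  exact ⟨f, K', f.contMDiff.contDiff, hK', hK'Ω, hKK'.trans interior_subset, fun x hx => hf1 hx,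
    fun x hx => hf0 fun h => hx (interior_subset h)⟩

/-- The data of a cutoff `χ` localized near a compact set `K`: the function `θ` is globally smooth
and agrees with `χ` over `K`, and it is supported over the compact set `K' ⊆ Ω`. -/
structure Localized (Ω : Opens (EuclideanSpace ℝ (Fin n))) (χ : Sp n d → ℝ)
    (K K' : Set (EuclideanSpace ℝ (Fin n))) (a b : ℝ) (κ : EuclideanSpace ℝ (Fin n) → ℂ)
    (θ : Sp n d → ℂ) : Prop where
  contDiff : ContDiff ℝ ∞ θ
  isCompact : IsCompact K'
  subset : K' ⊆ Ω
  pos : 0 < a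
  lt : a < b
  one : ∀ x ∈ K, κ x = 1
  eq : ∀ p : Sp n d, p.1 ∈ K → θ p = χ p
  inner : ∀ p : Sp n d, ‖p.2‖ ≤ a → θ p = κ p.1
  outer : ∀ p : Sp n d, b ≤ ‖p.2‖ → θ p = 0
  off : ∀ p : Sp n d, p.1 ∉ K' → θ p = 0
  support : ∀ p : Sp n d, χ p = 0 → θ p = 0

theorem IsCutoff.exists_localized {χ : Sp n d → ℝ} (hχ : IsCutoff Ω χ)
    {K : Set (EuclideanSpace ℝ (Fin n))} (hK : IsCompact K) (hKΩ : K ⊆ Ω) :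
    ∃ K' a b κ θ, Localized Ω χ K K' a b κ θ := by
  obtain ⟨κ, K', hκ, hK', hK'Ω, hKK', hκ1, hκ0⟩ := exists_smooth_bump hK hKΩ
  obtain ⟨a, b, ha, hab, hab'⟩ := hχ.2 K' hK' hK'Ω
  refine ⟨K', a, b, fun x => κ x, fun p => ((κ p.1 * χ p : ℝ) : ℂ), ?_, hK', hK'Ω, ha, hab,
    fun x hx => by rw [hκ1 x hx, Complex.ofReal_one],
    fun p hp => by simp [hκ1 p.1 hp], fun p hp => ?_, fun p hp => ?_,
    fun p hp => by simp [hκ0 p.1 hp], fun p hp => by simp [hp]⟩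
  · refine Complex.ofRealCLM.contDiff.comp (contDiff_iff_contDiffAt.2 fun p => ?_)
    by_cases hp : p.1 ∈ Ω
    · have ho : IsOpen {p : Sp n d | p.1 ∈ Ω} := Ω.isOpen.preimage continuous_fst
      exact (hκ.comp contDiff_fst).contDiffAt.mul (hχ.1.contDiffAt (ho.mem_nhds hp))
    · have hp' : p.1 ∈ K'ᶜ := fun h => hp (hK'Ω h)
      have ho : IsOpen {p : Sp n d | p.1 ∈ K'ᶜ} :=
        hK'.isClosed.isOpen_compl.preimage continuous_fst
      refine (contDiffAt_const (c := (0 : ℝ))).congr_of_eventuallyEq ?_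
      filter_upwards [ho.mem_nhds hp'] with q hq
      rw [hκ0 q.1 hq]
      exact zero_mul _
  · by_cases h : p.1 ∈ K'
    · have := (hab' p.1 h p.2).1 hp
      simp [this]
    · simp [hκ0 _ h]
  · by_cases h : p.1 ∈ K'
    · have := (hab' p.1 h p.2).2 hp
      simp [this]
    · simp [hκ0 _ h]

variable {χ : Sp n d → ℝ} {K K' : Set (EuclideanSpace ℝ (Fin n))} {a b : ℝ}
  {κ : EuclideanSpace ℝ (Fin n) → ℂ} {θ : Sp n d → ℂ}

theorem Localized.localCutoff (h : Localized Ω χ K K' a b κ θ) {e : ℝ} (he : 0 < e) :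
    LocalCutoff (cylinder K' (b * e)) (a * e) κ fun p => θ (dilation e⁻¹ p) where
  contDiff := h.contDiff.comp (dilation e⁻¹).contDiff
  pos := mul_pos h.pos he
  isCompact := isCompact_cylinder h.isCompact _
  star p hp c hc := ⟨hp.1, by
    rw [dilation_apply, norm_smul, Real.norm_of_nonneg hc.1]
    exact (mul_le_of_le_one_left (norm_nonneg _) hc.2).trans hp.2⟩
  inner p hp := h.inner _ (by
    rw [dilation_apply, norm_smul, Real.norm_of_nonneg (inv_nonneg.2 he.le), inv_mul_le_iff₀ he]
    linarith)
  off p hp := by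
    by_cases h1 : p.1 ∈ K'
    · refine h.outer _ ?_
      have : b * e < ‖p.2‖ := not_le.1 fun h2 => hp ⟨h1, h2⟩
      rw [dilation_apply, norm_smul, Real.norm_of_nonneg (inv_nonneg.2 he.le),
        le_inv_mul_iff₀ he]
      linarith
    · exact h.off _ h1

/-- If the cutoff is supported in a suitable neighbourhood of `{h = 0}`, so is a star-shaped
compact set containing the support of its localization. -/
theorem Localized.exists_localCutoff (h : Localized Ω χ K K' a b κ θ) {𝒩 : Opens (Sp n d)}
    (hI : ∀ x ∈ Ω, ((x, 0) : Sp n d) ∈ 𝒩) (hρ : RhoConvex 𝒩) (hχ : CutoffSupportedIn Ω χ 𝒩) :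
    ∃ S, LocalCutoff S a κ θ ∧ S ⊆ 𝒩 := by
  let S₀ : Set (Sp n d) := cylinder K' b ∩ closure (Function.support χ)
  have hS₀ : IsCompact S₀ := (isCompact_cylinder h.isCompact b).inter_right isClosed_closure
  let f : Sp n d × ℝ → Sp n d := fun z => dilation z.2 z.1
  have hf : Continuous f := contDiff_dilation_uncurry.continuous
  refine ⟨f '' (S₀ ×ˢ Icc 0 1), ⟨h.contDiff, h.pos, (hS₀.prod isCompact_Icc).image hf, ?_,
    h.inner, fun p hp => ?_⟩, ?_⟩
  · rintro _ ⟨⟨p, l⟩, ⟨hp, hl⟩, rfl⟩ c hc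
    exact ⟨(p, c * l), ⟨hp, mul_nonneg hc.1 hl.1, mul_le_one₀ hc.2 hl.1 hl.2⟩,
      (dilation_dilation c l p).symm⟩
  · by_contra h0
    refine hp ⟨(p, 1), ⟨⟨⟨?_, ?_⟩, subset_closure ?_⟩, zero_le_one, le_rfl⟩, dilation_one p⟩
    · exact by_contra fun h1 => h0 (h.off p h1)
    · exact (not_le.1 fun h1 => h0 (h.outer p h1)).le
    · exact fun h1 => h0 (h.support p h1)
  · rintro _ ⟨⟨p, l⟩, ⟨hp, hl⟩, rfl⟩
    have hp𝒩 : p ∈ 𝒩 := hχ p hp.2 (h.subset hp.1.1)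
    rcases hl.1.eq_or_lt with h0 | h0
    · have h0' : l = 0 := h0.symm
      have : f (p, l) = (p.1, 0) := by simp [f, h0']
      rw [this]
      exact hI _ (h.subset hp.1.1)
    · exact hρ p hp𝒩 ⟨l, h0, hl.2⟩

/-- Soft landing provides a neighbourhood of `{h = 0}` over which no covector of the scaled wave
front sets has the form `(k, 0)`. -/
theorem SoftLanding.exists_nhds {t : CDistribution (puncture 𝒱)} (h : SoftLanding Ω (WF t))
    (hI : ∀ x ∈ Ω, ((x, 0) : Sp n d) ∈ 𝒱) (hρ : RhoConvex 𝒱) :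
    ∃ 𝒩 : Opens (Sp n d), 𝒩 ≤ 𝒱 ∧ (∀ x ∈ Ω, ((x, 0) : Sp n d) ∈ 𝒩) ∧ RhoConvex 𝒩 ∧
      ∀ q ∈ scaledWF hρ.puncture t, q.1 ∈ 𝒩 → q.2.2 = 0 → q.2.1 = 0 := by
  have h' : ∀ x ∈ Ω, ∃ r > 0, ∃ δ > 0, ∀ q ∈ WF t, q.1 ∈ Metric.ball ((x, 0) : Sp n d) r →
      ‖q.2.1‖ ≤ δ * ‖q.1.2‖ * ‖q.2.2‖ := by
    intro x hx
    obtain ⟨U, hU, ε, hε, δ, hδ, h1⟩ := h x hx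
    obtain ⟨r, hr, hrU⟩ := Metric.mem_nhds_iff.1 hU
    refine ⟨min r ε, lt_min hr hε, δ, hδ, fun q hq hq' => h1 q hq
      (hrU (Metric.ball_subset_ball (min_le_left _ _) hq')) ?_⟩
    rw [Metric.mem_ball, Prod.dist_eq, max_lt_iff] at hq'
    have := hq'.2.le.trans (min_le_right r ε)
    simpa using this
  choose! r hr δ _ hb using h'
  let 𝒩 : Opens (Sp n d) :=
    ⟨𝒱 ∩ ⋃ x ∈ Ω, Metric.ball ((x, 0) : Sp n d) (r x),
      𝒱.isOpen.inter (isOpen_biUnion fun _ _ => Metric.isOpen_ball)⟩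
  have hconv : RhoConvex 𝒩 := by
    rintro p ⟨hp, hp'⟩ l
    obtain ⟨x, hx, hpx⟩ := mem_iUnion₂.1 hp'
    refine ⟨hρ p hp l, mem_iUnion₂.2 ⟨x, hx, ?_⟩⟩
    rw [Metric.mem_ball, Prod.dist_eq, max_lt_iff, dist_zero_right] at hpx ⊢
    refine ⟨hpx.1, lt_of_le_of_lt ?_ hpx.2⟩
    rw [dilation_apply, norm_smul, Real.norm_of_nonneg l.2.1.le]
    exact mul_le_of_le_one_left (norm_nonneg _) l.2.2
  refine ⟨𝒩, fun p hp => hp.1, fun x hx => ⟨hI x hx, mem_iUnion₂.2 ⟨x, hx,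
    Metric.mem_ball_self (hr x hx)⟩⟩, hconv, fun q hq hq𝒩 h0 => ?_⟩
  obtain ⟨l, hl⟩ := exists_mem_WF_of_mem_scaledWF hρ.puncture hq
  obtain ⟨x, hx, hpx⟩ := mem_iUnion₂.1 (hconv q.1 hq𝒩 l).2
  have := hb x hx _ hl hpx
  simpa [h0] using this

end Localize

/-! ### The extension -/

section Extension

variable {n d : ℕ} {U : Opens (Sp n d)} {s : ℝ} {L : Set (Sp n d)}

theorem SmoothIn.tsupport_toTest_subset {g : Sp n d → ℂ} (hg : SmoothIn L g) (hL : IsCompact L)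
    (hLU : L ⊆ U) : tsupport (hg.toTest hL hLU) ⊆ L :=
  closure_minimal (fun p hp => by_contra fun h => hp (hg.zero_off p h)) hL.isClosed

/-- Weak boundedness, in the form in which the main estimate uses it: only the covector `0`, with
weight one. -/
theorem BoundedIn.scaledBound_zero {hU : RhoConvex U} {t : CDistribution (puncture U)}
    {Γ : Set (Phase n d)} (hb : BoundedIn Γ (scaledFamily hU.puncture s t)) (hL : IsCompact L)
    (hLU : L ⊆ puncture U) (Λ : Set ℝ) : ScaledBound hU s t L Λ {0} fun _ => 1 := by
  intro g hg
  obtain ⟨C, hC⟩ := hb.2.1 (hg.toTest hL hLU)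
  refine ⟨C, fun m ζ hζ l _ => ?_⟩
  obtain rfl : ζ = 0 := hζ
  simp only [map_zero, expo_zero, one_mul]
  rw [hg.eval_eq hL hLU]
  exact hC _ ⟨m, rfl⟩

/-- Uniform rapid decrease, in the form in which the main estimate uses it. The dilated covectors
`(k, λξ)` are required to lie in a cone `W` which misses `Γ` over `L`; the factor `B` compares the
weight at `(k, ξ)` with the weight at `(k, λξ)`. -/
theorem BoundedIn.scaledBound_cone {hU : RhoConvex U} {t : CDistribution (puncture U)}
    {Γ : Set (Phase n d)} (hb : BoundedIn Γ (scaledFamily hU.puncture s t)) (hL : IsCompact L)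
    (hLU : L ⊆ puncture U) {Λ : Set ℝ} {Z W : Set (Sp n d)} (hW : IsClosedCone W)
    (hdisj : ∀ q ∈ Γ, q.1 ∈ L → q.2 ∉ W) (hZ : ∀ ζ ∈ Z, ∀ l ∈ Λ, dilation l ζ ∈ W) {B : ℝ}
    (hB0 : 0 ≤ B)
    (hB : ∀ ζ ∈ Z, ∀ l ∈ Λ, 1 + covNorm ζ ≤ B * (1 + covNorm (dilation l ζ))) (N : ℕ) :
    ScaledBound hU s t L Λ Z fun ζ => (1 + covNorm ζ) ^ N := by
  intro g hg
  obtain ⟨C, hC⟩ := hb.2.2 N W (hg.toTest hL hLU) hW (by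
    refine eq_empty_iff_forall_notMem.2 fun q hq => ?_
    exact hdisj q hq.2 (hg.tsupport_toTest_subset hL hLU hq.1.1) hq.1.2)
  refine ⟨B ^ N * C, fun m ζ hζ l hl => ?_⟩
  have h1 := hC _ ⟨m, rfl⟩ _ (hZ ζ hζ l hl)
  rw [localFourier_eq_eval] at h1
  have h2 := hB ζ hζ l hl
  have h3 := covNorm_nonneg ζ
  calc (1 + covNorm ζ) ^ N * _ ≤ (B * (1 + covNorm (dilation l ζ))) ^ N * _ := by gcongr
    _ = B ^ N * ((1 + covNorm (dilation l ζ)) ^ N *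
        ‖(scaled hU.puncture s t m).eval fun p => expo (dilation l ζ) p * g p‖) := by
      rw [mul_pow, mul_assoc]
    _ ≤ B ^ N * C := mul_le_mul_of_nonneg_left h1 (pow_nonneg hB0 N)

/-- The hypotheses under which the extension is constructed. The number of terms `M` subtracted
from the Taylor expansion is minimal for the convergence: `-M < s + d`, and `s + d < -j` for
`j < M`. The neighbourhood `𝒩` of `{h = 0}` is the one provided by soft landing. -/
structure ExtensionSetting (Ω : Opens (EuclideanSpace ℝ (Fin n))) {𝒱 : Opens (Sp n d)}
    (hρ : RhoConvex 𝒱) (s : ℝ) (t : CDistribution (puncture 𝒱)) (χ : Sp n d → ℝ) (M : ℕ)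
    (𝒩 : Opens (Sp n d)) : Prop where
  fst_mem : ∀ p ∈ 𝒱, p.1 ∈ Ω
  zero_mem : ∀ x ∈ Ω, ((x, 0) : Sp n d) ∈ 𝒱
  soft : SoftLanding Ω (WF t)
  bounded : BoundedIn (scaledWF hρ.puncture t) (scaledFamily hρ.puncture s t)
  cutoff : IsCutoff Ω χ
  le : 𝒩 ≤ 𝒱
  zero_mem_nhds : ∀ x ∈ Ω, ((x, 0) : Sp n d) ∈ 𝒩
  rhoConvex : RhoConvex 𝒩
  landing : ∀ q ∈ scaledWF hρ.puncture t, q.1 ∈ 𝒩 → q.2.2 = 0 → q.2.1 = 0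
  supportedIn : 0 < M → CutoffSupportedIn Ω χ 𝒩
  pos : 0 < s + d + M
  neg : ∀ j < M, s + d + j < 0

variable {Ω : Opens (EuclideanSpace ℝ (Fin n))} {𝒱 𝒩 : Opens (Sp n d)} {hρ : RhoConvex 𝒱}
  {t : CDistribution (puncture 𝒱)} {χ : Sp n d → ℝ} {M : ℕ}
  {K K' : Set (EuclideanSpace ℝ (Fin n))} {a b : ℝ} {κ : EuclideanSpace ℝ (Fin n) → ℂ}
  {θ : Sp n d → ℂ}

/-- For functions supported over `K`, the cutoff may be replaced by its localization. -/
theorem Localized.regularized_eq (h : Localized Ω χ K K' a b κ θ) (hK : IsClosed K)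
    {g : Sp n d → ℂ} (hg : ∀ p : Sp n d, p.1 ∉ K → g p = 0) :
    regularized t (fun p => (χ p : ℂ)) M g = regularized t θ M g := by
  ext ε
  have h1 : ∀ p : Sp n d, ∀ f : Sp n d → ℂ, (∀ p : Sp n d, p.1 ∉ K → f p = 0) →
      ((χ p : ℂ) * f p = θ p * f p ∧
        (χ (dilation ε⁻¹ p) : ℂ) * f p = θ (dilation ε⁻¹ p) * f p) := by
    intro p f hf
    by_cases hp : p.1 ∈ K
    · rw [h.eq p hp, h.eq (dilation ε⁻¹ p) hp]
      exact ⟨rfl, rfl⟩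
    · simp [hf p hp]
  simp only [regularized, shellEval, sub_mul]
  congr 1
  · congr 1
    ext p
    rw [(h1 p g hg).2]
  · refine Finset.sum_congr rfl fun j _ => ?_
    congr 2
    ext p
    have := h1 p (normalDeriv g j) fun p hp => normalDeriv_eq_zero_of_fst hK hg hp
    rw [this.1, this.2]

namespace ExtensionSetting

variable (h : ExtensionSetting Ω hρ s t χ M 𝒩)
include h

theorem exists_localized (hL : IsCompact L) (hLU : L ⊆ 𝒱) :
    ∃ K' a b κ θ, Localized Ω χ (Prod.fst '' L) K' a b κ θ :=
  h.cutoff.exists_localized (hL.image continuous_fst) (by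
    rintro _ ⟨p, hp, rfl⟩
    exact h.fst_mem p (hLU hp))

/-- The main estimate for a cutoff over `Ω`. The bound `h3` is required only on compact subsets of
`𝒩`, where the cutoff is supported if there are counterterms. -/
theorem exists_tendsto (hloc : Localized Ω χ K K' a b κ θ) (hK : IsCompact K) {φ : Sp n d → ℂ}
    (hφ : SmoothIn L φ) (hL : IsCompact L) (hLU : L ⊆ 𝒱)
    (hφK : ∀ p : Sp n d, p.1 ∉ K → φ p = 0) {e : ℝ} (he : e ∈ Ioc (0 : ℝ) 1)
    (hcyl : cylinder K' (b * e) ⊆ (𝒱 : Set (Sp n d))) {Z : Set (Sp n d)} {w : Sp n d → ℝ}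
    (hw : ∀ ζ, 0 < w ζ)
    (h1 : ScaledBound hρ s t (shell (a * e / 2) (cylinder K' (b * e))) (Icc 0 1) Z w)
    (h2 : ∃ C, ∀ m : Ioc (0 : ℝ) 1, ∀ ζ ∈ Z, w ζ * ‖(scaled hρ.puncture s t m).eval fun p =>
      (1 - θ (dilation e⁻¹ p)) * (expo ζ p * φ p)‖ ≤ C * (1 + ‖ζ.2‖) ^ M)
    (h3 : ∀ L : Set (Sp n d), IsCompact L → L ⊆ 𝒩 → L ⊆ puncture 𝒱 →
      ScaledBound hρ s t L {0} Z w) :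
    ∃ C, ∀ m : Ioc (0 : ℝ) 1, ∀ ζ ∈ Z, ∃ y,
      Tendsto (regularized t (fun p => (χ p : ℂ)) M fun p =>
          expo ζ (dilation (m : ℝ)⁻¹ p) * φ (dilation (m : ℝ)⁻¹ p)) (𝓝[>] 0) (𝓝 y) ∧
      w ζ * ((m : ℝ) ^ (-(s + d)) * ‖y‖) ≤ C * (1 + ‖ζ.2‖) ^ M := by
  have hκ : ∀ p : Sp n d, κ p.1 ≠ 1 → φ p = 0 := fun p hp =>
    hφK p fun hpK => hp (hloc.one p.1 hpK)
  obtain ⟨S, hS⟩ : ∃ S, 0 < M → LocalCutoff S a κ θ ∧ S ⊆ 𝒩 := by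
    rcases Nat.eq_zero_or_pos M with h0 | h0
    · exact ⟨∅, fun h' => absurd h0 h'.ne'⟩
    · obtain ⟨S, hS⟩ := hloc.exists_localCutoff h.zero_mem_nhds h.rhoConvex (h.supportedIn h0)
      exact ⟨S, fun _ => hS⟩
  obtain ⟨C, hC⟩ := exists_tendsto_regularized (hloc.localCutoff he.1) hcyl he (fun _ => rfl)
    (fun h0 => ⟨(hS h0).1, (hS h0).2.trans h.le⟩) hφ hL hLU hκ h.pos h.neg hw h1 h2
    fun h0 => h3 _ (isCompact_shell (hS h0).1.isCompact _) (fun p hp => (hS h0).2 hp.1)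
      (shell_subset_puncture ((hS h0).2.trans h.le) (half_pos (hS h0).1.pos))
  refine ⟨C, fun m ζ hζ => ?_⟩
  rw [hloc.regularized_eq hK.isClosed fun p hp => by
    rw [hφK _ (by simpa using hp), mul_zero]]
  exact hC m ζ hζ

/-- A rescaling of the localized cutoff has its support in `𝒱` and in a given neighbourhood of
`{h = 0}`. -/
theorem exists_scale (hloc : Localized Ω χ K K' a b κ θ) {r : ℝ} (hr : 0 < r) :
    ∃ e ∈ Ioc (0 : ℝ) 1, b * e ≤ r ∧ cylinder K' (b * e) ⊆ (𝒱 : Set (Sp n d)) := by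
  have hb := hloc.pos.trans hloc.lt
  obtain ⟨r', hr', hsub⟩ := exists_cylinder_subset (U := 𝒱) hloc.isCompact
    fun x hx => h.zero_mem x (hloc.subset hx)
  refine ⟨min 1 (min r r' / b), ⟨by positivity, min_le_left _ _⟩, ?_, fun p hp => hsub ⟨hp.1, ?_⟩⟩
  · calc b * min 1 (min r r' / b) ≤ b * (r / b) := by
          gcongr
          exact (min_le_right _ _).trans (by gcongr; exact min_le_left _ _)
      _ = r := mul_div_cancel₀ _ hb.ne'
  · calc ‖p.2‖ ≤ b * min 1 (min r r' / b) := hp.2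
      _ ≤ b * (r' / b) := by
          gcongr
          exact (min_le_right _ _).trans (by gcongr; exact min_le_right _ _)
      _ = r' := mul_div_cancel₀ _ hb.ne'

/-- Convergence of the regularized functionals, with the weak bound for the scaled limit. -/
theorem exists_tendsto_weak {φ : Sp n d → ℂ} (hφ : SmoothIn L φ) (hL : IsCompact L)
    (hLU : L ⊆ 𝒱) : ∃ C, ∀ m : Ioc (0 : ℝ) 1, ∃ y,
      Tendsto (regularized t (fun p => (χ p : ℂ)) M fun p => φ (dilation (m : ℝ)⁻¹ p))
        (𝓝[>] 0) (𝓝 y) ∧ (m : ℝ) ^ (-(s + d)) * ‖y‖ ≤ C := by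
  obtain ⟨K', a, b, κ, θ, hloc⟩ := h.exists_localized hL hLU
  obtain ⟨e, he, -, hcyl⟩ := h.exists_scale hloc one_pos
  have hφK : ∀ p : Sp n d, p.1 ∉ Prod.fst '' L → φ p = 0 := fun p hp =>
    hφ.zero_off p fun h => hp ⟨p, h, rfl⟩
  have hθ := hloc.localCutoff he.1
  have hs := hθ.smoothIn_one_sub_mul hφ fun p hp => hφK p fun hpK => hp (hloc.one p.1 hpK)
  obtain ⟨C, hC⟩ := h.bounded.scaledBound_zero (hU := hρ) (isCompact_shell hL _)
    (shell_subset_puncture hLU hθ.pos) {1} _ hs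
  obtain ⟨C', hC'⟩ := h.exists_tendsto hloc (hL.image continuous_fst) hφ hL hLU hφK he hcyl
    (fun _ => one_pos)
    (h.bounded.scaledBound_zero (hU := hρ) (isCompact_shell hθ.isCompact _)
      (shell_subset_puncture hcyl (half_pos hθ.pos)) _)
    ⟨C, fun m ζ hζ => by
      obtain rfl : ζ = 0 := hζ
      simpa only [map_zero, expo_zero, one_mul, Prod.snd_zero, norm_zero, add_zero, one_pow,
        mul_one] using hC m 0 rfl 1 rfl⟩
    (fun L hL _ hLU => h.bounded.scaledBound_zero hL hLU _)
  refine ⟨C', fun m => ?_⟩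
  simpa [expo_zero] using hC' m 0 rfl

theorem finiteOrder_regularized (hL : IsCompact L) (hLU : L ⊆ 𝒱) {ε : ℝ}
    (hε : ε ∈ Ioc (0 : ℝ) 1) :
    FiniteOrder L fun g => regularized t (fun p => (χ p : ℂ)) M g ε := by
  obtain ⟨K', a, b, κ, θ, hloc⟩ := h.exists_localized hL hLU
  have hKc : IsClosed (Prod.fst '' L) := (hL.image continuous_fst).isClosed
  have hθ := hloc.localCutoff hε.1
  have hreg : FiniteOrder L fun g => regularized t θ M g ε := by
    refine FiniteOrder.sub ?_ (FiniteOrder.sum _ fun j hj => FiniteOrder.const_mul ?_ _)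
    · refine (FiniteOrder.eval t (isCompact_shell hL (a * ε))
        (shell_subset_puncture hLU hθ.pos)).comp_mul (isCompact_shell hL (a * ε))
        (contDiff_const.sub hθ.contDiff) (ContinuousLinearMap.id ℝ _) fun p hp hpL => ?_
      have hp' : ‖p.2‖ ≤ a * ε := le_of_lt (not_le.1 fun h' => hp ⟨hpL, h'⟩)
      rw [hθ.inner p hp', hloc.one p.1 ⟨p, hpL, rfl⟩, sub_self]
    · obtain ⟨S, hS, hS𝒩⟩ := hloc.exists_localCutoff h.zero_mem_nhds h.rhoConvex
        (h.supportedIn (Nat.zero_lt_of_lt (Finset.mem_range.1 hj)))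
      exact FiniteOrder.normalDeriv (isCompact_shell hS.isCompact _)
        (FiniteOrder.eval t (isCompact_shell hS.isCompact _)
          (shell_subset_puncture (hS𝒩.trans h.le) (mul_pos hS.pos hε.1)))
        (hS.smoothIn_sub_inv hε) hL j
  have heq : ∀ g, SmoothIn L g →
      regularized t (fun p => (χ p : ℂ)) M g ε = regularized t θ M g ε := fun g hg => by
    rw [hloc.regularized_eq hKc fun p hp => hg.zero_off p fun h' => hp ⟨p, h', rfl⟩]
  obtain ⟨k, C, hC, hb⟩ := hreg.bound
  exact ⟨fun f g hf hg => by rw [heq _ (hf.add hg), heq _ hf, heq _ hg, hreg.map_add _ _ hf hg],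
    fun c f hf => by rw [heq _ (hf.const_mul c), heq _ hf, hreg.map_smul _ _ hf],
    k, C, hC, fun g hg B hB => by rw [heq _ hg]; exact hb g hg B hB⟩

theorem exists_limit : ∃ tbar : CDistribution 𝒱, ∀ φ : 𝓓(𝒱, ℂ),
    Tendsto (regularized t (fun p => (χ p : ℂ)) M φ) (𝓝[>] 0) (𝓝 (tbar φ)) := by
  -- The limit exists whenever `g` is smooth with compact support in `𝒱`; elsewhere the value of
  -- `limUnder` is never used.
  let T : (Sp n d → ℂ) → ℂ := fun g => limUnder (𝓝[>] 0) (regularized t (fun p => (χ p : ℂ)) M g)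
  have hT : ∀ L : Set (Sp n d), IsCompact L → L ⊆ 𝒱 → ∀ g, SmoothIn L g →
      Tendsto (regularized t (fun p => (χ p : ℂ)) M g) (𝓝[>] 0) (𝓝 (T g)) := by
    intro L hL hLU g hg
    obtain ⟨C, hC⟩ := h.exists_tendsto_weak hg hL hLU
    obtain ⟨y, hy, -⟩ := hC ⟨1, one_pos, le_rfl⟩
    simp only [inv_one, dilation_one] at hy
    exact tendsto_nhds_limUnder ⟨y, hy⟩
  have hseq : Tendsto (fun i : ℕ => 1 / ((i : ℝ) + 1)) atTop (𝓝[>] 0) :=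
    tendsto_nhdsWithin_iff.2 ⟨tendsto_one_div_add_atTop_nhds_zero_nat,
      Eventually.of_forall fun i => by simp only [mem_Ioi]; positivity⟩
  obtain ⟨tbar, htbar⟩ := exists_cDistribution (U := 𝒱) (T := T) fun L hL hLU =>
    FiniteOrder.of_tendsto hL (fun i => h.finiteOrder_regularized hL hLU
      (ε := 1 / ((i : ℝ) + 1)) ⟨by positivity, by
        rw [div_le_one (by positivity)]
        linarith [(Nat.cast_nonneg i : (0 : ℝ) ≤ i)]⟩)
      fun g hg => (hT L hL hLU g hg).comp hseq
  refine ⟨tbar, fun φ => ?_⟩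
  rw [htbar φ]
  exact hT _ φ.hasCompactSupport φ.tsupport_subset φ (smoothIn_testFunction φ)

variable {tbar : CDistribution 𝒱} (htbar : ∀ φ : 𝓓(𝒱, ℂ),
    Tendsto (regularized t (fun p => (χ p : ℂ)) M φ) (𝓝[>] 0) (𝓝 (tbar φ)))
include htbar

omit h in
theorem tendsto_eval {g : Sp n d → ℂ} (hg : SmoothIn L g) (hL : IsCompact L) (hLU : L ⊆ 𝒱) :
    Tendsto (regularized t (fun p => (χ p : ℂ)) M g) (𝓝[>] 0) (𝓝 (tbar.eval g)) := by
  rw [hg.eval_eq hL hLU]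
  exact htbar (hg.toTest hL hLU)

theorem isExtension : IsExtension t tbar := by
  intro φ
  have hle : (puncture 𝒱 : Opens (Sp n d)) ≤ 𝒱 := fun p hp => hp.1
  have hφc : IsCompact (tsupport φ) := φ.hasCompactSupport
  have hcoe : ((TestFunction.monoCLM ℂ φ : 𝓓(𝒱, ℂ)) : Sp n d → ℂ) = φ := by
    rw [TestFunction.monoCLM_apply, if_pos ⟨le_rfl, hle⟩]
  refine tendsto_nhds_unique (htbar _) ?_
  rw [hcoe]
  obtain ⟨K', a, b, κ, θ, hloc⟩ := h.exists_localized hφc (φ.tsupport_subset.trans hle)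
  have hb := hloc.pos.trans hloc.lt
  rw [hloc.regularized_eq (hφc.image continuous_fst).isClosed fun p hp =>
    image_eq_zero_of_notMem_tsupport fun h' => hp ⟨p, h', rfl⟩]
  obtain ⟨r, hr, hr'⟩ : ∃ r > 0, ∀ p ∈ tsupport φ, r ≤ ‖p.2‖ := by
    rcases (tsupport φ).eq_empty_or_nonempty with h0 | h0
    · exact ⟨1, one_pos, by simp [h0]⟩
    · obtain ⟨p, hp, hmin⟩ := hφc.exists_isMinOn h0 (continuous_snd.norm).continuousOn
      exact ⟨‖p.2‖, norm_pos_iff.2 (φ.tsupport_subset hp).2, fun q hq => hmin hq⟩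
  refine tendsto_const_nhds.congr' ?_
  filter_upwards [Ioc_mem_nhdsGT (div_pos hr hb)] with ε hε
  have h1 : ∀ j, normalDeriv φ j = fun _ => 0 := fun j => funext fun p =>
    normalDeriv_eq_zero fun h' => (φ.tsupport_subset h').2 rfl
  have h2 : ∀ p, (1 - θ (dilation ε⁻¹ p)) * φ p = φ p := by
    intro p
    by_cases hp : p ∈ tsupport φ
    · rw [hloc.outer, sub_zero, one_mul]
      rw [dilation_apply, norm_smul, Real.norm_of_nonneg (inv_nonneg.2 hε.1.le),
        le_inv_mul_iff₀ hε.1]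
      have := hε.2
      rw [le_div_iff₀ hb] at this
      exact this.trans (hr' p hp)
    · rw [image_eq_zero_of_notMem_tsupport hp, mul_zero]
  have h3 : t.eval (fun _ => 0) = 0 :=
    (FiniteOrder.eval t isCompact_empty (empty_subset _)).map_zero
  simp only [regularized, shellEval, h1, h2, h3, mul_zero, Finset.sum_const_zero, sub_zero]
  exact (CDistribution.eval_coe t φ).symm

end ExtensionSetting

end Extension

/-! ### Wave front set and scaling of extensions -/

section Properties

variable {n d : ℕ} {U : Opens (Sp n d)} {L : Set (Sp n d)}

theorem puncture_le (U : Opens (Sp n d)) : puncture U ≤ U := fun _ hp => hp.1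

theorem coe_monoCLM (φ : 𝓓(puncture U, ℂ)) :
    ((TestFunction.monoCLM ℂ φ : 𝓓(U, ℂ)) : Sp n d → ℂ) = φ := by
  rw [TestFunction.monoCLM_apply, if_pos ⟨le_rfl, puncture_le U⟩]

theorem IsExtension.eval_eq {t : CDistribution (puncture U)} {tbar : CDistribution U}
    (h : IsExtension t tbar) {g : Sp n d → ℂ} (hg : SmoothIn L g) (hL : IsCompact L)
    (hLU : L ⊆ puncture U) : tbar.eval g = t.eval g := by
  rw [hg.eval_eq hL hLU, ← h, ← CDistribution.eval_coe, coe_monoCLM]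
  rfl

theorem IsExtension.scaled {t : CDistribution (puncture U)} {tbar : CDistribution U}
    (h : IsExtension t tbar) (hU : RhoConvex U) (s : ℝ) (m : Ioc (0 : ℝ) 1) :
    IsExtension (scaled hU.puncture s t m) (scaled hU s tbar m) := by
  intro φ
  have hφ := smoothIn_testFunction φ
  have hc : IsCompact (tsupport φ) := φ.hasCompactSupport
  rw [← CDistribution.eval_coe, coe_monoCLM, ← CDistribution.eval_coe,
    eval_scaled hU s tbar m hφ hc (φ.tsupport_subset.trans (puncture_le U)),
    eval_scaled hU.puncture s t m hφ hc φ.tsupport_subset,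
    h.eval_eq (hφ.comp_dilation_inv m.2.1.ne') (hc.image (dilation (m : ℝ)).continuous)
      (hU.puncture.image_subset φ.tsupport_subset m)]

/-- Outside `{h = 0}` the wave front set of an extension is contained in that of the
extended distribution. -/
theorem IsExtension.mem_WF {t : CDistribution (puncture U)} {tbar : CDistribution U}
    (h : IsExtension t tbar) {q : Phase n d} (hq : q ∈ WF tbar) (h0 : q.1.2 ≠ 0) : q ∈ WF t := by
  rw [mem_WF_iff] at hq ⊢
  refine ⟨⟨hq.1, h0⟩, hq.2.1, fun χ hχ ⟨V, hV, hVq, hdec⟩ => ?_⟩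
  have hc := coe_monoCLM χ
  refine hq.2.2 (TestFunction.monoCLM ℂ χ) (by rw [hc]; exact hχ)
    ⟨V, hV, hVq, fun N => (hdec N).imp fun C hC ζ hζ => ?_⟩
  rw [hc, h.eval_eq (.mul_left (contDiff_expo ζ) (smoothIn_testFunction χ)) χ.hasCompactSupport
    χ.tsupport_subset]
  exact hC ζ hζ

theorem scaled_one (hU : RhoConvex U) (s : ℝ) (t : CDistribution U) :
    scaled hU s t ⟨1, one_pos, le_rfl⟩ = t := by
  refine ContinuousLinearMap.ext fun φ => ?_
  have h1 := smoothIn_testFunction φ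
  rw [← CDistribution.eval_coe, ← CDistribution.eval_coe,
    eval_scaled hU s t _ h1 φ.hasCompactSupport φ.tsupport_subset]
  simp

theorem WF_smul_subset (c : ℂ) (t : CDistribution U) : WF (c • t) ⊆ WF t := by
  intro q hq
  rw [mem_WF_iff] at hq ⊢
  refine ⟨hq.1, hq.2.1, fun χ hχ ⟨V, hV, hVq, hdec⟩ => hq.2.2 χ hχ ⟨V, hV, hVq, fun N => ?_⟩⟩
  obtain ⟨C, hC⟩ := hdec N
  refine ⟨‖c‖ * C, fun ζ hζ => ?_⟩
  rw [CDistribution.eval_smul, norm_mul, mul_left_comm]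
  exact mul_le_mul_of_nonneg_left (hC ζ hζ) (norm_nonneg c)

theorem scaled_eq_smul (hU : RhoConvex U) (s s' : ℝ) (t : CDistribution U) (l : Ioc (0 : ℝ) 1) :
    scaled hU s' t l = (((l : ℝ) ^ (s - s') : ℝ) : ℂ) • scaled hU s t l := by
  rw [scaled, scaled, smul_smul, ← Complex.ofReal_mul, ← Real.rpow_add l.2.1]
  congr 3
  ring

/-- Boundedness of `λ^{-s} t_λ` implies that of `λ^{-s'} t_λ` for `s' ≤ s`. -/
theorem BoundedIn.mono_exponent {hU : RhoConvex U} {t : CDistribution U} {Γ : Set (Phase n d)}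
    {s s' : ℝ} (h : BoundedIn Γ (scaledFamily hU s t)) (hs : s' ≤ s) :
    BoundedIn Γ (scaledFamily hU s' t) := by
  have hle : ∀ (l : Ioc (0 : ℝ) 1) (φ : 𝓓(U, ℂ)),
      ‖Microlocal.scaled hU s' t l φ‖ ≤ ‖Microlocal.scaled hU s t l φ‖ := by
    intro l φ
    rw [scaled_eq_smul hU s s' t l]
    change ‖(((l : ℝ) ^ (s - s') : ℝ) : ℂ) * Microlocal.scaled hU s t l φ‖ ≤ _
    rw [norm_mul, Complex.norm_real, Real.norm_of_nonneg (Real.rpow_nonneg l.2.1.le _)]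
    exact mul_le_of_le_one_left (norm_nonneg _)
      (Real.rpow_le_one l.2.1.le l.2.2 (sub_nonneg.2 hs))
  refine ⟨?_, fun φ => (h.2.1 φ).imp ?_, fun N V χ hV hd => (h.2.2 N V χ hV hd).imp ?_⟩
  · rintro _ ⟨l, rfl⟩
    refine subset_trans ?_ (h.1 _ ⟨l, rfl⟩)
    change WF (Microlocal.scaled hU s' t l) ⊆ _
    rw [scaled_eq_smul hU s s' t l]
    exact WF_smul_subset _ _
  · rintro C hC _ ⟨l, rfl⟩
    exact (hle l φ).trans (hC _ ⟨l, rfl⟩)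
  · rintro C hC _ ⟨l, rfl⟩ ζ hζ
    refine le_trans ?_ (hC _ ⟨l, rfl⟩ ζ hζ)
    have := covNorm_nonneg ζ
    gcongr
    exact hle l _

end Properties

/-! ### Cones of covectors which avoid the conormal directions -/

section Cones

variable {n d : ℕ}

/-- The cone of the covectors `(k, ξ)` with `k ≠ 0` and `|k| ≥ c|ξ|`. -/
def tangentialCone (c : ℝ) : Set (Sp n d) := {ζ | ζ.1 ≠ 0 ∧ c * ‖ζ.2‖ ≤ ‖ζ.1‖}

theorem isClosedCone_tangentialCone {c : ℝ} (hc : 0 < c) :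
    IsClosedCone (tangentialCone c : Set (Sp n d)) := by
  refine ⟨fun h => h.1 rfl, fun ζ hζ r hr => ⟨smul_ne_zero hr.ne' hζ.1, ?_⟩, ?_⟩
  · rw [Prod.smul_fst, Prod.smul_snd, norm_smul, norm_smul, mul_left_comm]
    exact mul_le_mul_of_nonneg_left hζ.2 (norm_nonneg _)
  · have : insert 0 (tangentialCone c) = {ζ : Sp n d | c * ‖ζ.2‖ ≤ ‖ζ.1‖} := by
      ext ζ
      refine ⟨?_, fun h => ?_⟩
      · rintro (rfl | h)
        · simp
        · exact h.2
      · by_cases h1 : ζ.1 = 0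
        · left
          have h' : c * ‖ζ.2‖ ≤ ‖ζ.1‖ := h
          rw [h1, norm_zero] at h'
          have h2 : ‖ζ.2‖ = 0 := le_antisymm (by nlinarith [norm_nonneg ζ.2]) (norm_nonneg _)
          exact Prod.ext h1 (norm_eq_zero.1 h2)
        · exact Or.inr ⟨h1, h⟩
    rw [this]
    exact isClosed_le (by fun_prop) (by fun_prop)

theorem isClosedCone_horizontal : IsClosedCone {ζ : Sp n d | ζ.1 ≠ 0 ∧ ζ.2 = 0} := by
  refine ⟨fun h => h.1 rfl, fun ζ hζ r hr => ⟨smul_ne_zero hr.ne' hζ.1, ?_⟩, ?_⟩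
  · rw [Prod.smul_snd, hζ.2, smul_zero]
  · have : insert 0 {ζ : Sp n d | ζ.1 ≠ 0 ∧ ζ.2 = 0} = {ζ : Sp n d | ζ.2 = 0} := by
      ext ζ
      refine ⟨?_, fun h => ?_⟩
      · rintro (rfl | h)
        · rfl
        · exact h.2
      · by_cases h1 : ζ.1 = 0
        · exact Or.inl (Prod.ext h1 h)
        · exact Or.inr ⟨h1, h⟩
    rw [this]
    exact isClosed_eq continuous_snd continuous_const

/-- A closed cone without conormal covectors has a positive angle to them, by compactness of the unit
sphere. -/
theorem IsClosedCone.subset_tangentialCone {W : Set (Sp n d)} (hW : IsClosedCone W)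
    (h : ∀ ζ ∈ W, ζ.1 ≠ 0) : ∃ c > 0, W ⊆ tangentialCone c := by
  have hcomp : IsCompact (insert 0 W ∩ Metric.sphere (0 : Sp n d) 1) :=
    (isCompact_sphere _ _).inter_left hW.2.2
  have hmem : ∀ ζ ∈ W, ‖ζ‖⁻¹ • ζ ∈ insert 0 W ∩ Metric.sphere (0 : Sp n d) 1 := by
    intro ζ hζ
    have h0 : ζ ≠ 0 := fun h0 => hW.1 (h0 ▸ hζ)
    exact ⟨Or.inr (hW.2.1 ζ hζ _ (inv_pos.2 (norm_pos_iff.2 h0))),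
      by rw [mem_sphere_zero_iff_norm, norm_smul, norm_inv, norm_norm,
        inv_mul_cancel₀ (norm_ne_zero_iff.2 h0)]⟩
  rcases (insert 0 W ∩ Metric.sphere (0 : Sp n d) 1).eq_empty_or_nonempty with h0 | h0
  · exact ⟨1, one_pos, fun ζ hζ => absurd (hmem ζ hζ) (by rw [h0]; simp)⟩
  · obtain ⟨η, hη, hmin⟩ := hcomp.exists_isMinOn h0 (continuous_fst.norm).continuousOn
    have hηW : η ∈ W := by
      refine hη.1.resolve_left fun h1 => ?_
      have := hη.2
      rw [h1, mem_sphere_zero_iff_norm, norm_zero] at this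
      exact zero_ne_one this
    refine ⟨‖η.1‖, norm_pos_iff.2 (h η hηW), fun ζ hζ => ⟨h ζ hζ, ?_⟩⟩
    have hζ0 : ζ ≠ 0 := fun h0 => hW.1 (h0 ▸ hζ)
    have h1 : ‖η.1‖ ≤ ‖(‖ζ‖⁻¹ • ζ).1‖ := hmin (hmem ζ hζ)
    rw [Prod.smul_fst, norm_smul, norm_inv, norm_norm, le_inv_mul_iff₀ (norm_pos_iff.2 hζ0)] at h1
    calc ‖η.1‖ * ‖ζ.2‖ ≤ ‖η.1‖ * ‖ζ‖ := by gcongr; exact norm_snd_le ζ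
      _ ≤ _ := by linarith

/-- In `tangentialCone c`, the component `k` controls the whole covector, so that `(k, λξ)` is as large
as `(k, ξ)` up to a constant, even for `λ = 0`. -/
theorem one_add_covNorm_le {c : ℝ} (hc : 0 < c) {ζ : Sp n d} (hζ : ζ ∈ tangentialCone c) {l : ℝ}
    (hl : 0 ≤ l) : 1 + covNorm ζ ≤ (1 + c⁻¹) * (1 + covNorm (dilation l ζ)) := by
  have h1 : ‖ζ.2‖ ≤ c⁻¹ * ‖ζ.1‖ := by
    rw [le_inv_mul_iff₀ hc]
    exact hζ.2
  have h2 : 0 ≤ l * ‖ζ.2‖ := mul_nonneg hl (norm_nonneg _)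
  have h3 := norm_nonneg ζ.1
  have h4 := inv_pos.2 hc
  simp only [covNorm, dilation_apply, norm_smul, Real.norm_of_nonneg hl]
  nlinarith [mul_nonneg h4.le h2]

end Cones

/-! ### Bounds for the extension -/

section Bounds

variable {n d : ℕ} {s : ℝ} {L : Set (Sp n d)} {Ω : Opens (EuclideanSpace ℝ (Fin n))}
  {𝒱 𝒩 : Opens (Sp n d)} {hρ : RhoConvex 𝒱} {t : CDistribution (puncture 𝒱)} {χ : Sp n d → ℝ}
  {M : ℕ}

namespace ExtensionSetting

variable (h : ExtensionSetting Ω hρ s t χ M 𝒩) {tbar : CDistribution 𝒱}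
  (htbar : ∀ φ : 𝓓(𝒱, ℂ),
    Tendsto (regularized t (fun p => (χ p : ℂ)) M φ) (𝓝[>] 0) (𝓝 (tbar φ)))
include htbar

/-- The normalization `m^{-(s+d)}` in the main estimate is the one which occurs in `m^{-s} t_m`,
evaluated at a dilated test function. -/
theorem norm_scaled_eval {g : Sp n d → ℂ} (hg : SmoothIn L g) (hL : IsCompact L) (hLU : L ⊆ 𝒱)
    (m : Ioc (0 : ℝ) 1) {y : ℂ}
    (hy : Tendsto (regularized t (fun p => (χ p : ℂ)) M fun p => g (dilation (m : ℝ)⁻¹ p))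
      (𝓝[>] 0) (𝓝 y)) :
    ‖(scaled hρ s tbar m).eval g‖ = (m : ℝ) ^ (-(s + d)) * ‖y‖ := by
  have h1 := tendsto_eval htbar (hg.comp_dilation_inv m.2.1.ne')
    (hL.image (dilation (m : ℝ)).continuous) (hρ.image_subset hLU m)
  rw [eval_scaled hρ s tbar m hg hL hLU, tendsto_nhds_unique hy h1, norm_mul, Complex.norm_real,
    Real.norm_of_nonneg (Real.rpow_nonneg m.2.1.le _)]

include h

theorem exists_weak_bound (φ : 𝓓(𝒱, ℂ)) : ∃ C, ∀ m, ‖scaled hρ s tbar m φ‖ ≤ C := by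
  have hφ := smoothIn_testFunction φ
  obtain ⟨C, hC⟩ := h.exists_tendsto_weak hφ φ.hasCompactSupport φ.tsupport_subset
  refine ⟨C, fun m => ?_⟩
  obtain ⟨y, hy, hyC⟩ := hC m
  rwa [← CDistribution.eval_coe,
    norm_scaled_eval htbar hφ φ.hasCompactSupport φ.tsupport_subset m hy]

/-- Uniform rapid decrease of the extension in cones away from the conormal directions. The loss of
the factor `(1 + |ξ|)^M` in the main estimate is compensated by applying it with `N + M` in place
of `N`. -/
theorem exists_cone_bound (φ : 𝓓(𝒱, ℂ)) {W : Set (Sp n d)} (hW : IsClosedCone W) {c : ℝ}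
    (hc : 0 < c) (hWc : W ⊆ tangentialCone c)
    (hdisj : ∀ q ∈ scaledWF hρ.puncture t, q.1 ∈ tsupport φ → q.2 ∉ W) (N : ℕ) :
    ∃ C, ∀ m, ∀ ζ ∈ W, (1 + covNorm ζ) ^ N * ‖localFourier (scaled hρ s tbar m) φ ζ‖ ≤ C := by
  have hφ := smoothIn_testFunction φ
  have hφc : IsCompact (tsupport φ) := φ.hasCompactSupport
  have hφ𝒱 := φ.tsupport_subset
  obtain ⟨K', a, b, κ, θ, hloc⟩ := h.exists_localized hφc hφ𝒱
  obtain ⟨r, hr, δ, hδ, hland⟩ := h.soft.exists_uniform hloc.isCompact hloc.subset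
  obtain ⟨e, he, hbe, hcyl⟩ := h.exists_scale hloc (r := min r (c / (2 * δ))) (by positivity)
  have hφK : ∀ p : Sp n d, p.1 ∉ Prod.fst '' tsupport φ → φ p = 0 := fun p hp =>
    hφ.zero_off p fun h => hp ⟨p, h, rfl⟩
  have hθ := hloc.localCutoff he.1
  have hs := hθ.smoothIn_one_sub_mul hφ fun p hp => hφK p fun hpK => hp (hloc.one p.1 hpK)
  have hone : ∀ ζ : Sp n d, 1 ≤ 1 + covNorm ζ := fun ζ => by linarith [covNorm_nonneg ζ]
  obtain ⟨C₂, hC₂⟩ := h.bounded.scaledBound_cone (hU := hρ) (isCompact_shell hφc (a * e))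
    (shell_subset_puncture hφ𝒱 hθ.pos) (Λ := {1}) (Z := W) hW (fun q hq hq1 => hdisj q hq hq1.1)
    (fun ζ hζ l hl => by
      obtain rfl : l = 1 := hl
      rwa [dilation_one]) zero_le_one
    (fun ζ hζ l hl => by
      obtain rfl : l = 1 := hl
      rw [dilation_one, one_mul]) (N + M) _ hs
  -- Soft landing: on the cylinder `|h| ≤ be` the wave front sets satisfy `|k| ≤ (c/2)|ξ|`.
  have hH1 := h.bounded.scaledBound_cone (hU := hρ)
    (isCompact_shell hθ.isCompact (a * e / 2)) (shell_subset_puncture hcyl (half_pos hθ.pos))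
    (Λ := Icc 0 1) (Z := W) (isClosedCone_tangentialCone hc)
    (fun q hq hq1 hq2 => by
      have h1 := scaledWF_softLanding hρ.puncture hland hq hq1.1.1
        (hq1.1.2.trans (hbe.trans (min_le_left _ _)))
      have h2 : ‖q.1.2‖ ≤ c / (2 * δ) := hq1.1.2.trans (hbe.trans (min_le_right _ _))
      have h3 : δ * ‖q.1.2‖ ≤ c / 2 := by
        calc δ * ‖q.1.2‖ ≤ δ * (c / (2 * δ)) := by gcongr
          _ = c / 2 := by field_simp
      have h4 : ‖q.2.1‖ ≤ c / 2 * ‖q.2.2‖ := h1.trans (by gcongr)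
      have h5 := norm_pos_iff.2 hq2.1
      have h6 := hq2.2
      linarith)
    (fun ζ hζ l hl => ⟨(hWc hζ).1, by
      have h1 := (hWc hζ).2
      rw [dilation_apply, norm_smul, Real.norm_of_nonneg hl.1]
      refine le_trans ?_ h1
      gcongr
      exact mul_le_of_le_one_left (norm_nonneg _) hl.2⟩)
    (by positivity) (fun ζ hζ l hl => one_add_covNorm_le hc (hWc hζ) hl.1) (N + M)
  -- The counterterms only involve the covectors `(k, 0)`, and `𝒩` excludes these altogether.
  have hH3 : ∀ L : Set (Sp n d), IsCompact L → L ⊆ 𝒩 → L ⊆ puncture 𝒱 →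
      ScaledBound hρ s t L {0} W fun ζ => (1 + covNorm ζ) ^ (N + M) := fun L hL hL𝒩 hLU =>
    h.bounded.scaledBound_cone (hU := hρ) hL hLU isClosedCone_horizontal
      (fun q hq hq1 hq2 => hq2.1 (h.landing q hq (hL𝒩 hq1) hq2.2))
      (fun ζ hζ l hl => by
        obtain rfl : l = 0 := hl
        exact ⟨(hWc hζ).1, zero_smul ℝ _⟩)
      (by positivity)
      (fun ζ hζ l hl => one_add_covNorm_le hc (hWc hζ) (le_of_eq (Eq.symm hl))) (N + M)
  obtain ⟨C, hC⟩ := h.exists_tendsto hloc (hφc.image continuous_fst) hφ hφc hφ𝒱 hφK he hcyl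
    (fun ζ => pow_pos (one_pos.trans_le (hone ζ)) _) hH1
    ⟨max C₂ 0, fun m ζ hζ => by
      have h1 := hC₂ m ζ hζ 1 rfl
      rw [dilation_one] at h1
      simp only [mul_left_comm (expo ζ _)] at h1
      refine h1.trans ((le_max_left C₂ 0).trans (le_mul_of_one_le_right (le_max_right _ _)
        (one_le_pow₀ (by linarith [norm_nonneg ζ.2]))))⟩ hH3
  refine ⟨max C 0, fun m ζ hζ => ?_⟩
  obtain ⟨y, hy, hyC⟩ := hC m ζ hζ
  rw [localFourier_eq_eval, norm_scaled_eval htbar (.mul_left (contDiff_expo ζ) hφ) hφc hφ𝒱 m hy]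
  have hpos : 0 < (1 + covNorm ζ) ^ M := pow_pos (one_pos.trans_le (hone ζ)) _
  refine le_of_mul_le_mul_right ?_ hpos
  calc (1 + covNorm ζ) ^ N * ((m : ℝ) ^ (-(s + d)) * ‖y‖) * (1 + covNorm ζ) ^ M
      = (1 + covNorm ζ) ^ (N + M) * ((m : ℝ) ^ (-(s + d)) * ‖y‖) := by rw [pow_add]; ring
    _ ≤ C * (1 + ‖ζ.2‖) ^ M := hyC
    _ ≤ max C 0 * (1 + covNorm ζ) ^ M := by
      have h1 : ‖ζ.2‖ ≤ covNorm ζ := le_add_of_nonneg_left (norm_nonneg _)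
      gcongr
      exact le_max_left _ _

/-- Over `{h = 0}` the wave front sets of the scaled extensions are conormal. -/
theorem mem_conormal {m : Ioc (0 : ℝ) 1} {q : Phase n d} (hq : q ∈ WF (scaled hρ s tbar m))
    (h0 : q.1.2 = 0) : q ∈ conormal Ω := by
  rw [mem_WF_iff] at hq
  have hqΩ : q.1.1 ∈ Ω := h.fst_mem _ hq.1
  have hk : q.2.1 = 0 := by
    by_contra hk
    obtain ⟨K, hK, hxK, hKΩ⟩ := exists_compact_between (isCompact_singleton (x := q.1.1))
      Ω.isOpen (singleton_subset_iff.2 hqΩ)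
    obtain ⟨r, hr, δ, hδ, hland⟩ := h.soft.exists_uniform hK hKΩ
    have hkp : 0 < ‖q.2.1‖ := norm_pos_iff.2 hk
    -- The cone `|k| ≥ c|ξ|` is a neighbourhood of the covector, and close to `{h = 0}` it contains
    -- no element of the wave front sets of the family, by soft landing.
    set c : ℝ := ‖q.2.1‖ / (‖q.2.2‖ + 1) with hcdef
    have hc : 0 < c := div_pos hkp (by positivity)
    have hcq : c * ‖q.2.2‖ < ‖q.2.1‖ := by
      rw [hcdef, div_mul_eq_mul_div, div_lt_iff₀ (by positivity)]
      nlinarith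
    let O : Set (Sp n d) := 𝒱 ∩ {p | p.1 ∈ interior K} ∩ {p | ‖p.2‖ < min r (c / (2 * δ))}
    have hO : IsOpen O := (𝒱.isOpen.inter (isOpen_interior.preimage continuous_fst)).inter
      (isOpen_lt continuous_snd.norm continuous_const)
    have hqO : q.1 ∈ O := by
      refine ⟨⟨hq.1, hxK rfl⟩, ?_⟩
      change ‖q.1.2‖ < _
      rw [h0, norm_zero]
      positivity
    obtain ⟨f, hfO, hfc, hfs, -, hf1⟩ :=
      exists_contDiff_tsupport_subset (n := ⊤) (hO.mem_nhds hqO)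
    have hfS : SmoothIn (tsupport f) fun p => (f p : ℂ) :=
      ⟨Complex.ofRealCLM.contDiff.comp hfs, fun p hp => by
        rw [image_eq_zero_of_notMem_tsupport hp, Complex.ofReal_zero]⟩
    have hf𝒱 : tsupport f ⊆ 𝒱 := fun p hp => (hfO hp).1.1
    refine hq.2.2 (hfS.toTest hfc hf𝒱) ?_ ⟨tangentialCone c,
      (isClosedCone_tangentialCone hc).2.1, ?_, fun N => ?_⟩
    · change (f q.1 : ℂ) ≠ 0
      rw [hf1, Complex.ofReal_one]
      exact one_ne_zero
    · have ho : IsOpen {ζ : Sp n d | ζ.1 ≠ 0 ∧ c * ‖ζ.2‖ < ‖ζ.1‖} :=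
        (isOpen_ne.preimage continuous_fst).inter
          (isOpen_lt (continuous_const.mul continuous_snd.norm) continuous_fst.norm)
      filter_upwards [ho.mem_nhds ⟨hk, hcq⟩] with ζ hζ
      exact ⟨hζ.1, hζ.2.le⟩
    · obtain ⟨C, hC⟩ := h.exists_cone_bound htbar (hfS.toTest hfc hf𝒱)
        (isClosedCone_tangentialCone hc) hc subset_rfl (fun q' hq' hq1 hq2 => by
          have hm := hfO (hfS.tsupport_toTest_subset hfc hf𝒱 hq1)
          have hm2 : ‖q'.1.2‖ < min r (c / (2 * δ)) := hm.2
          have h1 := scaledWF_softLanding hρ.puncture hland hq' (interior_subset hm.1.2)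
            (hm2.le.trans (min_le_left _ _))
          have h3 : δ * ‖q'.1.2‖ ≤ c / 2 := by
            calc δ * ‖q'.1.2‖ ≤ δ * (c / (2 * δ)) := by
                  gcongr
                  exact hm2.le.trans (min_le_right _ _)
              _ = c / 2 := by field_simp
          have h4 : ‖q'.2.1‖ ≤ c / 2 * ‖q'.2.2‖ := h1.trans (by gcongr)
          have h5 := norm_pos_iff.2 hq2.1
          have h6 := hq2.2
          linarith) N
      refine ⟨C, fun ζ hζ => ?_⟩
      rw [← localFourier_eq_eval]
      exact hC m ζ hζ
  exact ⟨hqΩ, h0, hk, fun hξ => hq.2.1 (Prod.ext hk hξ)⟩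

theorem WF_subset : WF tbar ⊆ WF t ∪ conormal Ω := by
  intro q hq
  by_cases h0 : q.1.2 = 0
  · exact Or.inr (h.mem_conormal htbar (m := ⟨1, one_pos, le_rfl⟩) (by rwa [scaled_one]) h0)
  · exact Or.inl ((h.isExtension htbar).mem_WF hq h0)

theorem boundedIn :
    BoundedIn (scaledWF hρ.puncture t ∪ conormal Ω) (scaledFamily hρ s tbar) := by
  refine ⟨?_, fun φ => ?_, fun N V φ hV hdisj => ?_⟩
  · rintro _ ⟨m, rfl⟩ q hq
    by_cases h0 : q.1.2 = 0
    · exact Or.inr (h.mem_conormal htbar hq h0)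
    · exact Or.inl (h.bounded.1 _ ⟨m, rfl⟩
        (((h.isExtension htbar).scaled hρ s m).mem_WF hq h0))
  · obtain ⟨C, hC⟩ := h.exists_weak_bound htbar φ
    refine ⟨C, ?_⟩
    rintro _ ⟨m, rfl⟩
    exact hC m
  · have hφ := smoothIn_testFunction φ
    have hφc : IsCompact (tsupport φ) := φ.hasCompactSupport
    have hdisj' : ∀ q ∈ scaledWF hρ.puncture t ∪ conormal Ω, q.1 ∈ tsupport φ → q.2 ∉ V :=
      fun q hq h1 h2 => eq_empty_iff_forall_notMem.1 hdisj q ⟨⟨h1, h2⟩, hq⟩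
    by_cases hex : ∃ p ∈ tsupport φ, p.2 = 0
    · obtain ⟨p, hp, hp0⟩ := hex
      obtain ⟨c, hc, hVc⟩ := hV.subset_tangentialCone fun ζ hζ h0 =>
        hdisj' (p, ζ) (Or.inr ⟨h.fst_mem p (φ.tsupport_subset hp), hp0, h0, fun h1 =>
          hV.1 (by rwa [show ζ = 0 from Prod.ext h0 h1] at hζ)⟩) hp hζ
      obtain ⟨C, hC⟩ := h.exists_cone_bound htbar φ hV hc hVc
        (fun q hq => hdisj' q (Or.inl hq)) N
      refine ⟨C, ?_⟩
      rintro _ ⟨m, rfl⟩ ζ hζ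
      exact hC m ζ hζ
    · -- Away from `{h = 0}` the extension is the original distribution.
      have hφU : tsupport φ ⊆ puncture 𝒱 := fun p hp =>
        ⟨φ.tsupport_subset hp, fun h0 => hex ⟨p, hp, h0⟩⟩
      obtain ⟨C, hC⟩ := h.bounded.2.2 N V (hφ.toTest hφc hφU) hV
        (eq_empty_iff_forall_notMem.2 fun q hq => hdisj' q (Or.inl hq.2)
          (hφ.tsupport_toTest_subset hφc hφU hq.1.1) hq.1.2)
      refine ⟨C, ?_⟩
      rintro _ ⟨m, rfl⟩ ζ hζ
      have h1 := hC _ ⟨m, rfl⟩ ζ hζ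
      rw [localFourier_eq_eval] at h1 ⊢
      have h2 := ((h.isExtension htbar).scaled hρ s m).eval_eq
        (.mul_left (contDiff_expo ζ) hφ) hφc hφU
      change (1 + covNorm ζ) ^ N * ‖(scaled hρ s tbar m).eval fun p => expo ζ p * φ p‖ ≤ C
      rw [h2]
      exact h1

omit htbar

/-- The regularized functional in terms of the Taylor polynomial of degree `m = M - 1`. Splitting the
pairing with the Taylor polynomial into its terms is legitimate because `χ - χ_{ε⁻¹}` has compact
support in `𝒱 ∖ {h = 0}` over the support of `φ`. -/
theorem regularized_succ_eq {m : ℕ} (hM : M = m + 1) (φ : 𝓓(𝒱, ℂ)) {ε : ℝ}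
    (hε : ε ∈ Ioc (0 : ℝ) 1) :
    regularized t (fun p => (χ p : ℂ)) M φ ε =
      ((t.eval fun p => ((χ p - χ (dilation ε⁻¹ p) : ℝ) : ℂ) * φ p) -
        (t.eval fun p => ((χ p - χ (dilation ε⁻¹ p) : ℝ) : ℂ) * taylorH m φ p)) +
      t.eval fun p => ((1 - χ p : ℝ) : ℂ) * φ p := by
  have hφ := smoothIn_testFunction φ
  have hφc : IsCompact (tsupport φ) := φ.hasCompactSupport
  obtain ⟨K', a, b, κ, θ, hloc⟩ := h.exists_localized hφc φ.tsupport_subset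
  have hKc : IsClosed (Prod.fst '' tsupport φ) := (hφc.image continuous_fst).isClosed
  have hφK : ∀ p : Sp n d, p.1 ∉ Prod.fst '' tsupport φ → φ p = 0 := fun p hp =>
    hφ.zero_off p fun h => hp ⟨p, h, rfl⟩
  obtain ⟨S, hS, hS𝒩⟩ := hloc.exists_localCutoff h.zero_mem_nhds h.rhoConvex
    (h.supportedIn (by omega))
  have h1 : ∀ f : Sp n d → ℂ, (∀ p : Sp n d, p.1 ∉ Prod.fst '' tsupport φ → f p = 0) →
      (fun p => ((χ p - χ (dilation ε⁻¹ p) : ℝ) : ℂ) * f p) =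
        fun p => (θ p - θ (dilation ε⁻¹ p)) * f p := by
    intro f hf
    ext p
    by_cases hp : p.1 ∈ Prod.fst '' tsupport φ
    · rw [hloc.eq p hp, hloc.eq (dilation ε⁻¹ p) hp, Complex.ofReal_sub]
    · simp [hf p hp]
  have h2 : (fun p => ((1 - χ p : ℝ) : ℂ) * φ p) = fun p => (1 - θ p) * φ p := by
    ext p
    by_cases hp : p.1 ∈ Prod.fst '' tsupport φ
    · rw [hloc.eq p hp, Complex.ofReal_sub, Complex.ofReal_one]
    · simp [hφK p hp]
  have htaylor : taylorH m φ = taylorPoly M φ := by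
    rw [hM]
    rfl
  rw [htaylor, h1 φ hφK, h1 _ fun p hp => taylorPoly_eq_zero_of_fst hKc hφK hp, h2,
    hloc.regularized_eq hKc hφK]
  have hsub := hS.smoothIn_sub_inv hε
  have hsubU := shell_subset_puncture (hS𝒩.trans h.le) (mul_pos hS.pos hε.1)
  have hcS := isCompact_shell hS.isCompact (a * ε)
  have hA := hsub.mul_right hφ.contDiff
  have hB := hS.smoothIn_one_sub_mul hφ fun p hp => hφK p fun hpK => hp (hloc.one p.1 hpK)
  have hcB := isCompact_shell hφc a
  have hBU := shell_subset_puncture φ.tsupport_subset hS.pos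
  have hadd := (FiniteOrder.eval t (hcS.union hcB) (union_subset hsubU hBU)).map_add _ _
    (hA.mono subset_union_left) (hB.mono subset_union_right)
  have e1 : (fun p => (θ p - θ (dilation ε⁻¹ p)) * φ p + (1 - θ p) * φ p) =
      fun p => (1 - θ (dilation ε⁻¹ p)) * φ p := by
    ext p
    ring
  rw [e1] at hadd
  have hT := (FiniteOrder.eval t hcS hsubU).apply_taylorPoly hsub hφ.contDiff M
  rw [regularized, hadd, hT]
  simp only [shellEval]
  ring

end ExtensionSetting

end Bounds

end Microlocal

end

/-! ### Extension of distributions -/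

theorem mainTheorem3 (n d : ℕ) (s : ℝ)
    (Ω : Opens (EuclideanSpace ℝ (Fin n)))
    (𝒱 : Opens (Sp n d))
    (h𝒱 : ∀ p ∈ 𝒱, p.1 ∈ Ω)
    (hI : ∀ x ∈ Ω, ((x, 0) : Sp n d) ∈ 𝒱)
    (hρ : RhoConvex 𝒱)
    (t : CDistribution (puncture 𝒱))
    (hsoft : SoftLanding Ω (WF t))
    (hbdd : BoundedIn (scaledWF hρ.puncture t) (scaledFamily hρ.puncture s t)) :
    (0 < s + d →
      ∀ χ : Sp n d → ℝ, IsCutoff Ω χ →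
        ∃ tbar : CDistribution 𝒱, IsExtension t tbar ∧ IsCutoffLimit t χ tbar ∧
          WF tbar ⊆ WF t ∪ conormal Ω ∧
          BoundedIn (scaledWF hρ.puncture t ∪ conormal Ω) (scaledFamily hρ s tbar)) ∧
    (∀ m : ℕ, -(m : ℝ) - 1 < s + d → s + d ≤ -(m : ℝ) →
      ∃ 𝒩 : Opens (Sp n d), 𝒩 ≤ 𝒱 ∧ (∀ x ∈ Ω, ((x, 0) : Sp n d) ∈ 𝒩) ∧
        ∀ χ : Sp n d → ℝ, IsCutoff Ω χ → CutoffSupportedIn Ω χ 𝒩 →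
          ∃ tbar : CDistribution 𝒱, IsExtension t tbar ∧ IsRenormalizedLimit t m χ tbar ∧
            WF tbar ⊆ WF t ∪ conormal Ω ∧
            ((¬ ∃ j : ℕ, -s - d = j) →
              BoundedIn (scaledWF hρ.puncture t ∪ conormal Ω) (scaledFamily hρ s tbar)) ∧
            ((∃ j : ℕ, -s - d = j) → ∀ s' < s,
              BoundedIn (scaledWF hρ.puncture t ∪ conormal Ω) (scaledFamily hρ s' tbar))) := by
  obtain ⟨𝒩, h𝒩𝒱, hI𝒩, hρ𝒩, hland⟩ := hsoft.exists_nhds hI hρ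
  refine ⟨fun hs χ hχ => ?_, fun m hm1 hm2 => ⟨𝒩, h𝒩𝒱, hI𝒩, fun χ hχ hsupp => ?_⟩⟩
  · have h : ExtensionSetting Ω hρ s t χ 0 𝒩 :=
      ⟨h𝒱, hI, hsoft, hbdd, hχ, h𝒩𝒱, hI𝒩, hρ𝒩, hland, fun h => absurd h (lt_irrefl _),
        by simpa using hs, fun j hj => absurd hj j.not_lt_zero⟩
    obtain ⟨tbar, htbar⟩ := h.exists_limit
    refine ⟨tbar, h.isExtension htbar, fun φ => ?_, h.WF_subset htbar, h.boundedIn htbar⟩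
    refine (htbar φ).congr fun ε => ?_
    simp [regularized]
  · have setting : ∀ s₁ ≤ s, s₁ + d < -(m : ℝ) → -(m : ℝ) - 1 < s₁ + d →
        ExtensionSetting Ω hρ s₁ t χ (m + 1) 𝒩 := fun s₁ hs₁ hneg hpos =>
      ⟨h𝒱, hI, hsoft, hbdd.mono_exponent hs₁, hχ, h𝒩𝒱, hI𝒩, hρ𝒩, hland, fun _ => hsupp,
        by push_cast; linarith, fun j hj => by
          have : (j : ℝ) ≤ m := mod_cast Nat.lt_succ_iff.1 hj
          linarith⟩
    have hlimit : ∀ {s₁ : ℝ} (h : ExtensionSetting Ω hρ s₁ t χ (m + 1) 𝒩) {tbar : CDistribution 𝒱},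
        (∀ φ : 𝓓(𝒱, ℂ), Tendsto (regularized t (fun p => (χ p : ℂ)) (m + 1) φ) (𝓝[>] 0)
          (𝓝 (tbar φ))) → IsRenormalizedLimit t m χ tbar := by
      intro s₁ h tbar htbar φ
      refine (htbar φ).congr' ?_
      filter_upwards [Ioc_mem_nhdsGT (zero_lt_one' ℝ)] with ε hε
      exact h.regularized_succ_eq rfl φ hε
    by_cases hj : ∃ j : ℕ, -s - d = j
    · have setting' : ∀ s₁ < s, -(m : ℝ) - 1 < s₁ + d →
          ExtensionSetting Ω hρ s₁ t χ (m + 1) 𝒩 := fun s₁ h1 h2 =>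
        setting s₁ h1.le (by linarith) h2
      have hsm : s + d = -(m : ℝ) := by
        obtain ⟨j, hj⟩ := hj
        have h1 : (m : ℝ) ≤ j := by linarith
        have h2 : (j : ℝ) < m + 1 := by linarith
        have h3 : m ≤ j := mod_cast h1
        have h4 : j < m + 1 := mod_cast h2
        obtain rfl : j = m := by omega
        linarith
      have h := setting' (s - 1 / 2) (by linarith) (by linarith)
      obtain ⟨tbar, htbar⟩ := h.exists_limit
      refine ⟨tbar, h.isExtension htbar, hlimit h htbar, h.WF_subset htbar,
        fun h' => absurd hj h', fun _ s' hs' => ?_⟩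
      -- The limit does not depend on the exponent, so it is the extension for exponents near `s`.
      have h' := setting' (max s' (s - 1 / 2)) (max_lt hs' (by linarith))
        (by linarith [le_max_right s' (s - 1 / 2)])
      exact (h'.boundedIn htbar).mono_exponent (le_max_left _ _)
    · have hsm : s + d < -(m : ℝ) := lt_of_le_of_ne hm2 fun h => hj ⟨m, by linarith⟩
      have h := setting s le_rfl hsm hm1
      obtain ⟨tbar, htbar⟩ := h.exists_limit
      exact ⟨tbar, h.isExtension htbar, hlimit h htbar, h.WF_subset htbar,
        fun _ => h.boundedIn htbar, fun h' => absurd h' hj⟩
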